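/- Let $(M,I,J,K)$ be a hypercomplex manifold: $I,J,K$ are integrable complex structures with $IJ=-JI=K$, acting on tangent vectors on the right, and on forms by $(L\eta)(X_1,\dots,X_k)=\eta(X_1\circ L,\dots,X_k\circ L)$. Let $\Lambda^{p,q}_I(M)$ be the smooth complex $(p,q)$-forms on $(M,I)$ (so $\eta(X\circ I)=\sqrt{-1}\,\eta(X)$ for $\eta\in\Lambda^{1,0}_I$), with $\partial,\bar\partial$ the Dolbeault differentials of $(M,I)$ and $\partial_J:=J^{-1}\circ\bar\partial\circ J:\Lambda^{k,0}_I(M)\to\Lambda^{k+1,0}_I(M)$. Unit quaternions $SU(2)\subset\mathbb H^*$ act on $\Lambda^k(M,\mathbb C)$ by $(u\eta)(X_1,\dots,X_k)=\eta(X_1\circ u,\dots,X_k\circ u)$. The irreducible representation of $SU(2)$ of weight $w$ is the one of complex dimension $w+1$. Let $\Lambda^k_+$ be the sum of the irreducible subrepresentations of $\Lambda^k$ of weight $k$, $V^k$ the sum of those of weight less than $k$, $P_+:\Lambda^k=\Lambda^k_+\oplus V^k\to\Lambda^k_+$ the projection, and $\Lambda^{p,q}_{I,+}:=\Lambda^{p+q}_+\cap\Lambda^{p,q}_I$.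 With $h_1=1$, $h_2=J$ and $k=p+q$, the map $$\eta\mapsto h_1^ph_2^q\,\eta,\qquad (h_1^ph_2^q\,\eta)(X_1,\dots,X_k)=\frac1{k!}\sum_{\sigma\in\Sigma_k}\eta(X_1\circ a_{\sigma(1)},\dots,X_k\circ a_{\sigma(k)}),$$ where $a_1=\dots=a_p=1$ and $a_{p+1}=\dots=a_k=J$, is an isomorphism $\Lambda^{k,0}_I(M)\to\Lambda^{p,q}_{I,+}(M)$. Let $R:\Lambda^{p,q}_I(M)\to\Lambda^{p+q,0}_I(M)$ be the composition of $P_+:\Lambda^{p,q}_I(M)\to\Lambda^{p,q}_{I,+}(M)$ with the inverse of this isomorphism. A real $(1,1)$-form $\omega$ is positive if $\omega(X,X\circ I)\ge0$ for every real tangent vector $X$. A $(2p,0)$-form $\eta$ is q-real if $J\bar\eta=\eta$; a q-real $(2,0)$-form $\eta$ is q-positive if $\eta(X,X\circ J)\ge0$ for every real tangent vector $X$. A $(p,p)$-form is strongly positive (a $(2p,0)$-form is strongly q-positive) if at every point it lies in the convex cone generated by the $p$-fold products of positive $(1,1)$-forms (of q-positive $(2,0)$-forms). Then the spaces and maps above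 are well defined, with the decompositions and isomorphisms stated, $R$ maps smooth $(p,q)$-forms to smooth $(p+q,0)$-forms, and: (i) $R(x\wedge y)=R(x)\wedge R(y)$ for $x\in\Lambda^{p,q}_I(M)$, $y\in\Lambda^{p',q'}_I(M)$. (ii) $R(\bar\lambda)=(-1)^p\,\overline{J(R(\lambda))}$ for $\lambda\in\Lambda^{p,q}_I(M)$. (iii) $R(\partial\lambda)=\partial R(\lambda)$ and $R(\bar\partial\lambda)=\partial_JR(\lambda)$ for $\lambda\in\Lambda^{p,q}_I(M)$. (iv) $(-\sqrt{-1})^pR$ maps strongly positive $(p,p)$-forms to strongly q-positive $(2p,0)$-forms. Equivalently, if the positive $(1,1)$-forms are normalised by the opposite sign, $\omega(X\circ I,X)\ge0$ (so that the form $\omega_I(X,Y)=g(X,Y\circ I)$ of a Hermitian metric $g$ is positive), then $(\sqrt{-1})^pR$ maps strongly positive $(p,p)$-forms to strongly q-positive $(2p,0)$-forms. -/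

import Mathlib

open scoped Manifold ContDiff Quaternion

noncomputable section

namespace Hypercomplex

/-! ### Multilinear algebra on one tangent space `V`

The quaternions act on tangent vectors on the right; `I, J, K : V →L[ℝ] V` are the maps
`X ↦ X·I`, `X ↦ X·J`, `X ↦ X·K`. Hence the quaternions act on forms on the left. -/

section Fibre

variable {V : Type*} [AddCommGroup V] [Module ℝ V] [TopologicalSpace V]
  [IsTopologicalAddGroup V] [ContinuousSMul ℝ V]

/-- Complex valued (real multilinear) alternating `k`-forms on `V`. -/
abbrev CForm (V : Type*) [AddCommGroup V] [Module ℝ V] [TopologicalSpace V] (k : ℕ) :=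
  V [⋀^Fin k]→L[ℝ] ℂ

theorem natAdd_ne_castAdd {k l : ℕ} (i : Fin k) (j : Fin l) :
    Fin.natAdd k j ≠ Fin.castAdd l i := by
  intro h
  have := congrArg Fin.val h
  simp only [Fin.val_natAdd, Fin.val_castAdd] at this
  omega

/-- The multilinear map `(X₁, …, X_{k+l}) ↦ a(X₁, …, X_k) b(X_{k+1}, …, X_{k+l})`. -/
def mulForms {k l : ℕ} (a : CForm V k) (b : CForm V l) :
    ContinuousMultilinearMap ℝ (fun _ : Fin (k + l) => V) ℂ where
  toFun v := a (v ∘ Fin.castAdd l) * b (v ∘ Fin.natAdd k)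
  map_update_add' := by
    intro inst v m x y
    induction m using Fin.addCases with
    | left i =>
      have h1 (z : V) := Function.update_comp_eq_of_injective v (Fin.castAdd_injective k l) i z
      have h2 (z : V) := Function.update_comp_eq_of_forall_ne (g := v) (f := Fin.natAdd k)
        (i := Fin.castAdd l i) z (fun j h => natAdd_ne_castAdd i j h)
      simp only [h1, h2, a.map_update_add, add_mul]
    | right j =>
      have h1 (z : V) := Function.update_comp_eq_of_injective v (Fin.natAdd_injective l k) j z
      have h2 (z : V) := Function.update_comp_eq_of_forall_ne (g := v) (f := Fin.castAdd l)
        (i := Fin.natAdd k j) z (fun i h => natAdd_ne_castAdd i j h.symm)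
      simp only [h1, h2, b.map_update_add, mul_add]
  map_update_smul' := by
    intro inst v m c x
    induction m using Fin.addCases with
    | left i =>
      have h1 (z : V) := Function.update_comp_eq_of_injective v (Fin.castAdd_injective k l) i z
      have h2 (z : V) := Function.update_comp_eq_of_forall_ne (g := v) (f := Fin.natAdd k)
        (i := Fin.castAdd l i) z (fun j h => natAdd_ne_castAdd i j h)
      simp only [h1, h2, a.map_update_smul, smul_mul_assoc]
    | right j =>
      have h1 (z : V) := Function.update_comp_eq_of_injective v (Fin.natAdd_injective l k) j z
      have h2 (z : V) := Function.update_comp_eq_of_forall_ne (g := v) (f := Fin.castAdd l)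
        (i := Fin.natAdd k j) z (fun i h => natAdd_ne_castAdd i j h.symm)
      simp only [h1, h2, b.map_update_smul, mul_smul_comm]
  cont := (a.cont.comp (by fun_prop)).mul (b.cont.comp (by fun_prop))

/-- The wedge product,
`(a ∧ b)(X) = 1/(k! l!) ∑_σ sgn σ a(X_{σ 1}, …, X_{σ k}) b(X_{σ (k+1)}, …, X_{σ (k+l)})`. -/
def wedge {k l : ℕ} (a : CForm V k) (b : CForm V l) : CForm V (k + l) :=
  ((k.factorial * l.factorial : ℂ)⁻¹) • ContinuousMultilinearMap.alternatization (mulForms a b)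

/-- Complex conjugation of forms. -/
def conjForm {k : ℕ} (a : CForm V k) : CForm V k :=
  (Complex.conjCLE : ℂ →L[ℝ] ℂ).compContinuousAlternatingMap a

/-- The pull-back `(A^* a)(X₁, …, X_k) = a(A X₁, …, A X_k)`. -/
def pull (k : ℕ) (A : V →L[ℝ] V) : CForm V k →ₗ[ℂ] CForm V k where
  toFun a := a.compContinuousLinearMap A
  map_add' _ _ := by ext; simp
  map_smul' _ _ := by ext; simp

/-- Right multiplication `X ↦ X·q` of tangent vectors by a quaternion `q = a + bI + cJ + dK`. -/
def rmul (I J K : V →L[ℝ] V) (q : ℍ[ℝ]) : V →L[ℝ] V :=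
  q.re • ContinuousLinearMap.id ℝ V + q.imI • I + q.imJ • J + q.imK • K

/-- The space `Λ^{p,q}_I` inside the `k`-forms, where `k = p + q`: the weight space of weight
`p - q` for the circle `e^{Iθ}`. For `k = 1` it is `{η | η(X·I) = √-1 η(X)}` if `p = 1`, and
`{η | η(X·I) = -√-1 η(X)}` if `q = 1`. -/
def hodge (I : V →L[ℝ] V) (k p q : ℕ) : Submodule ℂ (CForm V k) where
  carrier := {a | ∀ θ : ℝ, pull k (Real.cos θ • ContinuousLinearMap.id ℝ V + Real.sin θ • I) a =
    Complex.exp (((p : ℂ) - (q : ℂ)) * θ * Complex.I) • a}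
  add_mem' := by
    intro a b ha hb θ
    rw [map_add, ha θ, hb θ, smul_add]
  zero_mem' := by
    intro θ
    rw [map_zero, smul_zero]
  smul_mem' := by
    intro c a ha θ
    rw [map_smul, ha θ, smul_comm]

open Classical in
/-- The linear projection onto `W` along a complement `U` (zero if they are not complementary). -/
def projAlong {A : Type*} [AddCommGroup A] [Module ℂ A] (W U : Submodule ℂ A) : A →ₗ[ℂ] A :=
  if h : IsCompl W U then W.projection U h else 0

/-- The sum of all the `Λ^{a,b}_I` with `a + b = k` other than `Λ^{p,q}_I`. -/
def hodgeCompl (I : V →L[ℝ] V) (k p q : ℕ) : Submodule ℂ (CForm V k) :=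
  ⨆ (a : ℕ) (b : ℕ) (_ : a + b = k ∧ (a, b) ≠ (p, q)), hodge I k a b

/-- The `(p,q)`-component of a `k`-form, where `k = p + q`. -/
def hodgeProj (I : V →L[ℝ] V) (k p q : ℕ) : CForm V k →ₗ[ℂ] CForm V k :=
  projAlong (hodge I k p q) (hodgeCompl I k p q)

/-- Invariance of a complex subspace of `Λ^k` under `SU(2)`, the group of unit quaternions. -/
def SU2Invariant (I J K : V →L[ℝ] V) {k : ℕ} (W : Submodule ℂ (CForm V k)) : Prop :=
  ∀ u : ℍ[ℝ], ‖u‖ = 1 → ∀ a ∈ W, pull k (rmul I J K u) a ∈ W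

/-- `W` is an irreducible `SU(2)`-subrepresentation of `Λ^k` of weight `w`: the irreducible
representation of weight `w` is the one of complex dimension `w + 1`. -/
structure IsIrredOfWeight (I J K : V →L[ℝ] V) {k : ℕ} (w : ℕ) (W : Submodule ℂ (CForm V k)) :
    Prop where
  invariant : SU2Invariant I J K W
  ne_bot : W ≠ ⊥
  irreducible : ∀ U : Submodule ℂ (CForm V k), SU2Invariant I J K U → U ≤ W → U = ⊥ ∨ U = W
  finrank_eq : Module.finrank ℂ W = w + 1

/-- `Λ^k_+`: the maximal subspace of `Λ^k` on which `SU(2)` acts with weight `k`. -/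
def lamPlus (I J K : V →L[ℝ] V) (k : ℕ) : Submodule ℂ (CForm V k) :=
  sSup {W | IsIrredOfWeight I J K k W}

/-- `V^k`: the sum of all `SU(2)`-subspaces of `Λ^k` of weight less than `k`. -/
def lamLow (I J K : V →L[ℝ] V) (k : ℕ) : Submodule ℂ (CForm V k) :=
  sSup {W | ∃ w < k, IsIrredOfWeight I J K w W}

/-- The projection `P_+ : Λ^k → Λ^k_+` along `V^k`. -/
def projPlus (I J K : V →L[ℝ] V) (k : ℕ) : CForm V k →ₗ[ℂ] CForm V k :=
  projAlong (lamPlus I J K k) (lamLow I J K k)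

/-- `η ↦ h₁^p h₂^q · η`, `p + q = k`, the map `S^k(ℍ_I) ⊗ Λ^{k,0}_I → Λ^k` which takes
`(a₁ ⋯ a_k) ⊗ (b₁ ∧ ⋯ ∧ b_k)` to `1/k! ∑_σ (a_{σ 1} b₁) ∧ ⋯ ∧ (a_{σ k} b_k)`; here
`h₁ b = b` and `h₂ b = J b`, with `(J b)(X) = b(X·J)`. For alternating `η` this is
`1/k! ∑_σ η(X₁·a_{σ 1}, …, X_k·a_{σ k})`, that is, `1/k!` times the alternatization of
`η(X₁, …, X_p, X_{p+1}·J, …, X_k·J)`. -/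
def hMul (J : V →L[ℝ] V) (k p : ℕ) (η : CForm V k) : CForm V k :=
  ((k.factorial : ℂ)⁻¹) • ContinuousMultilinearMap.alternatization
    (η.toContinuousMultilinearMap.compContinuousLinearMap
      (fun j : Fin k => if (j : ℕ) < p then ContinuousLinearMap.id ℝ V else J))

/-- `R : Λ^{p,q}_I → Λ^{p+q,0}_I`: `P_+` followed by the inverse of the isomorphism
`Λ^{k,0}_I → Λ^{p,q}_{I,+}`, `η ↦ h₁^p h₂^q η`, where `k = p + q`. -/
def opR (I J K : V →L[ℝ] V) (k p : ℕ) (a : CForm V k) : CForm V k :=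
  Function.invFunOn (hMul J k p) (hodge I k k 0 : Set (CForm V k)) (projPlus I J K k a)

/-- A positive `(1,1)`-form in the complex sense: real, with `β(X, X·I) ≥ 0` for all `X`. -/
structure IsPositive (I : V →L[ℝ] V) (β : CForm V 2) : Prop where
  type : β ∈ hodge I 2 1 1
  real : conjForm β = β
  nonneg : ∀ X : V, 0 ≤ (β ![X, I X]).re

/-- Positivity with the other sign convention, the one for which the form `g(X, Y·I)` of a
Hermitian metric `g` is positive: `β` is real, of type `(1,1)`, and `β(X·I, X) ≥ 0`. -/
structure IsPositive' (I : V →L[ℝ] V) (β : CForm V 2) : Prop where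
  type : β ∈ hodge I 2 1 1
  real : conjForm β = β
  nonneg : ∀ X : V, 0 ≤ (β ![I X, X]).re

/-- A q-positive `(2,0)`-form: q-real, that is `J(η̄) = η`, with `η(X, X·J) ≥ 0` for all `X`
(this number is real since `η` is q-real). -/
structure IsQPositive (I J : V →L[ℝ] V) (η : CForm V 2) : Prop where
  type : η ∈ hodge I 2 2 0
  qreal : pull 2 J (conjForm η) = η
  nonneg : ∀ X : V, 0 ≤ (η ![X, J X]).re

/-- `p`-fold wedge products of elements of a set `P` of 2-forms. -/
inductive IsProduct (P : Set (CForm V 2)) : (p : ℕ) → CForm V (2 * p) → Prop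
  | one : IsProduct P 0 (ContinuousAlternatingMap.constOfIsEmpty ℝ V (Fin 0) (1 : ℂ) : CForm V 0)
  | mul {p : ℕ} {a : CForm V (2 * p)} {β : CForm V 2} :
      IsProduct P p a → β ∈ P → IsProduct P (p + 1) (wedge a β)

/-- The convex cone generated by the `p`-fold products of elements of `P`: their linear
combinations with non-negative real coefficients. -/
def productCone (P : Set (CForm V 2)) (p : ℕ) : PointedCone ℝ (CForm V (2 * p)) :=
  PointedCone.hull ℝ {a | IsProduct P p a}

end Fibre

/-! ### Hypercomplex manifolds and differential forms -/

section Manifold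

variable (E : Type*) [NormedAddCommGroup E] [NormedSpace ℝ E]
  (M : Type*) [TopologicalSpace M] [ChartedSpace E M]

/-- Endomorphisms of the tangent bundle (not necessarily smooth). -/
abbrev TangentEnd := ∀ x : M, TangentSpace 𝓘(ℝ, E) x →L[ℝ] TangentSpace 𝓘(ℝ, E) x

/-- Complex valued differential `k`-forms (not necessarily smooth). -/
abbrev DForm (k : ℕ) := ∀ x : M, CForm (TangentSpace 𝓘(ℝ, E) x) k

variable {E M}

/-- A complex structure on `M`: a smooth endomorphism `A` of `TM` with `A² = -1` whose Nijenhuis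
tensor `[AX, AY] - A[AX, Y] - A[X, AY] - [X, Y]` vanishes. -/
structure IsComplexStructure [IsManifold 𝓘(ℝ, E) ∞ M] (A : TangentEnd E M) : Prop where
  smooth : ContMDiff 𝓘(ℝ, E) (𝓘(ℝ, E).prod 𝓘(ℝ, E →L[ℝ] E)) ∞
    (fun x => Bundle.TotalSpace.mk' (E →L[ℝ] E)
      (E := fun x : M => TangentSpace 𝓘(ℝ, E) x →L[ℝ] TangentSpace 𝓘(ℝ, E) x) x (A x))
  sq : ∀ x X, A x (A x X) = -X
  integrable : ∀ (X Y : ∀ x : M, TangentSpace 𝓘(ℝ, E) x) (x : M),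
    ContMDiffAt 𝓘(ℝ, E) 𝓘(ℝ, E).tangent ∞ (fun y => (X y : TangentBundle 𝓘(ℝ, E) M)) x →
    ContMDiffAt 𝓘(ℝ, E) 𝓘(ℝ, E).tangent ∞ (fun y => (Y y : TangentBundle 𝓘(ℝ, E) M)) x →
    VectorField.mlieBracket 𝓘(ℝ, E) (fun y => A y (X y)) (fun y => A y (Y y)) x
      - A x (VectorField.mlieBracket 𝓘(ℝ, E) (fun y => A y (X y)) Y x)
      - A x (VectorField.mlieBracket 𝓘(ℝ, E) X (fun y => A y (Y y)) x)
      - VectorField.mlieBracket 𝓘(ℝ, E) X Y x = 0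

/-- A hypercomplex structure: complex structures `I, J, K` with `IJ = -JI = K`, acting on tangent
vectors on the right, so that `X·K = (X·I)·J = -(X·J)·I`. -/
structure IsHypercomplex [IsManifold 𝓘(ℝ, E) ∞ M] (I J K : TangentEnd E M) : Prop where
  complexI : IsComplexStructure I
  complexJ : IsComplexStructure J
  complexK : IsComplexStructure K
  mul_IJ : ∀ x X, J x (I x X) = K x X
  mul_JI : ∀ x X, I x (J x X) = -K x X

/-- The form `a` in the chart around `x₀`. -/
def inChart {k : ℕ} (a : DForm E M k) (x₀ : M) (y : E) : CForm E k :=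
  (a ((extChartAt 𝓘(ℝ, E) x₀).symm y)).compContinuousLinearMap
    (mfderiv 𝓘(ℝ, E) 𝓘(ℝ, E) (extChartAt 𝓘(ℝ, E) x₀).symm y)

/-- Smoothness of a differential form: its expression in every chart is smooth. -/
def IsSmooth {k : ℕ} (a : DForm E M k) : Prop :=
  ∀ x₀ : M, ContDiffOn ℝ ∞ (inChart a x₀) (extChartAt 𝓘(ℝ, E) x₀).target

/-- The de Rham differential, computed at each point in the chart around that point. -/
def extD {k : ℕ} (a : DForm E M k) : DForm E M (k + 1) := fun x =>
  (extDeriv (inChart a x) (extChartAt 𝓘(ℝ, E) x x)).compContinuousLinearMap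
    (mfderiv 𝓘(ℝ, E) 𝓘(ℝ, E) (extChartAt 𝓘(ℝ, E) x) x)

/-- `a` is a (smooth) differential form of type `(p,q)` with respect to `I`. -/
structure IsFormOfType (I : TangentEnd E M) {k : ℕ} (p q : ℕ) (a : DForm E M k) : Prop where
  degree : p + q = k
  smooth : IsSmooth a
  type : ∀ x, a x ∈ hodge (I x) k p q

/-- `∂ : Λ^{p,q}_I → Λ^{p+1,q}_I`. -/
def del (I : TangentEnd E M) {k : ℕ} (p q : ℕ) (a : DForm E M k) : DForm E M (k + 1) :=
  fun x => hodgeProj (I x) (k + 1) (p + 1) q (extD a x)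

/-- `∂̄ : Λ^{p,q}_I → Λ^{p,q+1}_I`. -/
def delbar (I : TangentEnd E M) {k : ℕ} (p q : ℕ) (a : DForm E M k) : DForm E M (k + 1) :=
  fun x => hodgeProj (I x) (k + 1) p (q + 1) (extD a x)

/-- `∂_J = J⁻¹ ∘ ∂̄ ∘ J : Λ^{k,0}_I → Λ^{k+1,0}_I`; `J` acts on `Λ^{k,0}_I` by
`(Ja)(X₁, …) = a(X₁·J, …)`, with values in `Λ^{0,k}_I`, and `X·J⁻¹ = -X·J`. -/
def delJ (I J : TangentEnd E M) {k : ℕ} (a : DForm E M k) : DForm E M (k + 1) :=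
  fun x => pull (k + 1) (-(J x)) (delbar I 0 k (fun y => pull k (J y) (a y)) x)

/-- `R : Λ^{p,q}_I(M) → Λ^{p+q,0}_I(M)`, fibrewise. -/
def formR (I J K : TangentEnd E M) {k : ℕ} (p _q : ℕ) (a : DForm E M k) : DForm E M k :=
  fun x => opR (I x) (J x) (K x) k p (a x)

end Manifold

end Hypercomplex

end

open scoped Manifold ContDiff Quaternion

set_option linter.unusedSectionVars false

noncomputable section

namespace Hypercomplex

/-! ### Multilinear forms and the maps induced slot by slot -/

section Induced

variable {V : Type*} [AddCommGroup V] [Module ℝ V] [TopologicalSpace V]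
  [IsTopologicalAddGroup V] [ContinuousSMul ℝ V]

/-! After complexification the quaternions become the algebra of `2 × 2` complex matrices, acting on
complex covectors through `mat`. The diagonal matrix units are the projections to the `(1,0)`- and
`(0,1)`-covectors, and `J` is the matrix with rows `(0, -1)`, `(1, 0)`. Every endomorphism of the
covectors induces an endomorphism of the forms of each degree, multiplicatively (`act_mul`) and
compatibly with wedge products (`act_wedge`). The central observation is `opR_eq`: on forms of type
`(p,q)`, whatever `p` and `q` are, `R` is the action `ringR` of the single matrix with rows `(1,
1)`, `(0, 0)`, which is the identity on `(1,0)`-covectors and `J⁻¹` on `(0,1)`-covectors.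
Multiplicativity of `R` is then immediate, and its behaviour under conjugation is a matrix
computation.

To reach `opR_eq`, an explicit projection `plusProj` is built from `hMul` and `ringR`, and its image
and kernel are identified with the sums of irreducibles of weight `k` and of smaller weight
(`lamPlus_eq`, `lamLow_eq`). This is highest weight theory with group elements instead of a Lie
algebra. The action is polynomial in the matrix entries, so an `SU(2)`-invariant subspace is stable
under all matrices, and raising and lowering operators are coefficients of these polynomials. An
irreducible whose highest vector has type `(p,q)` has dimension `p - q + 1`; complete reducibility
comes from an invariant Hermitian product.

For the differentials, vanishing of the Nijenhuis tensors of `I` and `J` provides, at each point,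
coordinates in which the derivatives of `I`, `J`, `K` vanish; this is the first order content of the
torsion-free Obata connection (`exists_connection`, `exists_firstOrder`). The exterior derivative is
then the antisymmetrization of a derivative commuting with all matrices, and `∂`, `∂̄` arise by
applying the diagonal matrix units to the derivative slot. The identities for `R` reduce to products
of matrices in `ringR_hodgeProj_extDeriv`.

For positivity, multiplicativity leaves only 2-forms, where `ringR_apply_J` writes `Rβ(X, X·J)` as
`√-1/2` times a sum of two values of `β(Z, Z·I)`. -/

/-- The complexified dual space. -/
abbrev CDual (V : Type*) [AddCommGroup V] [Module ℝ V] [TopologicalSpace V] := V →L[ℝ] ℂ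

/-- Complex linear endomorphisms of the complexified dual space. -/
abbrev DualEnd (V : Type*) [AddCommGroup V] [Module ℝ V] [TopologicalSpace V] :=
  Module.End ℂ (CDual V)

/-- Complex valued multilinear forms. -/
abbrev MForm (V : Type*) [AddCommGroup V] [Module ℝ V] [TopologicalSpace V] (k : ℕ) :=
  ContinuousMultilinearMap ℝ (fun _ : Fin k => V) ℂ

/-- The product `(X₁, …, X_k) ↦ φ₁(X₁) ⋯ φ_k(X_k)`, multilinear in `φ`. -/
def prodForm (V : Type*) [AddCommGroup V] [Module ℝ V] [TopologicalSpace V]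
    [IsTopologicalAddGroup V] [ContinuousSMul ℝ V] (k : ℕ) :
    MultilinearMap ℂ (fun _ : Fin k => CDual V) (MForm V k) where
  toFun φ := (ContinuousMultilinearMap.mkPiAlgebra ℝ (Fin k) ℂ).compContinuousLinearMap φ
  map_update_add' φ i x y := by
    ext v
    have h (z : CDual V) : (fun j => Function.update φ i z j (v j)) =
        Function.update (fun j => φ j (v j)) i (z (v i)) := by
      ext j
      by_cases hj : j = i
      · subst hj; simp
      · simp [hj]
    simp only [ContinuousMultilinearMap.compContinuousLinearMap_apply,
      add_apply, h,
      ContinuousMultilinearMap.map_update_add]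
  map_update_smul' φ i c x := by
    ext v
    have h (z : CDual V) : (fun j => Function.update φ i z j (v j)) =
        Function.update (fun j => φ j (v j)) i (z (v i)) := by
      ext j
      by_cases hj : j = i
      · subst hj; simp
      · simp [hj]
    simp only [ContinuousMultilinearMap.compContinuousLinearMap_apply,
      smul_apply, h]
    simp [Finset.prod_update_of_mem, mul_assoc]

@[simp] theorem prodForm_apply {k : ℕ} (φ : Fin k → CDual V) (v : Fin k → V) :
    prodForm V k φ v = ∏ j, φ j (v j) := by
  simp [prodForm]

variable [T2Space V] [FiniteDimensional ℝ V]

/-- A basis of `V`. -/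
def vbasis (V : Type*) [AddCommGroup V] [Module ℝ V] [FiniteDimensional ℝ V] :
    Module.Basis (Fin (Module.finrank ℝ V)) ℝ V := Module.finBasis ℝ V

/-- The dual basis of the complexified dual space. -/
def vcoord (i : Fin (Module.finrank ℝ V)) : CDual V :=
  Complex.ofRealCLM.comp (LinearMap.toContinuousLinearMap ((vbasis V).coord i))

theorem vcoord_apply (i : Fin (Module.finrank ℝ V)) (v : V) :
    vcoord i v = ((vbasis V).repr v i : ℂ) := by
  simp [vcoord]

theorem sum_vbasis (φ : CDual V) : ∑ i, φ (vbasis V i) • vcoord i = φ := by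
  ext v
  conv_rhs => rw [← (vbasis V).sum_repr v, map_sum]
  simp only [sum_apply, smul_apply, vcoord_apply,
    map_smul, smul_eq_mul, Complex.real_smul]
  exact Finset.sum_congr rfl fun i _ => mul_comm _ _

theorem sum_prodForm {k : ℕ} (m : MForm V k) :
    ∑ f : Fin k → Fin (Module.finrank ℝ V),
      m (fun j => vbasis V (f j)) • prodForm V k (fun j => vcoord (f j)) = m := by
  ext v
  conv_rhs => rw [show v = fun j => ∑ i, (vbasis V).repr (v j) i • vbasis V i from
    funext fun j => ((vbasis V).sum_repr (v j)).symm]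
  rw [ContinuousMultilinearMap.map_sum, sum_apply]
  refine Finset.sum_congr rfl fun f _ => ?_
  rw [ContinuousMultilinearMap.map_smul_univ]
  simp only [smul_apply, prodForm_apply, vcoord_apply, smul_eq_mul,
    Complex.real_smul, Complex.ofReal_prod]
  ring

/-- Products of covectors span the multilinear forms in finite dimension, so identities between
induced maps need only be checked on products. -/
theorem mform_ext {k : ℕ} {A : Type*} [AddCommGroup A] [Module ℂ A] {F G : MForm V k →ₗ[ℂ] A}
    (h : ∀ φ, F (prodForm V k φ) = G (prodForm V k φ)) : F = G := by
  ext1 m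
  rw [← sum_prodForm m, map_sum, map_sum]
  exact Finset.sum_congr rfl fun f _ => by rw [map_smul, map_smul, h]

/-- The map `φ₁ ⊗ ⋯ ⊗ φ_k ↦ T₁ φ₁ ⊗ ⋯ ⊗ T_k φ_k` on multilinear forms. -/
def mind {k : ℕ} (T : Fin k → DualEnd V) : MForm V k →ₗ[ℂ] MForm V k where
  toFun m := ∑ f : Fin k → Fin (Module.finrank ℝ V),
    m (fun j => vbasis V (f j)) • prodForm V k (fun j => T j (vcoord (f j)))
  map_add' m m' := by
    rw [← Finset.sum_add_distrib]
    exact Finset.sum_congr rfl fun f _ => add_smul (M := MForm V k) (m _) (m' _) _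
  map_smul' c m := by
    rw [Finset.smul_sum]
    exact Finset.sum_congr rfl fun f _ => mul_smul (β := MForm V k) c (m _) _

theorem mind_apply {k : ℕ} (T : Fin k → DualEnd V) (m : MForm V k) :
    mind T m = ∑ f : Fin k → Fin (Module.finrank ℝ V),
      m (fun j => vbasis V (f j)) • prodForm V k (fun j => T j (vcoord (f j))) := rfl

theorem mind_prodForm {k : ℕ} (T : Fin k → DualEnd V) (φ : Fin k → CDual V) :
    mind T (prodForm V k φ) = prodForm V k (fun j => T j (φ j)) := by
  have h : (fun j => T j (φ j)) = fun j => ∑ i, φ j (vbasis V i) • T j (vcoord i) := by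
    ext1 j
    conv_lhs => rw [← sum_vbasis (φ j), map_sum]
    simp only [map_smul]
  rw [h, MultilinearMap.map_sum, mind_apply]
  refine Finset.sum_congr rfl fun f _ => ?_
  rw [MultilinearMap.map_smul_univ, prodForm_apply]

theorem mind_comp {k : ℕ} (T T' : Fin k → DualEnd V) (m : MForm V k) :
    mind T (mind T' m) = mind (fun j => T j * T' j) m := by
  have : mind T ∘ₗ mind T' = mind (fun j => T j * T' j) :=
    mform_ext fun φ => by simp [mind_prodForm]
  exact LinearMap.congr_fun this m

theorem mind_one {k : ℕ} (m : MForm V k) : mind (fun _ => 1) m = m := by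
  have : mind (fun _ => 1) = (LinearMap.id : MForm V k →ₗ[ℂ] MForm V k) :=
    mform_ext fun φ => by simp [mind_prodForm]
  exact LinearMap.congr_fun this m

theorem mind_smul {k : ℕ} (c : Fin k → ℂ) (T : Fin k → DualEnd V) (m : MForm V k) :
    mind (fun j => c j • T j) m = (∏ j, c j) • mind T m := by
  have : mind (fun j => c j • T j) = (∏ j, c j) • mind T := by
    refine mform_ext fun φ => ?_
    rw [LinearMap.smul_apply, mind_prodForm, mind_prodForm, ← MultilinearMap.map_smul_univ]
    rfl
  exact LinearMap.congr_fun this m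

/-- Expanding the tensor power of `s A + t B` over the set `S` of slots that receive `B`. All later
polynomial arguments start from this expansion. -/
theorem mind_add {k : ℕ} (s t : ℂ) (A B : DualEnd V) (m : MForm V k) :
    mind (fun _ => s • A + t • B) m = ∑ S : Finset (Fin k), (s ^ (k - S.card) * t ^ S.card) •
      mind (fun j => if j ∈ S then B else A) m := by
  have : mind (fun _ : Fin k => s • A + t • B) = ∑ S : Finset (Fin k),
      (s ^ (k - S.card) * t ^ S.card) • mind (fun j => if j ∈ S then B else A) := by
    refine mform_ext fun φ => ?_
    rw [mind_prodForm, LinearMap.sum_apply]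
    have : (fun j => (s • A + t • B) (φ j)) = (fun j => t • B (φ j)) + fun j => s • A (φ j) := by
      ext1 j; simp [add_comm]
    rw [this, MultilinearMap.map_add_univ]
    refine Finset.sum_congr rfl fun S _ => ?_
    have : S.piecewise (fun j => t • B (φ j)) (fun j => s • A (φ j)) = fun j =>
        (if j ∈ S then t else s) • (if j ∈ S then B else A) (φ j) := by
      ext1 j
      by_cases hj : j ∈ S <;> simp [hj]
    rw [this, MultilinearMap.map_smul_univ, LinearMap.smul_apply, mind_prodForm]
    congr 1
    rw [Finset.prod_ite, Finset.prod_const, Finset.prod_const, mul_comm]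
    congr 2
    · rw [Finset.filter_not, Finset.card_sdiff]
      simp
    · simp
  rw [this]
  simp

theorem mind_domDomCongr {k : ℕ} (T : Fin k → DualEnd V) (σ : Equiv.Perm (Fin k)) (m : MForm V k) :
    mind T (m.domDomCongr σ) = (mind (T ∘ σ) m).domDomCongr σ := by
  let D : MForm V k →ₗ[ℂ] MForm V k :=
    { toFun := fun m => m.domDomCongr σ
      map_add' := fun _ _ => rfl
      map_smul' := fun _ _ => rfl }
  have hD (φ : Fin k → CDual V) : D (prodForm V k φ) = prodForm V k (φ ∘ σ.symm) := by
    ext v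
    change prodForm V k φ (fun i => v (σ i)) = _
    rw [prodForm_apply, prodForm_apply]
    exact Fintype.prod_equiv σ _ _ (by simp)
  have : mind T ∘ₗ D = D ∘ₗ mind (T ∘ σ) := by
    refine mform_ext fun φ => ?_
    rw [LinearMap.comp_apply, LinearMap.comp_apply, mind_prodForm, hD, hD, mind_prodForm]
    congr 1
    ext1 j
    simp
  exact LinearMap.congr_fun this m

end Induced

/-! ### Alternatization and the maps induced on alternating forms -/

section Ind

variable {V : Type*} [AddCommGroup V] [Module ℝ V] [TopologicalSpace V]
  [IsTopologicalAddGroup V] [ContinuousSMul ℝ V]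

/-- Normalized alternatization. -/
def alt (k : ℕ) : MForm V k →ₗ[ℂ] CForm V k where
  toFun m := ((k.factorial : ℂ)⁻¹) • ContinuousMultilinearMap.alternatization m
  map_add' m m' := by rw [map_add, smul_add]
  map_smul' c m := by
    rw [RingHom.id_apply, smul_comm]
    congr 1
    ext v
    simp [ContinuousMultilinearMap.alternatization_apply_apply, Finset.mul_sum,
      mul_smul_comm]

theorem alt_apply {k : ℕ} (m : MForm V k) :
    alt k m = ((k.factorial : ℂ)⁻¹) • ContinuousMultilinearMap.alternatization m := rfl

theorem alt_coe {k : ℕ} (a : CForm V k) : alt k a.toContinuousMultilinearMap = a := by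
  ext v
  rw [alt_apply, ContinuousAlternatingMap.smul_apply,
    ContinuousMultilinearMap.alternatization_apply_apply]
  have (σ : Equiv.Perm (Fin k)) :
      Equiv.Perm.sign σ • a.toContinuousMultilinearMap (v ∘ σ) = a v := by
    have := a.toAlternatingMap.map_perm v σ
    change a (v ∘ σ) = _ at this
    rw [ContinuousAlternatingMap.coe_toContinuousMultilinearMap, this, smul_smul]
    simp
  rw [Finset.sum_congr rfl fun σ _ => this σ, Finset.sum_const, Finset.card_univ,
    Fintype.card_perm, Fintype.card_fin, nsmul_eq_mul, smul_eq_mul, inv_mul_cancel_left₀]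
  exact_mod_cast k.factorial_ne_zero

theorem toContinuousMultilinearMap_alternatization {k : ℕ} (m : MForm V k) :
    (ContinuousMultilinearMap.alternatization m).toContinuousMultilinearMap =
      ∑ σ : Equiv.Perm (Fin k), ((Equiv.Perm.sign σ : ℤ) : ℂ) • m.domDomCongr σ := by
  ext v
  change ContinuousMultilinearMap.alternatization m v = _
  rw [ContinuousMultilinearMap.alternatization_apply_apply, sum_apply]
  refine Finset.sum_congr rfl fun σ _ => ?_
  rw [smul_apply, Units.smul_def, zsmul_eq_mul]
  rfl

theorem toContinuousMultilinearMap_alt {k : ℕ} (m : MForm V k) :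
    (alt k m).toContinuousMultilinearMap = ((k.factorial : ℂ)⁻¹) •
      ∑ σ : Equiv.Perm (Fin k), ((Equiv.Perm.sign σ : ℤ) : ℂ) • m.domDomCongr σ := by
  rw [← toContinuousMultilinearMap_alternatization]
  rfl

theorem domDomCongr_coe {k : ℕ} (a : CForm V k) (σ : Equiv.Perm (Fin k)) :
    a.toContinuousMultilinearMap.domDomCongr σ =
      ((Equiv.Perm.sign σ : ℤ) : ℂ) • a.toContinuousMultilinearMap := by
  ext v
  have := a.toAlternatingMap.map_perm v σ
  rw [Units.smul_def, zsmul_eq_mul] at this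
  exact this

theorem alt_domDomCongr {k : ℕ} (m : MForm V k) (σ : Equiv.Perm (Fin k)) :
    alt k (m.domDomCongr σ) = ((Equiv.Perm.sign σ : ℤ) : ℂ) • alt k m := by
  rw [alt_apply, alt_apply, smul_comm]
  congr 1
  ext v
  rw [ContinuousAlternatingMap.smul_apply,
    ContinuousMultilinearMap.alternatization_apply_apply,
    ContinuousMultilinearMap.alternatization_apply_apply, Finset.smul_sum]
  refine Fintype.sum_equiv (Equiv.mulRight σ) _ _ fun τ => ?_
  have : (m.domDomCongr σ) (v ∘ τ) = m (v ∘ (τ * σ : Equiv.Perm (Fin k))) := rfl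
  rw [this, Equiv.coe_mulRight, Equiv.Perm.sign_mul, Units.smul_def, Units.smul_def,
    zsmul_eq_mul, zsmul_eq_mul, smul_eq_mul, Units.val_mul, Int.cast_mul, ← mul_assoc]
  have h1 : ((Equiv.Perm.sign σ : ℤ) : ℂ) * ((Equiv.Perm.sign σ : ℤ) : ℂ) = 1 := by
    norm_cast
    simp
  linear_combination (-((Equiv.Perm.sign τ : ℤ) : ℂ) * m (v ∘ (τ * σ : Equiv.Perm (Fin k)))) * h1

/-- Composition with a real linear map, on the complexified dual space. -/
def precomp (A : V →L[ℝ] V) : DualEnd V where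
  toFun φ := φ.comp A
  map_add' _ _ := by ext; simp
  map_smul' _ _ := by ext; simp

@[simp] theorem precomp_apply (A : V →L[ℝ] V) (φ : CDual V) (v : V) :
    precomp A φ v = φ (A v) := rfl

variable [T2Space V] [FiniteDimensional ℝ V]

/-- The complex linear map on `k`-forms induced by a complex linear map on the complexified dual
space. -/
def ind (k : ℕ) (T : DualEnd V) : CForm V k →ₗ[ℂ] CForm V k where
  toFun a := alt k (mind (fun _ => T) a.toContinuousMultilinearMap)
  map_add' a b := by
    rw [← map_add, ← map_add]; rfl
  map_smul' c a := by
    rw [← map_smul, ← map_smul]; rfl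

theorem ind_apply {k : ℕ} (T : DualEnd V) (a : CForm V k) :
    ind k T a = alt k (mind (fun _ => T) a.toContinuousMultilinearMap) := rfl

/-- With the same `T` in every slot, permuting the slots changes nothing, so the induced map
commutes with alternatization. -/
theorem mind_alt {k : ℕ} (T : DualEnd V) (m : MForm V k) :
    mind (fun _ => T) (alt k m).toContinuousMultilinearMap =
      (alt k (mind (fun _ => T) m)).toContinuousMultilinearMap := by
  rw [toContinuousMultilinearMap_alt, toContinuousMultilinearMap_alt, map_smul, map_sum]
  congr 1
  refine Finset.sum_congr rfl fun σ _ => ?_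
  rw [map_smul, mind_domDomCongr]
  rfl

theorem toContinuousMultilinearMap_ind {k : ℕ} (T : DualEnd V) (a : CForm V k) :
    (ind k T a).toContinuousMultilinearMap = mind (fun _ => T) a.toContinuousMultilinearMap := by
  rw [ind_apply, ← mind_alt, alt_coe]

theorem ind_apply_apply {k : ℕ} (T : DualEnd V) (a : CForm V k) (v : Fin k → V) :
    ind k T a v = ∑ f : Fin k → Fin (Module.finrank ℝ V),
      a (fun j => vbasis V (f j)) * ∏ j, T (vcoord (f j)) (v j) := by
  change (ind k T a).toContinuousMultilinearMap v = _
  rw [toContinuousMultilinearMap_ind, mind_apply, sum_apply]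
  simp

theorem ind_alt {k : ℕ} (T : DualEnd V) (m : MForm V k) :
    ind k T (alt k m) = alt k (mind (fun _ => T) m) := by
  rw [ind_apply, mind_alt, alt_coe]

theorem ind_mul {k : ℕ} (T T' : DualEnd V) (a : CForm V k) :
    ind k (T * T') a = ind k T (ind k T' a) := by
  rw [ind_apply T', ind_alt, mind_comp]; rfl

theorem ind_one {k : ℕ} (a : CForm V k) : ind k 1 a = a := by
  rw [ind_apply, mind_one, alt_coe]

theorem ind_smul {k : ℕ} (c : ℂ) (T : DualEnd V) (a : CForm V k) :
    ind k (c • T) a = c ^ k • ind k T a := by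
  rw [ind_apply, ind_apply, mind_smul (fun _ => c), map_smul]
  simp

/-- The coefficients of the polynomial `ind k (s A + t B)`. -/
def coeffInd (k : ℕ) (A B : DualEnd V) (n : ℕ) : CForm V k →ₗ[ℂ] CForm V k where
  toFun a := ∑ S ∈ (Finset.univ : Finset (Finset (Fin k))) with S.card = n,
    alt k (mind (fun j => if j ∈ S then B else A) a.toContinuousMultilinearMap)
  map_add' a b := by
    rw [← Finset.sum_add_distrib]
    refine Finset.sum_congr rfl fun S _ => ?_
    rw [← map_add, ← map_add]; rfl
  map_smul' c a := by
    rw [Finset.smul_sum]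
    refine Finset.sum_congr rfl fun S _ => ?_
    rw [RingHom.id_apply, ← map_smul, ← map_smul]; rfl

theorem coeffInd_apply {k : ℕ} (A B : DualEnd V) (n : ℕ) (a : CForm V k) :
    coeffInd k A B n a = ∑ S ∈ (Finset.univ : Finset (Finset (Fin k))) with S.card = n,
      alt k (mind (fun j => if j ∈ S then B else A) a.toContinuousMultilinearMap) := rfl

theorem ind_add {k : ℕ} (s t : ℂ) (A B : DualEnd V) (a : CForm V k) :
    ind k (s • A + t • B) a =
      ∑ n ∈ Finset.range (k + 1), (s ^ (k - n) * t ^ n) • coeffInd k A B n a := by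
  rw [ind_apply, mind_add, map_sum]
  rw [← Finset.sum_fiberwise_of_maps_to (s := Finset.univ) (t := Finset.range (k + 1))
    (g := fun S : Finset (Fin k) => S.card)]
  · refine Finset.sum_congr rfl fun n _ => ?_
    rw [coeffInd_apply, Finset.smul_sum]
    refine Finset.sum_congr rfl fun S hS => ?_
    rw [map_smul, (Finset.mem_filter.1 hS).2]
  · intro S _
    rw [Finset.mem_range, Nat.lt_succ_iff]
    exact (Finset.card_le_univ S).trans_eq (Fintype.card_fin k)

theorem mind_precomp {k : ℕ} (A : Fin k → V →L[ℝ] V) (m : MForm V k) :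
    mind (fun j => precomp (A j)) m = m.compContinuousLinearMap A := by
  let D : MForm V k →ₗ[ℂ] MForm V k :=
    { toFun := fun m => m.compContinuousLinearMap A
      map_add' := fun _ _ => rfl
      map_smul' := fun _ _ => rfl }
  have : mind (fun j => precomp (A j)) = D := by
    refine mform_ext fun φ => ?_
    rw [mind_prodForm]
    ext v
    change _ = prodForm V k φ (fun j => A j (v j))
    simp
  exact LinearMap.congr_fun this m

theorem pull_eq_ind {k : ℕ} (A : V →L[ℝ] V) (a : CForm V k) : pull k A a = ind k (precomp A) a := by
  apply ContinuousAlternatingMap.toContinuousMultilinearMap_injective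
  rw [toContinuousMultilinearMap_ind, mind_precomp (fun _ => A)]
  rfl

/-- In the basis expansion, an index function on `Fin (k + l)` is a pair of index functions, and the
sum factors. This makes `R` an algebra homomorphism. -/
theorem ind_wedge {k l : ℕ} (T : DualEnd V) (a : CForm V k) (b : CForm V l) :
    ind (k + l) T (wedge a b) = wedge (ind k T a) (ind l T b) := by
  have key : mind (fun _ => T) (mulForms a b) = mulForms (ind k T a) (ind l T b) := by
    ext v
    change _ = ind k T a _ * ind l T b _
    rw [ind_apply_apply, ind_apply_apply, mind_apply, Finset.sum_mul_sum, sum_apply,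
      ← Fintype.sum_prod_type', ← (Fin.appendEquiv k l).sum_comp]
    refine Finset.sum_congr rfl fun f _ => ?_
    rw [smul_apply, prodForm_apply, Fin.prod_univ_add]
    change (a _ * b _) * _ = _
    simp only [Fin.appendEquiv_apply, Function.comp_def, Fin.append_left, Fin.append_right]
    ring
  have h (m : MForm V (k + l)) : ContinuousMultilinearMap.alternatization m =
      ((k + l).factorial : ℂ) • alt (k + l) m := by
    rw [alt_apply, smul_inv_smul₀]
    exact_mod_cast (k + l).factorial_ne_zero
  rw [wedge, wedge, h, h, map_smul, map_smul, ind_alt, key]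

theorem hMul_eq {k p : ℕ} (J : V →L[ℝ] V) (a : CForm V k) :
    hMul J k p a = alt k (mind (fun j : Fin k => if (j : ℕ) < p then 1 else precomp J)
      a.toContinuousMultilinearMap) := by
  have : (fun j : Fin k => if (j : ℕ) < p then (1 : DualEnd V) else precomp J) =
      fun j : Fin k => precomp (if (j : ℕ) < p then ContinuousLinearMap.id ℝ V else J) := by
    ext1 j
    split_ifs
    · rfl
    · rfl
  rw [this, mind_precomp]
  rfl

/-- The sign from permuting the arguments of the alternating form cancels the sign from
alternatization. -/
theorem alt_mind_comp_perm {k : ℕ} (T : Fin k → DualEnd V) (σ : Equiv.Perm (Fin k))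
    (a : CForm V k) : alt k (mind (T ∘ σ) a.toContinuousMultilinearMap) =
      alt k (mind T a.toContinuousMultilinearMap) := by
  have h := congrArg (alt k) (mind_domDomCongr T σ a.toContinuousMultilinearMap)
  rw [alt_domDomCongr, domDomCongr_coe, map_smul, map_smul] at h
  refine (smul_right_injective _ ?_ h).symm
  exact_mod_cast (Equiv.Perm.sign σ).isUnit.ne_zero

/-- After alternatization only the number of slots receiving `B` matters, so the `k.choose p`
summands agree. This relates `hMul`, where the slots are chosen in order, to polynomial
coefficients. -/
theorem coeffInd_eq_choose {k p : ℕ} (A B : DualEnd V) (hp : p ≤ k) (a : CForm V k) :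
    coeffInd k A B p a = (k.choose p : ℂ) •
      alt k (mind (fun j : Fin k => if (j : ℕ) < p then B else A)
        a.toContinuousMultilinearMap) := by
  rw [coeffInd_apply, Finset.sum_congr rfl (g := fun _ =>
    alt k (mind (fun j : Fin k => if (j : ℕ) < p then B else A) a.toContinuousMultilinearMap)),
    Finset.sum_const]
  · rw [← Finset.powerset_univ, ← Finset.powersetCard_eq_filter, Finset.card_powersetCard,
      Finset.card_univ, Fintype.card_fin]
    exact (Nat.cast_smul_eq_nsmul ℂ _ _).symm
  · intro S hS
    have hS := (Finset.mem_filter.1 hS).2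
    -- A bijection between two sets of slots of the same size extends to a permutation of all slots.
    have e : {j : Fin k // (j : ℕ) < p} ≃ {j : Fin k // j ∈ S} := by
      refine Fintype.equivOfCardEq ?_
      rw [Fintype.card_coe, hS, Fintype.card_subtype, Fin.card_filter_val_lt, min_eq_right hp]
    rw [← alt_mind_comp_perm _ e.extendSubtype]
    congr 3
    ext1 j
    rw [Function.comp_apply]
    by_cases hj : (j : ℕ) < p
    · rw [if_pos hj, if_pos (e.extendSubtype_mem j hj)]
    · rw [if_neg hj, if_neg (e.extendSubtype_not_mem j hj)]

theorem ind_conjForm {k : ℕ} (T T' : DualEnd V)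
    (h : ∀ φ : CDual V, ∀ v, T ((Complex.conjCLE : ℂ →L[ℝ] ℂ).comp φ) v =
      (starRingEnd ℂ) (T' φ v)) (a : CForm V k) :
    ind k T (conjForm a) = conjForm (ind k T' a) := by
  ext v
  have hc (i : Fin (Module.finrank ℝ V)) :
      (Complex.conjCLE : ℂ →L[ℝ] ℂ).comp (vcoord i) = vcoord i := by
    ext v; simp [vcoord_apply]
  rw [ind_apply_apply]
  change _ = (starRingEnd ℂ) (ind k T' a v)
  rw [ind_apply_apply, map_sum]
  refine Finset.sum_congr rfl fun f _ => ?_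
  rw [map_mul, map_prod]
  congr 1
  refine Finset.prod_congr rfl fun j _ => ?_
  rw [← h, hc]

end Ind

/-! ### Naturality of induced maps under pull-back -/

section Natural

variable {V W : Type*} [AddCommGroup V] [Module ℝ V] [TopologicalSpace V]
  [IsTopologicalAddGroup V] [ContinuousSMul ℝ V] [T2Space V] [FiniteDimensional ℝ V]
  [AddCommGroup W] [Module ℝ W] [TopologicalSpace W]
  [IsTopologicalAddGroup W] [ContinuousSMul ℝ W] [T2Space W] [FiniteDimensional ℝ W]

theorem ind_compContinuousLinearMap {k : ℕ} (A : V →L[ℝ] W) (T : DualEnd V) (T' : DualEnd W)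
    (h : ∀ φ : CDual W, T (φ.comp A) = (T' φ).comp A) (a : CForm W k) :
    ind k T (a.compContinuousLinearMap A) = (ind k T' a).compContinuousLinearMap A := by
  let D : MForm W k →ₗ[ℂ] MForm V k :=
    { toFun := fun m => m.compContinuousLinearMap (fun _ => A)
      map_add' := fun _ _ => rfl
      map_smul' := fun _ _ => rfl }
  have hD (φ : Fin k → CDual W) : D (prodForm W k φ) = prodForm V k (fun j => (φ j).comp A) := by
    ext v
    change prodForm W k φ (fun j => A (v j)) = _
    simp
  have key : mind (fun _ => T) ∘ₗ D = D ∘ₗ mind (fun _ => T') := by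
    refine mform_ext fun φ => ?_
    rw [LinearMap.comp_apply, LinearMap.comp_apply, hD, mind_prodForm, mind_prodForm, hD]
    simp only [h]
  apply ContinuousAlternatingMap.toContinuousMultilinearMap_injective
  rw [toContinuousMultilinearMap_ind]
  refine (LinearMap.congr_fun key a.toContinuousMultilinearMap).trans ?_
  rw [LinearMap.comp_apply, ← toContinuousMultilinearMap_ind]
  rfl

end Natural

/-! ### Polynomials with coefficients in a vector space -/

section Coefficients

variable {A : Type*} [AddCommGroup A] [Module ℂ A]

/-- A coefficient outside `W` would be detected by a linear functional vanishing on `W`; applied to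
the sum, the functional gives a scalar polynomial with infinitely many roots. -/
theorem coeff_mem_of_sum_pow_mem (W : Submodule ℂ A) {S : Set ℂ} (hS : S.Infinite) {n : ℕ}
    (c : ℕ → A) (h : ∀ t ∈ S, ∑ i ∈ Finset.range n, t ^ i • c i ∈ W) {i : ℕ} (hi : i < n) :
    c i ∈ W := by
  by_contra hc
  obtain ⟨f, hf, hW⟩ := Submodule.exists_le_ker_of_notMem hc
  have hp : (∑ j ∈ Finset.range n, Polynomial.monomial j (f (c j))) = 0 := by
    refine Polynomial.eq_zero_of_infinite_isRoot _ (hS.mono fun t ht => ?_)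
    have := hW (h t ht)
    rw [LinearMap.mem_ker, map_sum] at this
    rw [Set.mem_ofPred_eq, Polynomial.IsRoot, Polynomial.eval_finsetSum, ← this]
    refine Finset.sum_congr rfl fun j _ => ?_
    rw [Polynomial.eval_monomial, map_smul, smul_eq_mul, mul_comm]
  have := congrArg (fun p => Polynomial.coeff p i) hp
  simp only [Polynomial.finsetSum_coeff, Polynomial.coeff_monomial, Polynomial.coeff_zero] at this
  rw [Finset.sum_ite_eq' (Finset.range n) i, if_pos (Finset.mem_range.2 hi)] at this
  exact hf this

theorem coeff_eq_of_sum_pow_eq {S : Set ℂ} (hS : S.Infinite) {n : ℕ}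
    (c d : ℕ → A) (h : ∀ t ∈ S, ∑ i ∈ Finset.range n, t ^ i • c i =
      ∑ i ∈ Finset.range n, t ^ i • d i) {i : ℕ} (hi : i < n) : c i = d i := by
  refine sub_eq_zero.1 ((Submodule.mem_bot ℂ).1
    (coeff_mem_of_sum_pow_mem ⊥ hS (fun i => c i - d i) (fun t ht => ?_) hi))
  rw [Submodule.mem_bot]
  simp only [smul_sub, Finset.sum_sub_distrib, h t ht, sub_self]

/-- An explicit candidate for the projection proves both that the two subspaces are complementary
and that it is the projection. -/
theorem projAlong_eq {W U : Submodule ℂ A} (f : A →ₗ[ℂ] A) (hW : ∀ x, f x ∈ W)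
    (hfix : ∀ x ∈ W, f x = x) (hU : ∀ x ∈ U, f x = 0) (hsub : ∀ x, x - f x ∈ U) :
    IsCompl W U ∧ projAlong W U = f := by
  have h : IsCompl W U := by
    refine ⟨Submodule.disjoint_def.2 fun x h1 h2 => (hfix x h1).symm.trans (hU x h2),
      codisjoint_iff.2 (eq_top_iff.2 fun x _ => ?_)⟩
    rw [← add_sub_cancel (f x) x]
    exact Submodule.add_mem_sup (hW x) (hsub x)
  refine ⟨h, LinearMap.ext fun x => ?_⟩
  rw [projAlong, dif_pos h]
  conv_lhs => rw [← add_sub_cancel (f x) x, map_add]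
  rw [Submodule.projection_apply_of_mem_left h (hW x),
    (Submodule.projection_apply_eq_zero_iff h).2 (hsub x), add_zero]

end Coefficients

/-! ### Quaternionic actions and their complexification by matrices -/

section Quaternionic

variable {V : Type*} [AddCommGroup V] [Module ℝ V] [TopologicalSpace V]
  [IsTopologicalAddGroup V] [ContinuousSMul ℝ V]

/-- `I, J, K` define a right action of the quaternions on `V`. -/
structure IsQuaternionic (I J K : V →L[ℝ] V) : Prop where
  sq_I : ∀ X, I (I X) = -X
  sq_J : ∀ X, J (J X) = -X
  mul_IJ : ∀ X, J (I X) = K X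
  mul_JI : ∀ X, I (J X) = -K X

namespace IsQuaternionic

variable {I J K : V →L[ℝ] V} (h : IsQuaternionic I J K)
include h

theorem mul_KI (X : V) : I (K X) = J X := by
  rw [← h.mul_IJ, h.mul_JI, ← h.mul_IJ, h.sq_I, map_neg, neg_neg]

theorem mul_IK (X : V) : K (I X) = -J X := by
  rw [← h.mul_IJ, h.sq_I, map_neg]

theorem mul_KJ (X : V) : J (K X) = -I X := by
  rw [← h.mul_IJ, h.sq_J]

theorem mul_JK (X : V) : K (J X) = I X := by
  rw [← h.mul_IJ, h.mul_JI, map_neg, h.mul_KJ, neg_neg]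

theorem sq_K (X : V) : K (K X) = -X := by
  rw [← h.mul_IJ (K X), h.mul_KI, h.sq_J]

end IsQuaternionic

/-- The action of the matrix with rows `(a, b)`, `(c, d)` on the complexified dual space, for the
identification of the complexified quaternions with the `2 × 2` matrices in which the matrix units
of the diagonal are the projections to the `(1,0)`-forms and to the `(0,1)`-forms. -/
def mat (I J K : V →L[ℝ] V) (a b c d : ℂ) : DualEnd V :=
  ((a + d) / 2) • 1 + (Complex.I * (d - a) / 2) • precomp I + ((c - b) / 2) • precomp J +
    (Complex.I * (b + c) / 2) • precomp K

theorem mat_apply (I J K : V →L[ℝ] V) (a b c d : ℂ) (φ : CDual V) (v : V) :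
    mat I J K a b c d φ v = (a + d) / 2 * φ v + Complex.I * (d - a) / 2 * φ (I v) +
      (c - b) / 2 * φ (J v) + Complex.I * (b + c) / 2 * φ (K v) := by
  simp [mat, precomp]

theorem mat_mul {I J K : V →L[ℝ] V} (h : IsQuaternionic I J K) (a b c d a' b' c' d' : ℂ) :
    mat I J K a b c d * mat I J K a' b' c' d' =
      mat I J K (a * a' + b * c') (a * b' + b * d') (c * a' + d * c') (c * b' + d * d') := by
  ext φ v
  rw [Module.End.mul_apply]
  simp only [mat_apply, h.sq_I, h.sq_J, h.sq_K, h.mul_IJ, h.mul_JI, h.mul_IK, h.mul_KI, h.mul_JK,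
    h.mul_KJ, map_neg]
  linear_combination
    (-(d - a) * (d' - a') * φ v / 4 - (b + c) * (b' + c') * φ v / 4
      + (b + c) * (d' - a') * φ (J v) / 4 - (d - a) * (b' + c') * φ (J v) / 4) * Complex.I_mul_I

theorem mat_one (I J K : V →L[ℝ] V) : mat I J K 1 0 0 1 = 1 := by
  ext φ v
  rw [mat_apply, Module.End.one_apply]
  ring

theorem mat_add_smul (I J K : V →L[ℝ] V) (s t a b c d a' b' c' d' : ℂ) :
    mat I J K (s * a + t * a') (s * b + t * b') (s * c + t * c') (s * d + t * d') =
      s • mat I J K a b c d + t • mat I J K a' b' c' d' := by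
  ext φ v
  rw [LinearMap.add_apply, LinearMap.smul_apply, LinearMap.smul_apply, add_apply, smul_apply,
    smul_apply, smul_eq_mul, smul_eq_mul]
  simp only [mat_apply]
  ring

theorem mat_smul (I J K : V →L[ℝ] V) (s a b c d : ℂ) :
    mat I J K (s * a) (s * b) (s * c) (s * d) = s • mat I J K a b c d := by
  simpa using mat_add_smul I J K s 0 a b c d 0 0 0 0

/-- Real quaternions are the matrices whose diagonal entries are conjugate and whose off-diagonal
entries are negatives of each other's conjugates. -/
theorem precomp_rmul (I J K : V →L[ℝ] V) (u : ℍ[ℝ]) :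
    precomp (rmul I J K u) = mat I J K (u.re + u.imI * Complex.I) (-u.imJ - u.imK * Complex.I)
      (u.imJ - u.imK * Complex.I) (u.re - u.imI * Complex.I) := by
  ext φ v
  rw [mat_apply, precomp_apply, rmul]
  simp only [add_apply, smul_apply, map_add, map_smul, ContinuousLinearMap.id_apply,
    Complex.real_smul]
  linear_combination (u.imI * φ (I v) + u.imK * φ (K v)) * Complex.I_mul_I

theorem precomp_J (I J K : V →L[ℝ] V) : precomp J = mat I J K 0 (-1) 1 0 := by
  ext φ v
  rw [mat_apply, precomp_apply]
  ring

theorem precomp_rotation (I J K : V →L[ℝ] V) (θ : ℝ) :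
    precomp (Real.cos θ • ContinuousLinearMap.id ℝ V + Real.sin θ • I) =
      mat I J K (Complex.exp (θ * Complex.I)) 0 0 (Complex.exp (-(θ * Complex.I))) := by
  ext φ v
  rw [mat_apply, precomp_apply, ← neg_mul, Complex.exp_mul_I, Complex.exp_mul_I, Complex.cos_neg,
    Complex.sin_neg]
  simp only [add_apply, smul_apply, map_add, map_smul, ContinuousLinearMap.id_apply,
    Complex.real_smul, Complex.ofReal_cos, Complex.ofReal_sin]
  linear_combination (Complex.sin θ * φ (I v)) * Complex.I_mul_I

end Quaternionic

theorem smul_zero_cform {V : Type*} [AddCommGroup V] [Module ℝ V] [TopologicalSpace V] {k : ℕ}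
    (c : ℂ) : c • (0 : CForm V k) = 0 := smul_zero (A := CForm V k) c

theorem zero_smul_cform {V : Type*} [AddCommGroup V] [Module ℝ V] [TopologicalSpace V] {k : ℕ}
    (x : CForm V k) : (0 : ℂ) • x = 0 := zero_smul (A := CForm V k) ℂ x

/-! ### Hodge types, the matrix form of `R`, and an explicit projection `P_+` -/

section Hodge

variable {V : Type*} [AddCommGroup V] [Module ℝ V] [TopologicalSpace V]
  [IsTopologicalAddGroup V] [ContinuousSMul ℝ V] [T2Space V] [FiniteDimensional ℝ V]

/-- The map of `k`-forms induced by a complexified quaternion. -/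
def act (I J K : V →L[ℝ] V) (k : ℕ) (a b c d : ℂ) : CForm V k →ₗ[ℂ] CForm V k :=
  ind k (mat I J K a b c d)

/-- The coefficient of `z ^ p w ^ (k - p)` in `act k z 0 0 w`. -/
def hodgeComp (I J K : V →L[ℝ] V) (k p : ℕ) : CForm V k →ₗ[ℂ] CForm V k :=
  coeffInd k (mat I J K 0 0 0 1) (mat I J K 1 0 0 0) p

variable {I J K : V →L[ℝ] V}

theorem act_mul (h : IsQuaternionic I J K) {k : ℕ} (a b c d a' b' c' d' : ℂ) (x : CForm V k) :
    act I J K k a b c d (act I J K k a' b' c' d' x) = act I J K k (a * a' + b * c')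
      (a * b' + b * d') (c * a' + d * c') (c * b' + d * d') x := by
  rw [act, act, act, ← ind_mul, mat_mul h]

theorem act_one {k : ℕ} (x : CForm V k) : act I J K k 1 0 0 1 x = x := by
  rw [act, mat_one, ind_one]

theorem act_smul {k : ℕ} (s a b c d : ℂ) (x : CForm V k) :
    act I J K k (s * a) (s * b) (s * c) (s * d) x = s ^ k • act I J K k a b c d x := by
  rw [act, mat_smul, ind_smul]; rfl

theorem coeffInd_eq_zero {k n : ℕ} (A B : DualEnd V) (hn : k < n) (x : CForm V k) :
    coeffInd k A B n x = 0 := by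
  rw [coeffInd_apply, Finset.filter_false_of_mem, Finset.sum_empty]
  intro S _ hS
  have := (Finset.card_le_univ S).trans_eq (Fintype.card_fin k)
  omega

theorem act_diag {k : ℕ} (z w : ℂ) (x : CForm V k) : act I J K k z 0 0 w x =
    ∑ n ∈ Finset.range (k + 1), (w ^ (k - n) * z ^ n) • hodgeComp I J K k n x := by
  simp only [hodgeComp]
  rw [← ind_add, ← mat_add_smul]
  simp [act]

theorem sum_comp {k : ℕ} (x : CForm V k) :
    ∑ n ∈ Finset.range (k + 1), hodgeComp I J K k n x = x := by
  conv_rhs => rw [← act_one (I := I) (J := J) (K := K) x, act_diag]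
  simp

/-- Applying `diag(z, w)` to the expansion of `diag(s, 1) x` gives the expansion of `diag(zs, w) x`;
compare the coefficients of the powers of `s`. -/
theorem act_diag_comp (h : IsQuaternionic I J K) {k n : ℕ} (z w : ℂ) (x : CForm V k) :
    act I J K k z 0 0 w (hodgeComp I J K k n x) = (w ^ (k - n) * z ^ n) • hodgeComp I J K k n x := by
  rcases le_or_gt n k with hn | hn
  · refine coeff_eq_of_sum_pow_eq Set.infinite_univ
      (fun n => act I J K k z 0 0 w (hodgeComp I J K k n x))
      (fun n => (w ^ (k - n) * z ^ n) • hodgeComp I J K k n x) (fun s _ => ?_) (Nat.lt_succ_of_le hn)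
    have := act_mul h z 0 0 w s 0 0 1 x
    simp only [mul_zero, zero_mul, add_zero, zero_add, mul_one] at this
    rw [act_diag s 1, map_sum, act_diag] at this
    convert this using 2 with m _ m _
    · rw [map_smul, one_pow, one_mul]
    · rw [smul_smul]; ring_nf
  · rw [hodgeComp, coeffInd_eq_zero _ _ hn, map_zero, smul_zero_cform]

theorem infinite_circle : (Set.range fun θ : ℝ => Complex.exp (θ * Complex.I) ^ 2).Infinite := by
  have : (fun θ : ℝ => Complex.exp (θ * Complex.I) ^ 2) '' Set.Ioo 0 1 ⊆
      -- For `θ` in `(0, 1)` the doubled angle stays in `[0, π]`, where the cosine is injective.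
      Set.range fun θ : ℝ => Complex.exp (θ * Complex.I) ^ 2 := Set.image_subset_range _ _
  refine Set.Infinite.mono this (Set.Infinite.image ?_ (Set.Ioo_infinite one_pos))
  intro a ha b hb hab
  simp only [← Complex.exp_nat_mul] at hab
  have := congrArg Complex.re hab
  have e (c : ℝ) : ((2 : ℕ) : ℂ) * ((c : ℂ) * Complex.I) = ((2 * c : ℝ) : ℂ) * Complex.I := by
    push_cast; ring
  rw [e, e, Complex.exp_ofReal_mul_I_re, Complex.exp_ofReal_mul_I_re] at this
  have h3 := Real.pi_gt_three
  have := Real.injOn_cos ⟨by linarith [ha.1], by linarith [ha.2]⟩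
    ⟨by linarith [hb.1], by linarith [hb.2]⟩ this
  linarith

theorem pull_rotation {k : ℕ} (θ : ℝ) (x : CForm V k) :
    pull k (Real.cos θ • ContinuousLinearMap.id ℝ V + Real.sin θ • I) x =
      act I J K k (Complex.exp (θ * Complex.I)) 0 0 (Complex.exp (-(θ * Complex.I))) x := by
  rw [pull_eq_ind, precomp_rotation I J K, act]

theorem comp_of_mem_hodge (J K : V →L[ℝ] V) {k p q : ℕ} (hk : p + q = k) {x : CForm V k}
    (hx : x ∈ hodge I k p q) {n : ℕ} (hn : n ≤ k) :
    hodgeComp I J K k n x = if n = p then x else 0 := by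
  refine coeff_eq_of_sum_pow_eq infinite_circle
    (fun n => hodgeComp I J K k n x) (fun n => if n = p then x else 0) (fun s hs => ?_)
    (Nat.lt_succ_of_le hn)
  obtain ⟨θ, hθ⟩ := hs
  have := hx θ
  rw [pull_rotation (J := J) (K := K), act_diag] at this
  have e : Complex.exp (θ * Complex.I) ≠ 0 := Complex.exp_ne_zero _
  set z := Complex.exp (θ * Complex.I) with hz
  have hs : s = z ^ 2 := hθ.symm
  rw [hs]
  have hzi : Complex.exp (-(θ * Complex.I)) = z⁻¹ := by rw [Complex.exp_neg]
  have hpq : Complex.exp (((p : ℂ) - q) * θ * Complex.I) = z ^ p * (z⁻¹) ^ q := by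
    rw [hz, ← Complex.exp_neg, ← Complex.exp_nat_mul, ← Complex.exp_nat_mul, ← Complex.exp_add]
    congr 1; ring
  rw [hzi, hpq] at this
  -- On the circle `w = z⁻¹`, so multiplication by `z ^ k` clears denominators and turns the `n`-th
  -- term into a multiple of `(z ^ 2) ^ n`: the expansion is a polynomial in `z ^ 2`.
  have := congrArg (fun y => z ^ k • y) this
  simp only [Finset.smul_sum, smul_smul] at this
  rw [Finset.sum_eq_single (M := CForm V k) (f := fun i => (z ^ 2) ^ i • if i = p then x else 0)
    p (fun m _ hm => by rw [if_neg hm, smul_zero_cform])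
    (fun hp => absurd (Finset.mem_range.2 (by omega)) hp), if_pos rfl]
  have h1 : ∀ m ∈ Finset.range (k + 1), (z ^ 2) ^ m • hodgeComp I J K k m x =
      (z ^ k * (z⁻¹ ^ (k - m) * z ^ m)) • hodgeComp I J K k m x := by
    intro m hm
    congr 1
    have : m ≤ k := Nat.lt_succ_iff.1 (Finset.mem_range.1 hm)
    obtain ⟨l, rfl⟩ := Nat.exists_eq_add_of_le this
    rw [Nat.add_sub_cancel_left, pow_add, inv_pow]
    field_simp
    ring
  rw [Finset.sum_congr rfl h1, this]
  congr 1
  rw [← hk, pow_add, inv_pow]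
  field_simp
  ring

/-- The circle action determines the action of the whole diagonal torus, and even of degenerate
diagonal matrices. In this form the type of a form is checked by multiplying matrices. -/
theorem mem_hodge_iff (h : IsQuaternionic I J K) {k p q : ℕ} (hk : p + q = k) {x : CForm V k} :
    x ∈ hodge I k p q ↔ ∀ z w : ℂ, act I J K k z 0 0 w x = (z ^ p * w ^ q) • x := by
  constructor
  · intro hx z w
    have hp := comp_of_mem_hodge J K hk hx (n := p) (by omega)
    rw [if_pos rfl] at hp
    rw [← hp, act_diag_comp h, show k - p = q by omega, mul_comm]
  · intro hx θ
    rw [pull_rotation (J := J) (K := K), hx, ← Complex.exp_nat_mul, ← Complex.exp_nat_mul,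
      ← Complex.exp_add]
    congr 2; ring

theorem comp_mem_hodge (h : IsQuaternionic I J K) {k p q : ℕ} (hk : p + q = k) (x : CForm V k) :
    hodgeComp I J K k p x ∈ hodge I k p q := by
  rw [mem_hodge_iff h hk]
  intro z w
  rw [act_diag_comp h, show k - p = q by omega, mul_comm]

theorem hodgeProj_eq (h : IsQuaternionic I J K) {k p q : ℕ} (hk : p + q = k) :
    IsCompl (hodge I k p q) (hodgeCompl I k p q) ∧ hodgeProj I k p q = hodgeComp I J K k p := by
  refine projAlong_eq _ (comp_mem_hodge h hk) (fun x hx => ?_) (fun x hx => ?_) (fun x => ?_)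
  · rw [comp_of_mem_hodge J K hk hx (by omega), if_pos rfl]
  · have : hodgeCompl I k p q ≤ LinearMap.ker (hodgeComp I J K k p) := by
      refine iSup_le fun a => iSup_le fun b => iSup_le fun hab y hy => ?_
      rw [LinearMap.mem_ker, comp_of_mem_hodge J K hab.1 hy (by omega), if_neg]
      rintro rfl
      exact hab.2 (by rw [Prod.mk.injEq]; omega)
    exact this hx
  · have hs := sum_comp (I := I) (J := J) (K := K) x
    rw [← Finset.add_sum_erase _ _ (show p ∈ Finset.range (k + 1) by
      rw [Finset.mem_range]; omega)] at hs
    rw [sub_eq_of_eq_add' hs.symm]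
    refine Submodule.sum_mem _ fun n hn => ?_
    rw [Finset.mem_erase, Finset.mem_range] at hn
    refine Submodule.mem_iSup_of_mem n (Submodule.mem_iSup_of_mem (k - n)
      (Submodule.mem_iSup_of_mem ⟨by omega, fun e => hn.1 (Prod.mk.inj e).1⟩ ?_))
    exact comp_mem_hodge h (by omega) x

/-- The form `R a` of type `(k,0)`. -/
def ringR (I J K : V →L[ℝ] V) (k : ℕ) : CForm V k →ₗ[ℂ] CForm V k := act I J K k 1 1 0 0

theorem ringR_mem_hodge (h : IsQuaternionic I J K) {k : ℕ} (x : CForm V k) :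
    ringR I J K k x ∈ hodge I k k 0 := by
  rw [mem_hodge_iff h (add_zero k)]
  intro z w
  have := act_smul (I := I) (J := J) (K := K) z 1 1 0 0 x
  simp only [mul_zero, mul_one] at this
  rw [ringR, act_mul h, pow_zero, mul_one (z ^ k), ← this]
  simp

/-- A `(k,0)`-form is fixed by `diag(1, 0)`, and multiplying by that matrix on the right erases the
second column. -/
theorem act_of_mem_hodge_top (h : IsQuaternionic I J K) {k : ℕ} {x : CForm V k}
    (hx : x ∈ hodge I k k 0) (a b c d : ℂ) : act I J K k a b c d x = act I J K k a 0 c 0 x := by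
  have hx := (mem_hodge_iff h (add_zero k)).1 hx 1 0
  rw [one_pow, pow_zero, one_mul, one_smul] at hx
  rw [← hx, act_mul h, act_mul h]
  simp

theorem ringR_of_mem_hodge (h : IsQuaternionic I J K) {k : ℕ} {x : CForm V k}
    (hx : x ∈ hodge I k k 0) : ringR I J K k x = x := by
  rw [ringR, act_of_mem_hodge_top h hx, ← act_of_mem_hodge_top h hx 1 0 0 1, act_one]

/-- `hMul` as a linear map. -/
def hMulₗ (J : V →L[ℝ] V) (k p : ℕ) : CForm V k →ₗ[ℂ] CForm V k where
  toFun := hMul J k p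
  map_add' a b := by
    rw [hMul_eq, hMul_eq, hMul_eq, ← map_add, ← map_add]; rfl
  map_smul' c a := by
    rw [hMul_eq, hMul_eq, ← map_smul, ← map_smul]; rfl

@[simp] theorem hMulₗ_apply (J : V →L[ℝ] V) (k p : ℕ) (x : CForm V k) :
    hMulₗ J k p x = hMul J k p x := rfl

/-- On forms of type `(k,0)`, `hMul` is induced by matrix units. -/
theorem hMul_of_mem_hodge (h : IsQuaternionic I J K) {k p : ℕ} {x : CForm V k}
    (hx : x ∈ hodge I k k 0) : hMul J k p x = alt k (mind (fun j : Fin k =>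
      if (j : ℕ) < p then mat I J K 1 0 0 0 else mat I J K 0 0 1 0)
        x.toContinuousMultilinearMap) := by
  have hx' := (mem_hodge_iff h (add_zero k)).1 hx 1 0
  rw [one_pow, pow_zero, one_mul, one_smul] at hx'
  conv_lhs => rw [← hx', hMul_eq, act, toContinuousMultilinearMap_ind, mind_comp]
  congr 3
  ext1 j
  rw [precomp_J I J K, ← mat_one I J K]
  split_ifs <;> rw [mat_mul h] <;> simp

theorem ind_hMul (h : IsQuaternionic I J K) {k p : ℕ} {x : CForm V k}
    (hx : x ∈ hodge I k k 0) (a b c d : ℂ) : act I J K k a b c d (hMul J k p x) =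
      alt k (mind (fun j : Fin k => if (j : ℕ) < p then mat I J K a 0 c 0 else mat I J K b 0 d 0)
        x.toContinuousMultilinearMap) := by
  rw [hMul_of_mem_hodge h hx, act, ind_alt, mind_comp]
  congr 3
  ext1 j
  split_ifs <;> rw [mat_mul h] <;> simp

/-- On a `(k,0)`-form, `hMul` puts the matrix unit `E₁₁` or `E₂₁` in each slot. The matrix of
`ringR` sends both to `E₁₁`, which acts as the identity there, so `ringR` inverts `hMul` for every
`p`. -/
theorem ringR_hMul (h : IsQuaternionic I J K) {k p : ℕ} {x : CForm V k}
    (hx : x ∈ hodge I k k 0) : ringR I J K k (hMul J k p x) = x := by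
  rw [ringR, ind_hMul h hx]
  simp only [ite_self]
  rw [← ind_apply]
  exact (act_of_mem_hodge_top h hx 1 0 0 1).symm.trans (act_one x)

theorem hMul_mem_hodge (h : IsQuaternionic I J K) {k p q : ℕ} (hk : p + q = k) {x : CForm V k}
    (hx : x ∈ hodge I k k 0) : hMul J k p x ∈ hodge I k p q := by
  rw [mem_hodge_iff h hk]
  intro z w
  rw [ind_hMul h hx, hMul_of_mem_hodge h hx, ← map_smul]
  have hprod : z ^ p * w ^ q = ∏ j : Fin k, if (j : ℕ) < p then z else w := by
    rw [Finset.prod_ite, Finset.prod_const, Finset.prod_const, Finset.filter_not,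
      Finset.card_sdiff_of_subset (Finset.filter_subset _ _), Fin.card_filter_val_lt,
      Finset.card_univ, Fintype.card_fin, min_eq_right (by omega)]
    congr 2; omega
  rw [hprod, ← mind_smul]
  congr 3
  ext1 j
  split_ifs <;> rw [← mat_smul] <;> simp

theorem coeffInd_eq_hMul (h : IsQuaternionic I J K) {k p : ℕ} (hp : p ≤ k) {x : CForm V k}
    (hx : x ∈ hodge I k k 0) : coeffInd k (mat I J K 0 0 1 0) (mat I J K 1 0 0 0) p x =
      (k.choose p : ℂ) • hMul J k p x := by
  rw [coeffInd_eq_choose _ _ hp, hMul_of_mem_hodge h hx]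

theorem act_eq_sum_hMul (h : IsQuaternionic I J K) {k : ℕ} {x : CForm V k}
    (hx : x ∈ hodge I k k 0) (a b c d : ℂ) : act I J K k a b c d x =
      ∑ p ∈ Finset.range (k + 1), (c ^ (k - p) * a ^ p * k.choose p) • hMul J k p x := by
  rw [act_of_mem_hodge_top h hx, act]
  have := mat_add_smul I J K c a 0 0 1 0 1 0 0 0
  simp only [mul_zero, mul_one, zero_add, add_zero] at this
  rw [this, ind_add]
  refine Finset.sum_congr rfl fun p hp => ?_
  rw [coeffInd_eq_hMul h (Nat.lt_succ_iff.1 (Finset.mem_range.1 hp)) hx, smul_smul]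

/-- The projection `P_+` as an explicit sum. -/
def plusProj (I J K : V →L[ℝ] V) (k : ℕ) : CForm V k →ₗ[ℂ] CForm V k :=
  ∑ p ∈ Finset.range (k + 1), hMulₗ J k p ∘ₗ ringR I J K k ∘ₗ hodgeComp I J K k p

theorem plusProj_of_mem_hodge {k p q : ℕ} (hk : p + q = k)
    {x : CForm V k} (hx : x ∈ hodge I k p q) :
    plusProj I J K k x = hMul J k p (ringR I J K k x) := by
  rw [plusProj, LinearMap.sum_apply, Finset.sum_eq_single p]
  · rw [LinearMap.comp_apply, LinearMap.comp_apply,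
      comp_of_mem_hodge J K hk hx (by omega), if_pos rfl]
    rfl
  · intro n hn hnp
    rw [LinearMap.comp_apply, LinearMap.comp_apply,
      comp_of_mem_hodge J K hk hx (Nat.lt_succ_iff.1 (Finset.mem_range.1 hn)), if_neg hnp, map_zero,
      map_zero]
  · intro hp
    exact absurd (Finset.mem_range.2 (by omega)) hp

/-- The span of the image of `plusProj`. -/
def plusPart (I J : V →L[ℝ] V) (k : ℕ) : Submodule ℂ (CForm V k) :=
  ⨆ p : Fin (k + 1), (hodge I k k 0).map (hMulₗ J k p)

/-- The kernel of `plusProj`: the largest invariant subspace without forms of type `(k,0)`. -/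
def lowPart (I J K : V →L[ℝ] V) (k : ℕ) : Submodule ℂ (CForm V k) :=
  ⨅ (z : ℂ) (w : ℂ), LinearMap.ker (act I J K k z w 0 0)

theorem mem_lowPart {k : ℕ} {x : CForm V k} :
    x ∈ lowPart I J K k ↔ ∀ z w : ℂ, act I J K k z w 0 0 x = 0 := by
  simp [lowPart]

/-- The matrix with top row `(z, w)` and zero bottom row factors as the matrix of `ringR` times
`diag(z, w)`. -/
theorem act_row (h : IsQuaternionic I J K) {k : ℕ} (z w : ℂ) (x : CForm V k) :
    act I J K k z w 0 0 x =
      ∑ n ∈ Finset.range (k + 1), (w ^ (k - n) * z ^ n) • ringR I J K k (hodgeComp I J K k n x) := by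
  have := act_mul h 1 1 0 0 z 0 0 w x
  simp only [one_mul, mul_zero, zero_mul, zero_add, add_zero] at this
  rw [← this, act_diag, map_sum]
  exact Finset.sum_congr rfl fun n _ => map_smul _ _ _

theorem mem_lowPart_iff (h : IsQuaternionic I J K) {k : ℕ} {x : CForm V k} :
    x ∈ lowPart I J K k ↔ ∀ n ≤ k, ringR I J K k (hodgeComp I J K k n x) = 0 := by
  rw [mem_lowPart]
  constructor
  · intro hx n hn
    refine coeff_eq_of_sum_pow_eq Set.infinite_univ
      (fun n => ringR I J K k (hodgeComp I J K k n x)) (fun _ => 0) (fun z _ => ?_)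
      (Nat.lt_succ_of_le hn)
    have := hx z 1
    rw [act_row h] at this
    simpa using this
  · intro hx z w
    rw [act_row h]
    refine Finset.sum_eq_zero fun n hn => ?_
    rw [hx n (Nat.lt_succ_iff.1 (Finset.mem_range.1 hn)), smul_zero_cform]

theorem plusProj_hMul (h : IsQuaternionic I J K) {k p : ℕ} (hp : p ≤ k) {x : CForm V k}
    (hx : x ∈ hodge I k k 0) : plusProj I J K k (hMul J k p x) = hMul J k p x := by
  rw [plusProj_of_mem_hodge (q := k - p) (by omega) (hMul_mem_hodge h (by omega) hx),
    ringR_hMul h hx]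

/-- The map fixes `plusPart` by `ringR_hMul` and kills `lowPart` by `mem_lowPart_iff`. It remains to
place the defect `x - plusProj x` in `lowPart`, which follows from idempotence. -/
theorem plusProj_eq (h : IsQuaternionic I J K) (k : ℕ) :
    IsCompl (plusPart I J k) (lowPart I J K k) ∧
      projAlong (plusPart I J k) (lowPart I J K k) = plusProj I J K k := by
  have hmem (x : CForm V k) : plusProj I J K k x ∈ plusPart I J k := by
    rw [plusProj, LinearMap.sum_apply]
    refine Submodule.sum_mem _ fun p hp => Submodule.mem_iSup_of_mem ⟨p, Finset.mem_range.1 hp⟩ ?_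
    exact ⟨ringR I J K k (hodgeComp I J K k p x), ringR_mem_hodge h _, rfl⟩
  have hfix (x : CForm V k) (hx : x ∈ plusPart I J k) : plusProj I J K k x = x := by
    refine Submodule.iSup_induction _ (motive := fun x => plusProj I J K k x = x) hx ?_
      (map_zero _) (fun a b ha hb => by rw [map_add, ha, hb])
    rintro p _ ⟨y, hy, rfl⟩
    exact plusProj_hMul h (Nat.lt_succ_iff.1 p.2) hy
  have hker (x : CForm V k) (hx : x ∈ lowPart I J K k) : plusProj I J K k x = 0 := by
    rw [plusProj, LinearMap.sum_apply]
    refine Finset.sum_eq_zero fun n hn => ?_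
    rw [LinearMap.comp_apply, LinearMap.comp_apply, (mem_lowPart_iff h).1 hx n
      (Nat.lt_succ_iff.1 (Finset.mem_range.1 hn)), map_zero]
  refine projAlong_eq _ hmem hfix hker fun x => ?_
  have hx : plusProj I J K k (x - plusProj I J K k x) = 0 := by
    rw [map_sub, hfix _ (hmem x), sub_self]
  rw [mem_lowPart_iff h]
  set y := x - plusProj I J K k x
  intro n hn
  -- The summands of `plusProj` have distinct types, so each can be isolated; `ringR` then undoes
  -- `hMul`, and `plusProj y = 0` forces every `ringR` of a component of `y` to vanish.
  have h1 : hodgeComp I J K k n (plusProj I J K k y) = hMul J k n (ringR I J K k (hodgeComp I J K k n y)) := by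
    rw [plusProj, LinearMap.sum_apply, map_sum, Finset.sum_eq_single n]
    · rw [LinearMap.comp_apply, LinearMap.comp_apply, hMulₗ_apply,
        comp_of_mem_hodge J K (q := k - n) (by omega)
          (hMul_mem_hodge h (by omega) (ringR_mem_hodge h _)) hn, if_pos rfl]
    · intro m hm hmn
      rw [Finset.mem_range] at hm
      rw [LinearMap.comp_apply, LinearMap.comp_apply, hMulₗ_apply,
        comp_of_mem_hodge J K (q := k - m) (by omega)
          (hMul_mem_hodge h (by omega) (ringR_mem_hodge h _)) hn, if_neg (Ne.symm hmn)]
    · intro hn'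
      exact absurd (Finset.mem_range.2 (by omega)) hn'
  have h2 := congrArg (ringR I J K k) h1
  rw [ringR_hMul h (ringR_mem_hodge h _), hx, map_zero, map_zero] at h2
  exact h2.symm

end Hodge

/-! ### Polynomial continuation from `SU(2)` to all matrices -/

section Weights

variable {V : Type*} [AddCommGroup V] [Module ℝ V] [TopologicalSpace V]
  [IsTopologicalAddGroup V] [ContinuousSMul ℝ V] [T2Space V] [FiniteDimensional ℝ V]
  {I J K : V →L[ℝ] V}

/-- Along an affine line of matrices the action is polynomial in the parameter, so membership at
infinitely many parameters gives membership at all of them. -/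
theorem act_line_mem {k : ℕ} (W : Submodule ℂ (CForm V k)) {S : Set ℂ} (hS : S.Infinite)
    (a b c d a' b' c' d' : ℂ) (x : CForm V k)
    (hx : ∀ t ∈ S, act I J K k (a + t * a') (b + t * b') (c + t * c') (d + t * d') x ∈ W) (t : ℂ) :
    act I J K k (a + t * a') (b + t * b') (c + t * c') (d + t * d') x ∈ W := by
  have key (t : ℂ) : act I J K k (a + t * a') (b + t * b') (c + t * c') (d + t * d') x =
      ∑ n ∈ Finset.range (k + 1),
        t ^ n • coeffInd k (mat I J K a b c d) (mat I J K a' b' c' d') n x := by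
    have := mat_add_smul I J K 1 t a b c d a' b' c' d'
    simp only [one_mul] at this
    rw [act, this, ind_add]
    simp only [one_pow, one_mul]
  rw [key]
  refine Submodule.sum_mem _ fun n hn => Submodule.smul_mem _ _ ?_
  exact coeff_mem_of_sum_pow_mem W hS
    (fun n => coeffInd k (mat I J K a b c d) (mat I J K a' b' c' d') n x)
    (fun t ht => by rw [← key]; exact hx t ht) (Finset.mem_range.1 hn)

theorem pull_rmul {k : ℕ} (u : ℍ[ℝ]) (x : CForm V k) : pull k (rmul I J K u) x =
    act I J K k (u.re + u.imI * Complex.I) (-u.imJ - u.imK * Complex.I)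
      (u.imJ - u.imK * Complex.I) (u.re - u.imI * Complex.I) x := by
  rw [pull_eq_ind, precomp_rmul, act]

theorem SU2Invariant.pull_mem {k : ℕ} {W : Submodule ℂ (CForm V k)} (hW : SU2Invariant I J K W)
    {u : ℍ[ℝ]} (hu : u ≠ 0) {x : CForm V k} (hx : x ∈ W) : pull k (rmul I J K u) x ∈ W := by
  have hn : ‖u‖ ≠ 0 := norm_ne_zero_iff.2 hu
  have h1 := hW (‖u‖⁻¹ • u) (by rw [norm_smul, norm_inv, norm_norm, inv_mul_cancel₀ hn]) x hx
  -- The action on `k`-forms is homogeneous of degree `k`, so normalizing the quaternion costs only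
  -- a scalar.
  have h2 : pull k (rmul I J K u) x =
      ((‖u‖ : ℂ) ^ k) • pull k (rmul I J K (‖u‖⁻¹ • u)) x := by
    rw [pull_rmul, pull_rmul, ← act_smul]
    have hc : (‖u‖ : ℂ) ≠ 0 := by exact_mod_cast hn
    congr 1
    simp only [Quaternion.re_smul, Quaternion.imI_smul, Quaternion.imJ_smul, Quaternion.imK_smul,
      smul_eq_mul, Complex.ofReal_mul, Complex.ofReal_inv]
    congr 1 <;> field_simp
  rw [h2]
  exact W.smul_mem _ h1

theorem infinite_ofReal : (Set.range ((↑) : ℝ → ℂ)).Infinite :=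
  Set.infinite_range_of_injective Complex.ofReal_injective

/-- Weyl's unitary trick: a subspace stable under real quaternions is stable under complex ones. The
four real coordinates are made complex one at a time along lines. -/
theorem SU2Invariant.act_mem {k : ℕ} {W : Submodule ℂ (CForm V k)} (hW : SU2Invariant I J K W)
    (a b c d : ℂ) {x : CForm V k} (hx : x ∈ W) : act I J K k a b c d x ∈ W := by
  have h1 (r y z w : ℝ) : act I J K k (r + y * Complex.I) (-z - w * Complex.I)
      (z - w * Complex.I) (r - y * Complex.I) x ∈ W := by
    -- The line varies the real part. The value `0` is left out so that the quaternion is nonzero,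
    -- and continuation then covers the zero quaternion too.
    have := act_line_mem (I := I) (J := J) (K := K) W (S := ((↑) : ℝ → ℂ) '' {0}ᶜ)
      ((Set.finite_singleton (0 : ℝ)).infinite_compl.image Complex.ofReal_injective.injOn)
      (y * Complex.I) (-z - w * Complex.I) (z - w * Complex.I) (-y * Complex.I) 1 0 0 1 x ?_ r
    · convert this using 2; ring_nf
    · rintro _ ⟨s, hs, rfl⟩
      obtain ⟨u, e1, e2, e3, e4⟩ : ∃ u : ℍ[ℝ], u.re = s ∧ u.imI = y ∧ u.imJ = z ∧ u.imK = w :=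
        ⟨⟨s, y, z, w⟩, rfl, rfl, rfl, rfl⟩
      have := hW.pull_mem (u := u) (fun e => hs (by rw [← e1, e]; rfl)) hx
      rw [pull_rmul, e1, e2, e3, e4] at this
      convert this using 2; ring_nf
  have h2 (r y : ℂ) (z w : ℝ) : act I J K k (r + y * Complex.I) (-z - w * Complex.I)
      (z - w * Complex.I) (r - y * Complex.I) x ∈ W := by
    have h3 (y : ℝ) := act_line_mem (I := I) (J := J) (K := K) W infinite_ofReal
      (y * Complex.I) (-z - w * Complex.I) (z - w * Complex.I) (-y * Complex.I) 1 0 0 1 x (by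
        rintro _ ⟨s, rfl⟩
        convert h1 s y z w using 2; ring_nf) r
    have := act_line_mem (I := I) (J := J) (K := K) W infinite_ofReal
      r (-z - w * Complex.I) (z - w * Complex.I) r Complex.I 0 0 (-Complex.I) x (by
        rintro _ ⟨s, rfl⟩
        convert h3 s using 2; ring_nf) y
    convert this using 2; ring_nf
  have h3 (r y z w : ℂ) : act I J K k (r + y * Complex.I) (-z - w * Complex.I)
      (z - w * Complex.I) (r - y * Complex.I) x ∈ W := by
    have h3 (w : ℝ) := act_line_mem (I := I) (J := J) (K := K) W infinite_ofReal
      (r + y * Complex.I) (- w * Complex.I) (- w * Complex.I) (r - y * Complex.I) 0 (-1) 1 0 x (by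
        rintro _ ⟨s, rfl⟩
        convert h2 r y s w using 2; ring_nf) z
    have := act_line_mem (I := I) (J := J) (K := K) W infinite_ofReal
      (r + y * Complex.I) (-z) z (r - y * Complex.I) 0 (-Complex.I) (-Complex.I) 0 x (by
        rintro _ ⟨s, rfl⟩
        convert h3 s using 2; ring_nf) w
    convert this using 2; ring_nf
  -- The coordinates of the matrix with respect to the complexified `1, I, J, K`.
  have := h3 ((a + d) / 2) ((d - a) / 2 * Complex.I) ((c - b) / 2) ((b + c) / 2 * Complex.I)
  have e1 : (a + d) / 2 + (d - a) / 2 * Complex.I * Complex.I = a := by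
    linear_combination ((d - a) / 2) * Complex.I_mul_I
  have e2 : -((c - b) / 2) - (b + c) / 2 * Complex.I * Complex.I = b := by
    linear_combination (-(b + c) / 2) * Complex.I_mul_I
  have e3 : (c - b) / 2 - (b + c) / 2 * Complex.I * Complex.I = c := by
    linear_combination (-(b + c) / 2) * Complex.I_mul_I
  have e4 : (a + d) / 2 - (d - a) / 2 * Complex.I * Complex.I = d := by
    linear_combination (-(d - a) / 2) * Complex.I_mul_I
  rwa [e1, e2, e3, e4] at this

theorem SU2Invariant.hodgeComp_mem {k n : ℕ} {W : Submodule ℂ (CForm V k)}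
    (hW : SU2Invariant I J K W) {x : CForm V k} (hx : x ∈ W) : hodgeComp I J K k n x ∈ W := by
  rcases le_or_gt n k with hn | hn
  · refine coeff_mem_of_sum_pow_mem W Set.infinite_univ (fun n => hodgeComp I J K k n x)
      (fun z _ => ?_) (Nat.lt_succ_of_le hn)
    have := hW.act_mem z 0 0 1 hx
    rw [act_diag] at this
    simpa using this
  · rw [hodgeComp, coeffInd_eq_zero _ _ hn]
    exact W.zero_mem

theorem weight_right (h : IsQuaternionic I J K) {k s : ℕ} {y : CForm V k}
    (hy : ∀ w, act I J K k 1 0 0 w y = w ^ s • y) :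
    (s ≤ k → y ∈ hodge I k (k - s) s) ∧ (k < s → y = 0) := by
  -- Both polynomials are padded with zeros to `k + 1 + s` terms so that the coefficient of `w ^ s`
  -- can be compared even when `s > k`. The component of index `k - j` goes with `w ^ j`.
  have key := coeff_eq_of_sum_pow_eq (n := k + 1 + s) Set.infinite_univ
    (fun j => if j < k + 1 then hodgeComp I J K k (k - j) y else 0)
    (fun j => if j = s then y else 0) (fun w _ => ?_) (show s < k + 1 + s by omega)
  · simp only [if_true] at key
    constructor
    · intro hs
      rw [if_pos (by omega)] at key
      rw [← key]
      exact comp_mem_hodge h (by omega) y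
    · intro hs
      rw [if_neg (by omega)] at key
      exact key.symm
  · rw [Finset.sum_range_add, Finset.sum_eq_zero (s := Finset.range s) fun j _ => by
      rw [if_neg (by omega), smul_zero_cform], add_zero, Finset.sum_eq_single
      (f := fun i => w ^ i • if i = s then y else 0) s (fun m _ hm => by
        rw [if_neg hm, smul_zero_cform])
      (fun hs => absurd (Finset.mem_range.2 (by omega)) hs), if_pos rfl, ← hy, act_diag,
      ← Finset.sum_range_reflect (fun j => (w ^ (k - j) * 1 ^ j) • hodgeComp I J K k j y)]
    refine Finset.sum_congr rfl fun j hj => ?_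
    rw [Finset.mem_range] at hj
    rw [if_pos hj, one_pow, mul_one, show k + 1 - 1 - j = k - j by omega,
      show k - (k - j) = j by omega]

theorem weight_left (h : IsQuaternionic I J K) {k s : ℕ} {y : CForm V k}
    (hy : ∀ z, act I J K k z 0 0 1 y = z ^ s • y) :
    (s ≤ k → y ∈ hodge I k s (k - s)) ∧ (k < s → y = 0) := by
  have key := coeff_eq_of_sum_pow_eq (n := k + 1 + s) Set.infinite_univ
    (fun j => if j < k + 1 then hodgeComp I J K k j y else 0)
    (fun j => if j = s then y else 0) (fun w _ => ?_) (show s < k + 1 + s by omega)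
  · simp only [if_true] at key
    constructor
    · intro hs
      rw [if_pos (by omega)] at key
      rw [← key]
      exact comp_mem_hodge h (by omega) y
    · intro hs
      rw [if_neg (by omega)] at key
      exact key.symm
  · rw [Finset.sum_range_add, Finset.sum_eq_zero (s := Finset.range s) fun j _ => by
      rw [if_neg (by omega), smul_zero_cform], add_zero, Finset.sum_eq_single
      (f := fun i => w ^ i • if i = s then y else 0) s (fun m _ hm => by
        rw [if_neg hm, smul_zero_cform])
      (fun hs => absurd (Finset.mem_range.2 (by omega)) hs), if_pos rfl, ← hy, act_diag]
    refine Finset.sum_congr rfl fun j hj => ?_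
    rw [Finset.mem_range] at hj
    rw [if_pos hj, one_pow, one_mul]

end Weights

/-! ### Raising and lowering operators -/

section HighestWeight

variable {V : Type*} [AddCommGroup V] [Module ℝ V] [TopologicalSpace V]
  [IsTopologicalAddGroup V] [ContinuousSMul ℝ V] [T2Space V] [FiniteDimensional ℝ V]

/-- Divided powers of the lowering operator. -/
def lower (I J K : V →L[ℝ] V) (k n : ℕ) : CForm V k →ₗ[ℂ] CForm V k :=
  coeffInd k (mat I J K 1 0 0 1) (mat I J K 0 0 1 0) n

/-- Divided powers of the raising operator. -/
def raise (I J K : V →L[ℝ] V) (k n : ℕ) : CForm V k →ₗ[ℂ] CForm V k :=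
  coeffInd k (mat I J K 1 0 0 1) (mat I J K 0 1 0 0) n

variable {I J K : V →L[ℝ] V}

theorem act_lower {k : ℕ} (t : ℂ) (x : CForm V k) : act I J K k 1 0 t 1 x =
    ∑ n ∈ Finset.range (k + 1), t ^ n • lower I J K k n x := by
  have := mat_add_smul I J K 1 t 1 0 0 1 0 0 1 0
  simp only [mul_zero, add_zero, zero_add, mul_one] at this
  rw [act, this, ind_add]
  simp only [one_pow, one_mul, lower]

theorem act_raise {k : ℕ} (t : ℂ) (x : CForm V k) : act I J K k 1 t 0 1 x =
    ∑ n ∈ Finset.range (k + 1), t ^ n • raise I J K k n x := by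
  have := mat_add_smul I J K 1 t 1 0 0 1 0 1 0 0
  simp only [mul_zero, add_zero, zero_add, mul_one] at this
  rw [act, this, ind_add]
  simp only [one_pow, one_mul, raise]

theorem lower_of_lt {k n : ℕ} (hn : k < n) (x : CForm V k) : lower I J K k n x = 0 :=
  coeffInd_eq_zero _ _ hn x

theorem raise_of_lt {k n : ℕ} (hn : k < n) (x : CForm V k) : raise I J K k n x = 0 :=
  coeffInd_eq_zero _ _ hn x

theorem lower_zero {k : ℕ} (x : CForm V k) : lower I J K k 0 x = x := by
  have := act_lower (I := I) (J := J) (K := K) 0 x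
  rw [act_one, Finset.sum_eq_single (M := CForm V k) 0] at this
  · rw [pow_zero, one_smul] at this; exact this.symm
  · intro n _ hn
    rw [zero_pow hn]; module
  · intro hn
    exact absurd (Finset.mem_range.2 (by omega)) hn

theorem raise_zero {k : ℕ} (x : CForm V k) : raise I J K k 0 x = x := by
  have := act_raise (I := I) (J := J) (K := K) 0 x
  rw [act_one, Finset.sum_eq_single (M := CForm V k) 0] at this
  · rw [pow_zero, one_smul] at this; exact this.symm
  · intro n _ hn
    rw [zero_pow hn]; module
  · intro hn
    exact absurd (Finset.mem_range.2 (by omega)) hn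

/-- Lowerings are coefficients of the lower unipotent action. The map `F` and the infinite set `S`
allow a further matrix to be applied while finitely many bad parameters are avoided. -/
theorem lower_mem (W : Submodule ℂ (CForm V k)) {S : Set ℂ} (hS : S.Infinite) {x : CForm V k}
    {F : CForm V k →ₗ[ℂ] CForm V k}
    (hx : ∀ t ∈ S, F (act I J K k 1 0 t 1 x) ∈ W) (n : ℕ) : F (lower I J K k n x) ∈ W := by
  rcases le_or_gt n k with hn | hn
  · refine coeff_mem_of_sum_pow_mem W hS (fun n => F (lower I J K k n x))
      (fun t ht => ?_) (Nat.lt_succ_of_le hn)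
    have := hx t ht
    rw [act_lower, map_sum] at this
    simpa only [map_smul] using this
  · rw [lower_of_lt hn, map_zero]
    exact W.zero_mem

theorem raise_mem (W : Submodule ℂ (CForm V k)) {x : CForm V k}
    (hx : ∀ t, act I J K k 1 t 0 1 x ∈ W) (n : ℕ) : raise I J K k n x ∈ W := by
  rcases le_or_gt n k with hn | hn
  · refine coeff_mem_of_sum_pow_mem W Set.infinite_univ (fun n => raise I J K k n x)
      (fun t ht => ?_) (Nat.lt_succ_of_le hn)
    have := hx t
    rwa [act_raise] at this
  · rw [raise_of_lt hn]
    exact W.zero_mem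

theorem act_diag_lower (h : IsQuaternionic I J K) {k p q : ℕ} (hk : p + q = k) {v : CForm V k}
    (hv : v ∈ hodge I k p q) (n : ℕ) (w : ℂ) :
    act I J K k 1 0 0 w (lower I J K k n v) = w ^ (q + n) • lower I J K k n v := by
  rcases le_or_gt n k with hn | hn
  · refine coeff_eq_of_sum_pow_eq Set.infinite_univ
      (fun n => act I J K k 1 0 0 w (lower I J K k n v))
      (fun n => w ^ (q + n) • lower I J K k n v) (fun t _ => ?_) (Nat.lt_succ_of_le hn)
    -- Conjugation by `diag(1, w)` multiplies the parameter of the lower unipotent matrix by `w`;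
    -- hence `n` lowerings add `n` to the weight in `w`.
    have h1 := act_mul h 1 0 0 w 1 0 t 1 v
    have h2 := act_mul h 1 0 (w * t) 1 1 0 0 w v
    simp only [mul_zero, zero_mul, add_zero, zero_add, mul_one, one_mul] at h1 h2
    rw [← h2, (mem_hodge_iff h hk).1 hv, map_smul, act_lower, act_lower, map_sum, one_pow,
      one_mul, Finset.smul_sum] at h1
    simp only [map_smul, mul_pow, smul_smul] at h1
    refine h1.trans (Finset.sum_congr rfl fun m _ => ?_)
    rw [smul_smul, pow_add]
    ring_nf
  · rw [lower_of_lt hn, map_zero, smul_zero_cform]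

theorem act_diag_raise (h : IsQuaternionic I J K) {k p q : ℕ} (hk : p + q = k) {v : CForm V k}
    (hv : v ∈ hodge I k p q) (n : ℕ) (z : ℂ) :
    act I J K k z 0 0 1 (raise I J K k n v) = z ^ (p + n) • raise I J K k n v := by
  rcases le_or_gt n k with hn | hn
  · refine coeff_eq_of_sum_pow_eq Set.infinite_univ
      (fun n => act I J K k z 0 0 1 (raise I J K k n v))
      (fun n => z ^ (p + n) • raise I J K k n v) (fun t _ => ?_) (Nat.lt_succ_of_le hn)
    have h1 := act_mul h z 0 0 1 1 t 0 1 v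
    have h2 := act_mul h 1 (z * t) 0 1 z 0 0 1 v
    simp only [mul_zero, zero_mul, add_zero, zero_add, mul_one, one_mul] at h1 h2
    rw [← h2, (mem_hodge_iff h hk).1 hv, map_smul, act_raise, act_raise, map_sum, one_pow,
      mul_one, Finset.smul_sum] at h1
    simp only [map_smul, mul_pow, smul_smul] at h1
    refine h1.trans (Finset.sum_congr rfl fun m _ => ?_)
    rw [smul_smul, pow_add]
    ring_nf
  · rw [raise_of_lt hn, map_zero, smul_zero_cform]

theorem lower_mem_hodge (h : IsQuaternionic I J K) {k p q n : ℕ} (hk : p + q = k) {v : CForm V k}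
    (hv : v ∈ hodge I k p q) (hn : n ≤ p) : lower I J K k n v ∈ hodge I k (p - n) (q + n) := by
  have := (weight_right h (act_diag_lower h hk hv n)).1 (by omega)
  rwa [show k - (q + n) = p - n by omega] at this

theorem lower_eq_zero (h : IsQuaternionic I J K) {k p q n : ℕ} (hk : p + q = k) {v : CForm V k}
    (hv : v ∈ hodge I k p q) (hn : p < n) : lower I J K k n v = 0 :=
  (weight_right h (act_diag_lower h hk hv n)).2 (by omega)

end HighestWeight

/-! ### Irreducible subrepresentations and the space `Λ^k_+` -/

section Irreducible

variable {V : Type*} [AddCommGroup V] [Module ℝ V] [TopologicalSpace V]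
  [IsTopologicalAddGroup V] [ContinuousSMul ℝ V] [T2Space V] [FiniteDimensional ℝ V]

/-- A vector of type `(p,q)` killed by the raising operators. -/
structure IsHighest (I J K : V →L[ℝ] V) {k : ℕ} (p q : ℕ) (v : CForm V k) : Prop where
  degree : p + q = k
  type : v ∈ hodge I k p q
  act_raise : ∀ t, act I J K k 1 t 0 1 v = v

/-- The span of the lowerings of a vector. -/
def lowerSpan (I J K : V →L[ℝ] V) {k : ℕ} (v : CForm V k) : Submodule ℂ (CForm V k) :=
  Submodule.span ℂ (Set.range fun n : ℕ => lower I J K k n v)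

variable {I J K : V →L[ℝ] V}

theorem act_lower_mem_lowerSpan {k : ℕ} (v : CForm V k) (t : ℂ) :
    act I J K k 1 0 t 1 v ∈ lowerSpan I J K v := by
  rw [act_lower]
  exact Submodule.sum_mem _ fun n _ => Submodule.smul_mem _ _ (Submodule.subset_span ⟨n, rfl⟩)

theorem mem_lowerSpan_self {k : ℕ} (v : CForm V k) : v ∈ lowerSpan I J K v := by
  have := act_lower_mem_lowerSpan (I := I) (J := J) (K := K) v 0
  rwa [act_one] at this

theorem lowerSpan_le {k : ℕ} {W : Submodule ℂ (CForm V k)} (hW : SU2Invariant I J K W)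
    {v : CForm V k} (hv : v ∈ W) : lowerSpan I J K v ≤ W := by
  refine Submodule.span_le.2 ?_
  rintro _ ⟨n, rfl⟩
  exact lower_mem W Set.infinite_univ (F := LinearMap.id) (fun t _ => hW.act_mem _ _ _ _ hv) n

/-- A matrix with nonzero top left entry is lower unipotent times diagonal times upper unipotent.
The last factor fixes `v`, and the diagonal one multiplies it by a scalar. -/
theorem IsHighest.act_eq (h : IsQuaternionic I J K) {k p q : ℕ} {v : CForm V k}
    (hv : IsHighest I J K p q v) {a : ℂ} (ha : a ≠ 0) (b c d : ℂ) :
    act I J K k a b c d v = (a ^ p * (d - b * c / a) ^ q) • act I J K k 1 0 (c / a) 1 v := by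
  have h1 := act_mul h 1 0 (c / a) 1 a 0 0 (d - b * c / a)
    (act I J K k 1 (b / a) 0 1 v)
  rw [hv.act_raise, (mem_hodge_iff h hv.degree).1 hv.type, map_smul] at h1
  rw [h1]
  conv_rhs => rw [← hv.act_raise (b / a), act_mul h]
  congr 1
  congr 1 <;> field_simp <;> ring

theorem IsHighest.su2Invariant (h : IsQuaternionic I J K) {k p q : ℕ} {v : CForm V k}
    (hv : IsHighest I J K p q v) : SU2Invariant I J K (lowerSpan I J K v) := by
  intro u hu x hx
  rw [pull_rmul]
  set a := (u.re + u.imI * Complex.I : ℂ) with ha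
  set b := (-u.imJ - u.imK * Complex.I : ℂ) with hb
  set c := (u.imJ - u.imK * Complex.I : ℂ)
  set d := (u.re - u.imI * Complex.I : ℂ)
  have hab : ¬(a = 0 ∧ b = 0) := by
    rintro ⟨h1, h2⟩
    have e1 := congrArg Complex.re h1
    have e2 := congrArg Complex.im h1
    have e3 := congrArg Complex.re h2
    have e4 := congrArg Complex.im h2
    simp [ha, hb] at e1 e2 e3 e4
    have : u = 0 := by ext <;> simp [*]
    rw [this, norm_zero] at hu
    exact zero_ne_one hu
  suffices lowerSpan I J K v ≤ (lowerSpan I J K v).comap (act I J K k a b c d) from this hx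
  refine Submodule.span_le.2 ?_
  rintro _ ⟨n, rfl⟩
  -- `a + b t` is the top left entry after multiplying by the lower unipotent matrix with parameter
  -- `t`. As `a` and `b` are not both zero, at most one `t` obstructs the factorization.
  have hS : {t : ℂ | a + b * t ≠ 0}.Infinite := by
    refine Set.Finite.infinite_compl (s := {t : ℂ | a + b * t = 0}) ?_
    refine Set.Subsingleton.finite fun s hs t ht => ?_
    simp only [Set.mem_ofPred_eq] at hs ht
    by_cases hb0 : b = 0
    · exact absurd ⟨by simpa [hb0] using hs, hb0⟩ hab
    · exact mul_left_cancel₀ hb0 (add_left_cancel (hs.trans ht.symm))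
  change act I J K k a b c d (lower I J K k n v) ∈ lowerSpan I J K v
  refine lower_mem _ hS (F := act I J K k a b c d) (fun t ht => ?_) n
  have ht' : a * 1 + b * t ≠ 0 := by simpa using ht
  rw [act_mul h, hv.act_eq h ht']
  exact Submodule.smul_mem _ _ (act_lower_mem_lowerSpan _ _)

theorem hodgeComp_lower (h : IsQuaternionic I J K) {k p q m n : ℕ} (hk : p + q = k)
    {v : CForm V k} (hv : v ∈ hodge I k p q) (hm : m ≤ p) :
    hodgeComp I J K k (p - m) (lower I J K k n v) = if n = m then lower I J K k n v else 0 := by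
  rcases le_or_gt n p with hn | hn
  · rw [comp_of_mem_hodge J K (by omega) (lower_mem_hodge h hk hv hn) (by omega)]
    by_cases hnm : n = m
    · subst hnm; rw [if_pos rfl, if_pos rfl]
    · rw [if_neg (by omega), if_neg hnm]
  · rw [lower_eq_zero h hk hv hn, map_zero, ite_self]

theorem hodgeComp_act_lower (h : IsQuaternionic I J K) {k p q : ℕ} (hk : p + q = k)
    {v : CForm V k} (hv : v ∈ hodge I k p q) (t : ℂ) :
    hodgeComp I J K k p (act I J K k 1 0 t 1 v) = v := by
  rw [act_lower, map_sum, Finset.sum_eq_single (M := CForm V k) 0]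
  · rw [map_smul, pow_zero, one_smul, lower_zero]
    exact (comp_of_mem_hodge J K hk hv (by omega)).trans (if_pos rfl)
  · intro n _ hn
    have := hodgeComp_lower h (m := 0) (n := n) hk hv (Nat.zero_le p)
    rw [if_neg hn] at this
    rw [map_smul, ← Nat.sub_zero p, this, smul_zero_cform]
  · intro hn
    exact absurd (Finset.mem_range.2 (by omega)) hn

/-- Raising after lowering by `t` gives the matrix with rows `(1 + t, 1)`, `(t, 1)`, of determinant
`1`. Its diagonal factor acts by `(1 + t) ^ (p - q)`, whose coefficients are binomial; hence the
first `p - q` lowerings are nonzero. -/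
theorem IsHighest.hodgeComp_raise_lower (h : IsQuaternionic I J K) {k p q : ℕ} {v : CForm V k}
    (hv : IsHighest I J K p q v) (hqp : q ≤ p) (n : ℕ) :
    hodgeComp I J K k p (act I J K k 1 1 0 1 (lower I J K k n v)) = ((p - q).choose n : ℂ) • v := by
  have hk := hv.degree
  rcases le_or_gt n k with hn | hn
  · have hS : ({-1}ᶜ : Set ℂ).Infinite := (Set.finite_singleton _).infinite_compl
    refine coeff_eq_of_sum_pow_eq hS
      (fun n => hodgeComp I J K k p (act I J K k 1 1 0 1 (lower I J K k n v)))
      (fun n => ((p - q).choose n : ℂ) • v) (fun t ht => ?_) (Nat.lt_succ_of_le hn)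
    have ht : 1 + t ≠ 0 := fun e => ht (by
      rw [Set.mem_singleton_iff]; linear_combination e)
    have h1 := congrArg (hodgeComp I J K k p) (act_mul h 1 1 0 1 1 0 t 1 v)
    rw [hv.act_eq h (a := 1 * 1 + 1 * t) (by simpa using ht), map_smul, hodgeComp_act_lower h hk hv.type,
      act_lower, map_sum, map_sum] at h1
    simp only [map_smul] at h1
    refine h1.trans ?_
    simp only [smul_smul, ← Finset.sum_smul]
    congr 1
    have e : (1 + t) ^ p * (1 - t / (1 + t)) ^ q = (1 + t) ^ (p - q) := by
      have e1 : 1 - t / (1 + t) = (1 + t)⁻¹ := by field_simp; ring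
      obtain ⟨r, rfl⟩ := Nat.exists_eq_add_of_le hqp
      rw [e1, Nat.add_sub_cancel_left, pow_add, inv_pow]
      field_simp
    have e2 : (1 + t) ^ (p - q) = ∑ i ∈ Finset.range (p - q + 1), t ^ i * ((p - q).choose i : ℂ) := by
      rw [add_comm, add_pow]
      simp
    simp only [mul_one, one_mul, mul_zero, zero_add]
    rw [e, e2]
    refine Finset.sum_subset (Finset.range_mono (by omega)) fun i _ hi => ?_
    rw [Nat.choose_eq_zero_of_lt (by rw [Finset.mem_range] at hi; omega), Nat.cast_zero, mul_zero]
  · rw [lower_of_lt hn, map_zero, map_zero, Nat.choose_eq_zero_of_lt (by omega), Nat.cast_zero,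
      zero_smul_cform]

theorem IsHighest.lower_ne_zero (h : IsQuaternionic I J K) {k p q n : ℕ} {v : CForm V k}
    (hv : IsHighest I J K p q v) (hv0 : v ≠ 0) (hqp : q ≤ p) (hn : n ≤ p - q) :
    lower I J K k n v ≠ 0 := by
  intro h0
  have := hv.hodgeComp_raise_lower h hqp n
  rw [h0, map_zero, map_zero] at this
  have hc : ((p - q).choose n : ℂ) ≠ 0 := by exact_mod_cast (Nat.choose_pos hn).ne'
  exact (smul_ne_zero hc hv0) this.symm

/-- The nonzero lowerings have pairwise distinct types, so Hodge projections separate them and prove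
independence. -/
theorem IsHighest.finrank_lowerSpan (h : IsQuaternionic I J K) {k p q : ℕ} {v : CForm V k}
    (hv : IsHighest I J K p q v) (hv0 : v ≠ 0) (hqp : q ≤ p)
    (hz : ∀ n, p - q < n → lower I J K k n v = 0) :
    Module.finrank ℂ (lowerSpan I J K v) = p - q + 1 := by
  let b : Fin (p - q + 1) → CForm V k := fun n => lower I J K k n v
  have hspan : lowerSpan I J K v = Submodule.span ℂ (Set.range b) := by
    refine le_antisymm (Submodule.span_le.2 ?_) (Submodule.span_mono ?_)
    · rintro _ ⟨n, rfl⟩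
      by_cases hn : p - q < n
      · rw [SetLike.mem_coe]
        simp only [hz n hn, Submodule.zero_mem]
      · exact Submodule.subset_span ⟨⟨n, by omega⟩, rfl⟩
    · rintro _ ⟨n, rfl⟩
      exact ⟨n, rfl⟩
  have hli : LinearIndependent ℂ b := by
    rw [Fintype.linearIndependent_iff]
    intro g hg i
    have := congrArg (hodgeComp I J K k (p - i)) hg
    rw [map_zero, map_sum, Finset.sum_eq_single (M := CForm V k) i] at this
    · rw [map_smul, hodgeComp_lower h hv.degree hv.type (by omega), if_pos rfl] at this
      exact (smul_eq_zero.1 this).resolve_right (hv.lower_ne_zero h hv0 hqp (by omega))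
    · intro j _ hj
      rw [map_smul, hodgeComp_lower h hv.degree hv.type (by omega),
        if_neg (fun e => hj (Fin.ext e)), smul_zero_cform]
    · intro hi
      exact absurd (Finset.mem_univ i) hi
  rw [hspan, finrank_span_eq_card hli, Fintype.card_fin]

theorem act_swap_mem_hodge (h : IsQuaternionic I J K) {k p q : ℕ} (hk : p + q = k)
    {v : CForm V k} (hv : v ∈ hodge I k p q) : act I J K k 0 1 1 0 v ∈ hodge I k q p := by
  rw [mem_hodge_iff h (by omega)]
  intro z w
  have h1 := act_mul h 0 1 1 0 w 0 0 z v
  rw [(mem_hodge_iff h hk).1 hv, map_smul] at h1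
  rw [act_mul h, mul_comm (z ^ q), h1]
  simp

theorem act_swap_swap (h : IsQuaternionic I J K) {k : ℕ} (v : CForm V k) :
    act I J K k 0 1 1 0 (act I J K k 0 1 1 0 v) = v := by
  rw [act_mul h]
  simpa using act_one v

/-- The structure of an irreducible representation. -/
theorem exists_isHighest (h : IsQuaternionic I J K) {k : ℕ} {W : Submodule ℂ (CForm V k)}
    (hW : SU2Invariant I J K W) (h0 : W ≠ ⊥)
    (hirr : ∀ U : Submodule ℂ (CForm V k), SU2Invariant I J K U → U ≤ W → U = ⊥ ∨ U = W) :
    ∃ p q v, IsHighest I J K p q v ∧ v ≠ 0 ∧ W = lowerSpan I J K v ∧ q ≤ p ∧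
      Module.finrank ℂ W = p - q + 1 ∧ ∀ n m, n + m = k → ∀ y ∈ W, y ∈ hodge I k n m → y ≠ 0 →
        n ≤ p := by
  classical
  obtain ⟨x, hx, hx0⟩ := Submodule.exists_mem_ne_zero_of_ne_bot h0
  let P : ℕ → Prop := fun n => ∃ y ∈ W, y ∈ hodge I k n (k - n) ∧ y ≠ 0
  have hex : ∃ n ≤ k, P n := by
    by_contra! hc
    refine hx0 ?_
    rw [← sum_comp (I := I) (J := J) (K := K) x]
    refine Finset.sum_eq_zero fun n hn => ?_
    rw [Finset.mem_range] at hn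
    by_contra h1
    exact hc n (by omega) ⟨_, hW.hodgeComp_mem hx, comp_mem_hodge h (by omega) x, h1⟩
  obtain ⟨n0, hn0, hP0⟩ := hex
  -- The highest weight is the largest `p` for which `W` contains a nonzero form of type `(p, k -
  -- p)`.
  set p := Nat.findGreatest P k
  have hp : P p := Nat.findGreatest_spec hn0 hP0
  have hpk : p ≤ k := Nat.findGreatest_le k
  have hmax (n m : ℕ) (hnm : n + m = k) (y : CForm V k) (hy : y ∈ W) (hy' : y ∈ hodge I k n m)
      (hy0 : y ≠ 0) : n ≤ p := by
    refine Nat.le_findGreatest (by omega) ⟨y, hy, ?_, hy0⟩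
    rwa [show k - n = m by omega]
  obtain ⟨v, hvW, hv, hv0⟩ := hp
  have hk : p + (k - p) = k := by omega
  have htop : IsHighest I J K p (k - p) v := by
    refine ⟨hk, hv, fun t => ?_⟩
    -- A nonzero raising of `v` would be a form in `W` with larger first index, against the choice
    -- of `p`.
    rw [act_raise, Finset.sum_eq_single (M := CForm V k) 0]
    · rw [pow_zero, one_smul, raise_zero]
    · intro n _ hn
      suffices raise I J K k n v = 0 by rw [this, smul_zero_cform]
      by_contra hne
      have hw := weight_left h (act_diag_raise h hk hv n)
      by_cases hpn : p + n ≤ k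
      · have := hmax (p + n) (k - (p + n)) (by omega) _
          (raise_mem W (fun t => hW.act_mem _ _ _ _ hvW) n) (hw.1 hpn) hne
        omega
      · exact hne (hw.2 (by omega))
    · intro hn
      exact absurd (Finset.mem_range.2 (by omega)) hn
  have hZ : W = lowerSpan I J K v := by
    rcases hirr _ (htop.su2Invariant h) (lowerSpan_le hW hvW) with h1 | h1
    · exact absurd ((Submodule.eq_bot_iff _).1 h1 v (mem_lowerSpan_self v)) hv0
    · exact h1.symm
  -- Exchanging the two coordinates swaps the indices of the type, so `p` bounds the second index
  -- too. This gives `q ≤ p` and kills the lowerings beyond `p - q`.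
  have hswap (n m : ℕ) (hnm : n + m = k) (y : CForm V k) (hy : y ∈ W) (hy' : y ∈ hodge I k n m)
      (hy0 : y ≠ 0) : m ≤ p := by
    refine hmax m n (by omega) _ (hW.act_mem 0 1 1 0 hy) (act_swap_mem_hodge h hnm hy') fun e => ?_
    rw [← act_swap_swap h y, e, map_zero] at hy0
    exact hy0 rfl
  have hqp : k - p ≤ p := hswap p (k - p) hk v hvW hv hv0
  refine ⟨p, k - p, v, htop, hv0, hZ, hqp, ?_, hmax⟩
  conv_lhs => rw [hZ]
  refine htop.finrank_lowerSpan h hv0 hqp fun n hn => ?_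
  rcases le_or_gt n p with hnp | hnp
  · by_contra hne
    have := hswap (p - n) (k - p + n) (by omega) _
      (lower_mem W Set.infinite_univ (F := LinearMap.id) (fun t _ => hW.act_mem _ _ _ _ hvW) n)
      (lower_mem_hodge h hk hv hnp) hne
    omega
  · exact lower_eq_zero h hk hv hnp

theorem isHighest_of_mem_hodge (h : IsQuaternionic I J K) {k : ℕ} {η : CForm V k}
    (hη : η ∈ hodge I k k 0) : IsHighest I J K k 0 η :=
  ⟨add_zero k, hη, fun t => by
    rw [act_of_mem_hodge_top h hη, ← act_of_mem_hodge_top h hη 1 0 0 1, act_one]⟩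

/-- Both sides are coefficients in the lower unipotent orbit of `η`; replacing `n` slots by `J`
leaves `k - n` unchanged. -/
theorem lower_eq_hMul (h : IsQuaternionic I J K) {k n : ℕ} (hn : n ≤ k) {η : CForm V k}
    (hη : η ∈ hodge I k k 0) :
    lower I J K k n η = (k.choose n : ℂ) • hMul J k (k - n) η := by
  refine coeff_eq_of_sum_pow_eq Set.infinite_univ
    (fun n => lower I J K k n η) (fun n => (k.choose n : ℂ) • hMul J k (k - n) η)
    (fun t _ => ?_) (Nat.lt_succ_of_le hn)
  have := act_eq_sum_hMul h hη 1 0 t 1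
  rw [act_lower] at this
  refine this.trans ?_
  rw [← Finset.sum_range_reflect]
  refine Finset.sum_congr rfl fun j hj => ?_
  have hj := Finset.mem_range.1 hj
  rw [smul_smul, one_pow, mul_one, show k + 1 - 1 - j = k - j by omega,
    show k - (k - j) = j by omega, Nat.choose_symm (by omega)]

theorem lowerSpan_le_plusPart (h : IsQuaternionic I J K) {k : ℕ} {η : CForm V k}
    (hη : η ∈ hodge I k k 0) : lowerSpan I J K η ≤ plusPart I J k := by
  refine Submodule.span_le.2 ?_
  rintro _ ⟨n, rfl⟩
  rcases le_or_gt n k with hn | hn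
  · rw [SetLike.mem_coe]
    simp only [lower_eq_hMul h hn hη]
    refine Submodule.smul_mem _ _
      (Submodule.mem_iSup_of_mem ⟨k - n, by omega⟩ ⟨η, hη, rfl⟩)
  · rw [SetLike.mem_coe]
    simp only [lower_of_lt hn]
    exact Submodule.zero_mem _

theorem hMul_mem_lowerSpan (h : IsQuaternionic I J K) {k p : ℕ} (hp : p ≤ k) {η : CForm V k}
    (hη : η ∈ hodge I k k 0) : hMul J k p η ∈ lowerSpan I J K η := by
  have h1 := lower_eq_hMul h (n := k - p) (by omega) hη
  rw [show k - (k - p) = p by omega, Nat.choose_symm hp] at h1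
  have hc : (k.choose p : ℂ) ≠ 0 := by exact_mod_cast (Nat.choose_pos hp).ne'
  rw [← inv_smul_smul₀ hc (hMul J k p η), ← h1]
  exact Submodule.smul_mem _ _ (Submodule.subset_span ⟨k - p, rfl⟩)

/-- A nonzero vector of an invariant subspace lies in `plusPart`, hence not in `lowPart`, so some
matrix with zero bottom row sends it to a nonzero `(k,0)`-form. In this span such forms are
multiples of `η`, so the subspace contains `η` and everything it generates. -/
theorem isIrredOfWeight_lowerSpan (h : IsQuaternionic I J K) {k : ℕ} {η : CForm V k}
    (hη : η ∈ hodge I k k 0) (hη0 : η ≠ 0) : IsIrredOfWeight I J K k (lowerSpan I J K η) := by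
  have htop := isHighest_of_mem_hodge h hη
  have hinv := htop.su2Invariant h
  refine ⟨hinv, fun e => hη0 ((Submodule.eq_bot_iff _).1 e η (mem_lowerSpan_self η)),
    fun Y hY hYle => ?_, ?_⟩
  · rw [or_iff_not_imp_left]
    intro hY0
    obtain ⟨y, hy, hy0⟩ := Submodule.exists_mem_ne_zero_of_ne_bot hY0
    refine le_antisymm hYle (lowerSpan_le hY ?_)
    have hlow : y ∉ lowPart I J K k := fun hl =>
      hy0 (Submodule.disjoint_def.1 (plusProj_eq h k).1.disjoint y
        (lowerSpan_le_plusPart h hη (hYle hy)) hl)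
    rw [mem_lowPart] at hlow
    push Not at hlow
    obtain ⟨z, w, hzw⟩ := hlow
    set x := act I J K k z w 0 0 y
    have hxY : x ∈ Y := hY.act_mem _ _ _ _ hy
    have hx : x ∈ hodge I k k 0 := by
      have : act I J K k 1 0 0 0 x = x := by
        rw [act_mul h]; simp [x]
      rw [mem_hodge_iff h (add_zero k)]
      intro s t
      have h2 := act_mul h s 0 0 t 1 0 0 0 x
      have h3 := act_smul (I := I) (J := J) (K := K) s 1 0 0 0 x
      simp only [mul_zero, add_zero, mul_one] at h2 h3
      rw [this] at h2 h3
      rw [h2, h3, pow_zero, mul_one]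
    have hsp : ∃ c : ℂ, c • η = x := by
      refine (Submodule.mem_span_singleton (M := CForm V k)).1 ?_
      have hle : lowerSpan I J K η ≤ (Submodule.span ℂ {η}).comap (hodgeComp I J K k k) := by
        refine Submodule.span_le.2 ?_
        rintro _ ⟨n, rfl⟩
        rw [SetLike.mem_coe, Submodule.mem_comap]
        have := hodgeComp_lower h (m := 0) (n := n) (add_zero k) hη (Nat.zero_le k)
        rw [Nat.sub_zero] at this
        rw [this]
        split_ifs with hn
        · subst hn
          rw [lower_zero]
          exact Submodule.mem_span_singleton_self η
        · exact Submodule.zero_mem _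
      have := hle (hYle hxY)
      rwa [Submodule.mem_comap, comp_of_mem_hodge J K (add_zero k) hx le_rfl, if_pos rfl] at this
    obtain ⟨c, hc⟩ := hsp
    have hc0 : c ≠ 0 := by
      rintro rfl
      exact hzw (by rw [← hc]; exact zero_smul_cform η)
    rw [← inv_smul_smul₀ hc0 η, hc]
    exact Y.smul_mem _ hxY
  · refine htop.finrank_lowerSpan h hη0 (Nat.zero_le k) fun n hn => lower_of_lt ?_ η
    omega

/-- Dimension `k + 1` forces `p - q = k`, that is, a highest vector of type `(k,0)`; conversely each
nonzero `(k,0)`-form generates such an irreducible. -/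
theorem lamPlus_eq (h : IsQuaternionic I J K) (k : ℕ) : lamPlus I J K k = plusPart I J k := by
  refine le_antisymm (sSup_le fun W hW => ?_) (iSup_le fun p => ?_)
  · obtain ⟨p, q, v, hv, -, hWv, hqp, hrank, -⟩ :=
      exists_isHighest h hW.invariant hW.ne_bot hW.irreducible
    have := hv.degree
    rw [hW.finrank_eq] at hrank
    obtain rfl : p = k := by omega
    obtain rfl : q = 0 := by omega
    rw [hWv]
    exact lowerSpan_le_plusPart h hv.type
  · rintro _ ⟨η, hη, rfl⟩
    by_cases hη0 : η = 0
    · rw [hη0, map_zero]; exact Submodule.zero_mem _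
    · exact le_sSup (a := lowerSpan I J K η) (isIrredOfWeight_lowerSpan h hη hη0)
        (hMul_mem_lowerSpan h (by omega) hη)

/-- A nonzero `ringR` of a component would be a `(k,0)`-form inside the irreducible, forcing its
weight to be `k`. -/
theorem lamLow_le (h : IsQuaternionic I J K) (k : ℕ) : lamLow I J K k ≤ lowPart I J K k := by
  refine sSup_le ?_
  rintro W ⟨w, hw, hW⟩
  obtain ⟨p, q, v, hv, -, hWv, hqp, hrank, hmax⟩ :=
    exists_isHighest h hW.invariant hW.ne_bot hW.irreducible
  rw [hW.finrank_eq] at hrank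
  have := hv.degree
  intro y hy
  rw [mem_lowPart_iff h]
  intro n _
  by_contra hne
  have := hmax k 0 (add_zero k) _ (hW.invariant.act_mem 1 1 0 0 (hW.invariant.hodgeComp_mem hy))
    (ringR_mem_hodge h _) hne
  omega

theorem su2Invariant_lowPart (h : IsQuaternionic I J K) (k : ℕ) :
    SU2Invariant I J K (lowPart I J K k) := by
  intro u _ x hx
  rw [pull_rmul, mem_lowPart]
  intro z w
  rw [act_mul h]
  simp only [zero_mul, add_zero]
  exact mem_lowPart.1 hx _ _

end Irreducible

/-! ### An inner product invariant under the quaternions -/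

section SkewBasis

variable {V : Type*} [AddCommGroup V] [Module ℝ V] [FiniteDimensional ℝ V]

/-- A positive definite form that is invariant under three endomorphisms has an orthonormal basis,
in which they are skew-symmetric. -/
theorem exists_skew_basis (I J K : V →ₗ[ℝ] V) (hI : ∀ X, I (I X) = -X) (hJ : ∀ X, J (J X) = -X)
    (hIJ : ∀ X, J (I X) = K X) (hJI : ∀ X, I (J X) = -K X) :
    ∃ b : Module.Basis (Fin (Module.finrank ℝ V)) ℝ V, ∀ i j,
      b.repr (I (b i)) j = -b.repr (I (b j)) i ∧ b.repr (J (b i)) j = -b.repr (J (b j)) i ∧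
      b.repr (K (b i)) j = -b.repr (K (b j)) i := by
  have hKI (X : V) : I (K X) = J X := by rw [← hIJ, hJI, ← hIJ, hI, map_neg, neg_neg]
  have hIK (X : V) : K (I X) = -J X := by rw [← hIJ, hI, map_neg]
  have hKJ (X : V) : J (K X) = -I X := by rw [← hIJ, hJ]
  have hJK (X : V) : K (J X) = I X := by rw [← hIJ, hJI, map_neg, hKJ, neg_neg]
  have hK (X : V) : K (K X) = -X := by rw [← hIJ (K X), hKI, hJ]
  let b0 := Module.finBasis ℝ V
  let g : V → V → ℝ := fun x y => ∑ i, b0.repr x i * b0.repr y i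
  have g_symm (x y : V) : g x y = g y x := Finset.sum_congr rfl fun i _ => mul_comm _ _
  have g_add (x y z : V) : g (x + y) z = g x z + g y z := by
    simp [g, add_mul, Finset.sum_add_distrib]
  have g_smul (r : ℝ) (x y : V) : g (r • x) y = r * g x y := by
    simp [g, Finset.mul_sum, mul_assoc]
  have g_neg (x y : V) : g (-x) y = -g x y := by simp [g]
  have g_neg' (x y : V) : g x (-y) = -g x y := by simp [g]
  have g_nonneg (x : V) : 0 ≤ g x x := Finset.sum_nonneg fun i _ => mul_self_nonneg _
  have g_def (x : V) (hx : g x x = 0) : x = 0 := by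
    refine b0.repr.injective (Finsupp.ext fun i => ?_)
    have := (Finset.sum_eq_zero_iff_of_nonneg fun i _ => mul_self_nonneg (b0.repr x i)).1 hx i
      (Finset.mem_univ i)
    simpa using this
  -- Summing over `1, I, J, K` makes the form invariant, since composition with any of them permutes
  -- the four terms up to signs that cancel.
  let G : V → V → ℝ := fun x y => g x y + g (I x) (I y) + g (J x) (J y) + g (K x) (K y)
  let core : InnerProductSpace.Core ℝ V :=
    { inner := G
      conj_inner_symm := fun x y => by
        simp only [G, conj_trivial]
        rw [g_symm x y, g_symm (I x), g_symm (J x), g_symm (K x)]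
      re_inner_nonneg := fun x => by
        have := g_nonneg x
        have := g_nonneg (I x)
        have := g_nonneg (J x)
        have := g_nonneg (K x)
        simp only [G, RCLike.re_to_real]
        positivity
      add_left := fun x y z => by
        simp only [G, map_add, g_add]; ring
      smul_left := fun x y r => by
        simp only [G, map_smul, g_smul, conj_trivial]; ring
      definite := fun x hx => g_def x (by
        have h0 := g_nonneg x
        have h1 := g_nonneg (I x)
        have h2 := g_nonneg (J x)
        have h3 := g_nonneg (K x)
        simp only [G] at hx
        linarith) }
  let _ : NormedAddCommGroup V := core.toNormedAddCommGroup
  let _ : InnerProductSpace ℝ V := InnerProductSpace.ofCore core.toCore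
  let b := stdOrthonormalBasis ℝ V
  have hG (x y : V) : inner ℝ x y = G x y := rfl
  have hskew (A : V →ₗ[ℝ] V) (hA : ∀ x y, G (A x) y = -G x (A y)) (i j) :
      b.toBasis.repr (A (b.toBasis i)) j = -b.toBasis.repr (A (b.toBasis j)) i := by
    rw [OrthonormalBasis.coe_toBasis_repr_apply, OrthonormalBasis.coe_toBasis_repr_apply,
      OrthonormalBasis.coe_toBasis, OrthonormalBasis.repr_apply_apply,
      OrthonormalBasis.repr_apply_apply, ← real_inner_comm, hG, hG, hA]
  refine ⟨b.toBasis, fun i j => ⟨hskew I (fun x y => ?_) i j, hskew J (fun x y => ?_) i j,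
    hskew K (fun x y => ?_) i j⟩⟩
  · simp only [G, hI, hIJ, hIK, g_neg, g_neg']; ring
  · simp only [G, hJ, hJI, hJK, g_neg, g_neg']; ring
  · simp only [G, hK, hKI, hKJ, g_neg, g_neg']; ring

end SkewBasis

/-! ### Complete reducibility and the space `V^k` -/

section Semisimple

variable {V : Type*} [AddCommGroup V] [Module ℝ V] [TopologicalSpace V]
  [IsTopologicalAddGroup V] [ContinuousSMul ℝ V] [T2Space V] [FiniteDimensional ℝ V]
  {I J K : V →L[ℝ] V}

/-- The values of a form on the vectors of a basis. -/
def basisValues {n : ℕ} (b : Module.Basis (Fin n) ℝ V) (k : ℕ) :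
    CForm V k →ₗ[ℂ] EuclideanSpace ℂ (Fin k → Fin n) where
  toFun x := WithLp.toLp 2 fun f => x fun j => b (f j)
  map_add' _ _ := rfl
  map_smul' _ _ := rfl

theorem basisValues_injective {n : ℕ} (b : Module.Basis (Fin n) ℝ V) (k : ℕ) :
    Function.Injective (basisValues b k) := by
  intro x y hxy
  apply ContinuousAlternatingMap.toAlternatingMap_injective
  apply AlternatingMap.coe_multilinearMap_injective
  refine Module.Basis.ext_multilinear (fun _ => b) fun f => ?_
  exact congrFun (congrArg WithLp.ofLp hxy) f

instance finiteDimensional_cform (k : ℕ) : FiniteDimensional ℂ (CForm V k) :=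
  Module.Finite.of_injective (basisValues (Module.finBasis ℝ V) k) (basisValues_injective _ k)

/-- The matrix of a pull-back on `k`-forms has products of entries of the original matrix as its
coefficients, so transposition of real matrices becomes adjunction. -/
theorem inner_pull {n : ℕ} (b : Module.Basis (Fin n) ℝ V) {A B : V →L[ℝ] V}
    (hAB : ∀ i j, b.repr (A (b i)) j = b.repr (B (b j)) i) {k : ℕ} (x y : CForm V k) :
    inner ℂ (basisValues b k (pull k A x)) (basisValues b k y) =
      inner ℂ (basisValues b k x) (basisValues b k (pull k B y)) := by
  have expand (A : V →L[ℝ] V) (x : CForm V k) (f : Fin k → Fin n) :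
      basisValues b k (pull k A x) f = ∑ g : Fin k → Fin n,
        (∏ j, b.repr (A (b (f j))) (g j) : ℝ) • basisValues b k x g := by
    change x (fun j => A (b (f j))) = _
    have : (fun j => A (b (f j))) = fun j => ∑ i, b.repr (A (b (f j))) i • b i :=
      funext fun j => (b.sum_repr _).symm
    rw [this]
    change x.toContinuousMultilinearMap _ = _
    rw [ContinuousMultilinearMap.map_sum]
    refine Finset.sum_congr rfl fun g _ => ?_
    rw [ContinuousMultilinearMap.map_smul_univ]
    rfl
  rw [PiLp.inner_apply, PiLp.inner_apply]
  simp only [expand, RCLike.inner_apply, map_sum, Finset.mul_sum, Finset.sum_mul]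
  rw [Finset.sum_comm]
  refine Finset.sum_congr rfl fun g _ => Finset.sum_congr rfl fun f _ => ?_
  have : ∏ j, b.repr (A (b (f j))) (g j) = ∏ j, b.repr (B (b (g j))) (f j) :=
    Finset.prod_congr rfl fun j _ => hAB _ _
  rw [this, Complex.real_smul, Complex.real_smul, map_mul, Complex.conj_ofReal]
  ring

theorem exists_invariant_isCompl (h : IsQuaternionic I J K) {k : ℕ} {Y : Submodule ℂ (CForm V k)}
    (hY : SU2Invariant I J K Y) : ∃ Z : Submodule ℂ (CForm V k), SU2Invariant I J K Z ∧
      Y ⊓ Z = ⊥ ∧ Y ⊔ Z = ⊤ := by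
  obtain ⟨b, hb⟩ := exists_skew_basis (I : V →ₗ[ℝ] V) J K h.sq_I h.sq_J h.mul_IJ h.mul_JI
  -- In a basis where `I`, `J`, `K` are skew-symmetric, conjugate quaternions have transposed
  -- matrices. Hence the orthogonal complement of an invariant subspace is invariant.
  have hadj (u : ℍ[ℝ]) (i j) : b.repr (rmul I J K (star u) (b i)) j =
      b.repr (rmul I J K u (b j)) i := by
    have e := hb i j
    simp only [ContinuousLinearMap.coe_coe] at e
    simp only [rmul, add_apply, smul_apply, map_add, map_smul, Finsupp.add_apply,
      Finsupp.smul_apply, ContinuousLinearMap.id_apply, e.1, e.2.1, e.2.2, Quaternion.re_star,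
      Quaternion.imI_star, Quaternion.imJ_star, Quaternion.imK_star, smul_eq_mul,
      Module.Basis.repr_self, Finsupp.single_apply, eq_comm (a := i)]
    ring
  refine ⟨(Y.map (basisValues b k))ᗮ.comap (basisValues b k), ?_, ?_, ?_⟩
  · intro u hu x hx
    rw [Submodule.mem_comap, Submodule.mem_orthogonal] at hx ⊢
    rintro _ ⟨y, hy, rfl⟩
    rw [← inner_pull b (hadj u)]
    exact hx _ ⟨_, hY (star u) (by rwa [norm_star]) y hy, rfl⟩
  · rw [Submodule.eq_bot_iff]
    rintro x ⟨hx, hx'⟩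
    have := (Submodule.mem_orthogonal _ _).1 hx' _ ⟨x, hx, rfl⟩
    rw [inner_self_eq_zero] at this
    exact basisValues_injective b k (this.trans (map_zero _).symm)
  · rw [eq_top_iff]
    intro x _
    obtain ⟨y, hy, z, hz, hyz⟩ := (Y.map (basisValues b k)).exists_add_mem_mem_orthogonal
      (basisValues b k x)
    obtain ⟨y, hy, rfl⟩ := hy
    refine Submodule.mem_sup.2 ⟨y, hy, x - y, ?_, add_sub_cancel _ _⟩
    rw [Submodule.mem_comap, map_sub, hyz, add_sub_cancel_left]
    exact hz

theorem le_sSup_irreducible (h : IsQuaternionic I J K) {k : ℕ} (n : ℕ)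
    (X : Submodule ℂ (CForm V k)) (hX : SU2Invariant I J K X) (hn : Module.finrank ℂ X ≤ n) :
    X ≤ sSup {W | SU2Invariant I J K W ∧ W ≠ ⊥ ∧ W ≤ X ∧
      ∀ U, SU2Invariant I J K U → U ≤ W → U = ⊥ ∨ U = W} := by
  induction n generalizing X with
  | zero =>
    rw [Submodule.finrank_eq_zero.1 (Nat.le_zero.1 hn)]
    exact bot_le
  | succ n ih =>
    by_cases hX0 : X = ⊥
    · rw [hX0]; exact bot_le
    by_cases hirr : ∀ U, SU2Invariant I J K U → U ≤ X → U = ⊥ ∨ U = X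
    · exact le_sSup (a := X) ⟨hX, hX0, le_rfl, hirr⟩
    push Not at hirr
    obtain ⟨Y, hY, hYX, hY0, hYX'⟩ := hirr
    obtain ⟨Z, hZ, hYZ, hYZ'⟩ := exists_invariant_isCompl h hY
    have hmono (X' : Submodule ℂ (CForm V k)) (hX' : SU2Invariant I J K X') (hlt : X' < X) :
        X' ≤ sSup {W | SU2Invariant I J K W ∧ W ≠ ⊥ ∧ W ≤ X ∧
          ∀ U, SU2Invariant I J K U → U ≤ W → U = ⊥ ∨ U = W} := by
      refine (ih X' hX' ?_).trans (sSup_le_sSup fun W hW => ⟨hW.1, hW.2.1, hW.2.2.1.trans hlt.le,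
        hW.2.2.2⟩)
      have := Submodule.finrank_lt_finrank_of_lt hlt
      omega
    -- By the modular law, the complement of `Y` in the whole space restricts to a complement inside
    -- `X`; both parts are proper and the induction applies.
    have hsup : X ≤ Y ⊔ (Z ⊓ X) := by
      rw [← sup_inf_assoc_of_le Z hYX, hYZ', top_inf_eq]
    refine hsup.trans (sup_le (hmono Y hY (lt_of_le_of_ne hYX hYX')) (hmono (Z ⊓ X) ?_ ?_))
    · exact fun u hu x hx => ⟨hZ u hu x hx.1, hX u hu x hx.2⟩
    · refine lt_of_le_of_ne inf_le_right fun e => hY0 ?_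
      rw [eq_bot_iff, ← hYZ]
      exact le_inf le_rfl (hYX.trans (inf_eq_right.1 e))

/-- `lowPart` is the sum of its irreducible subspaces. One of weight `k` would contain a highest
vector of type `(k,0)`, which `ringR` both fixes and annihilates. -/
theorem lamLow_eq (h : IsQuaternionic I J K) (k : ℕ) : lamLow I J K k = lowPart I J K k := by
  refine le_antisymm (lamLow_le h k) ((le_sSup_irreducible h _ _ (su2Invariant_lowPart h k)
    le_rfl).trans (sSup_le_sSup ?_))
  rintro W ⟨hW, hW0, hWle, hirr⟩
  obtain ⟨p, q, v, hv, hv0, hWv, hqp, hrank, -⟩ := exists_isHighest h hW hW0 hirr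
  have hk := hv.degree
  refine ⟨p - q, ?_, hW, hW0, hirr, hrank⟩
  rcases lt_or_ge (p - q) k with hlt | hge
  · exact hlt
  · obtain rfl : p = k := by omega
    obtain rfl : q = 0 := by omega
    have hvl : v ∈ lowPart I J K p := hWle (by rw [hWv]; exact mem_lowerSpan_self v)
    exact absurd ((ringR_of_mem_hodge h hv.type).symm.trans (mem_lowPart.1 hvl 1 1)) hv0

end Semisimple

/-! ### The construction of `R` on a fibre -/

section Fibre

variable {V : Type*} [AddCommGroup V] [Module ℝ V] [TopologicalSpace V]
  [IsTopologicalAddGroup V] [ContinuousSMul ℝ V] [T2Space V] [FiniteDimensional ℝ V]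
  {I J K : V →L[ℝ] V}

theorem isCompl_lamPlus_lamLow (h : IsQuaternionic I J K) (k : ℕ) :
    IsCompl (lamPlus I J K k) (lamLow I J K k) := by
  rw [lamPlus_eq h, lamLow_eq h]
  exact (plusProj_eq h k).1

theorem projPlus_eq (h : IsQuaternionic I J K) (k : ℕ) : projPlus I J K k = plusProj I J K k := by
  rw [projPlus, lamPlus_eq h, lamLow_eq h]
  exact (plusProj_eq h k).2

theorem hMul_mem_lamPlus (h : IsQuaternionic I J K) {k p : ℕ} (hp : p ≤ k) {x : CForm V k}
    (hx : x ∈ hodge I k k 0) : hMul J k p x ∈ lamPlus I J K k := by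
  rw [lamPlus_eq h]
  exact Submodule.mem_iSup_of_mem ⟨p, Nat.lt_succ_of_le hp⟩ ⟨x, hx, rfl⟩

theorem mapsTo_projPlus (h : IsQuaternionic I J K) {k p q : ℕ} (hk : p + q = k) :
    Set.MapsTo (projPlus I J K k) (hodge I k p q)
      (lamPlus I J K k ⊓ hodge I k p q : Submodule ℂ _) := by
  intro x hx
  rw [projPlus_eq h, plusProj_of_mem_hodge hk hx]
  exact ⟨hMul_mem_lamPlus h (by omega) (ringR_mem_hodge h x),
    hMul_mem_hodge h hk (ringR_mem_hodge h x)⟩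

theorem bijOn_hMul (h : IsQuaternionic I J K) {k p q : ℕ} (hk : p + q = k) :
    Set.BijOn (hMul J k p) (hodge I k k 0)
      (lamPlus I J K k ⊓ hodge I k p q : Submodule ℂ _) := by
  refine ⟨fun x hx => ⟨hMul_mem_lamPlus h (by omega) hx, hMul_mem_hodge h hk hx⟩,
    fun x hx y hy hxy => ?_, fun x hx => ?_⟩
  · rw [← ringR_hMul h hx (p := p), hxy, ringR_hMul h hy]
  · refine ⟨ringR I J K k x, ringR_mem_hodge h x, ?_⟩
    rw [← plusProj_of_mem_hodge hk hx.2, ← projPlus_eq h, projPlus, projAlong,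
      dif_pos (isCompl_lamPlus_lamLow h k)]
    exact Submodule.projection_apply_of_mem_left _ hx.1

theorem opR_eq (h : IsQuaternionic I J K) {k p q : ℕ} (hk : p + q = k) {x : CForm V k}
    (hx : x ∈ hodge I k p q) : opR I J K k p x = ringR I J K k x := by
  rw [opR, projPlus_eq h, plusProj_of_mem_hodge hk hx]
  exact (bijOn_hMul h hk).injOn.leftInvOn_invFunOn (ringR_mem_hodge h x)

end Fibre

/-! ### `R`, wedge products and conjugation -/

section Wedge

variable {V : Type*} [AddCommGroup V] [Module ℝ V] [TopologicalSpace V]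
  [IsTopologicalAddGroup V] [ContinuousSMul ℝ V]

theorem conjForm_smul {k : ℕ} (c : ℂ) (x : CForm V k) :
    conjForm (c • x) = (starRingEnd ℂ) c • conjForm x := by
  ext v
  exact map_mul (starRingEnd ℂ) c (x v)

theorem pull_conjForm {k : ℕ} (A : V →L[ℝ] V) (x : CForm V k) :
    pull k A (conjForm x) = conjForm (pull k A x) := rfl

theorem wedge_eq_alt {k l : ℕ} (a : CForm V k) (b : CForm V l) :
    wedge a b = ((k.factorial * l.factorial : ℂ)⁻¹ * (k + l).factorial) •
      alt (k + l) (mulForms a b) := by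
  rw [wedge, alt_apply, smul_smul, mul_assoc, mul_inv_cancel₀, mul_one]
  exact_mod_cast (k + l).factorial_ne_zero

theorem wedge_smul_smul {k l : ℕ} (c d : ℂ) (a : CForm V k) (b : CForm V l) :
    wedge (c • a) (d • b) = (c * d) • wedge a b := by
  have : mulForms (c • a) (d • b) = (c * d) • mulForms a b := by
    ext v
    exact mul_mul_mul_comm c _ d _
  rw [wedge_eq_alt, wedge_eq_alt, this, map_smul, smul_comm]

variable [T2Space V] [FiniteDimensional ℝ V] {I J K : V →L[ℝ] V}

theorem act_wedge {k l : ℕ} (α β γ δ : ℂ) (a : CForm V k) (b : CForm V l) :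
    act I J K (k + l) α β γ δ (wedge a b) =
      wedge (act I J K k α β γ δ a) (act I J K l α β γ δ b) := ind_wedge _ a b

theorem wedge_mem_hodge (h : IsQuaternionic I J K) {k l p q p' q' : ℕ} (hk : p + q = k)
    (hl : p' + q' = l) {a : CForm V k} {b : CForm V l} (ha : a ∈ hodge I k p q)
    (hb : b ∈ hodge I l p' q') : wedge a b ∈ hodge I (k + l) (p + p') (q + q') := by
  rw [mem_hodge_iff h (by omega)]
  intro z w
  rw [act_wedge, (mem_hodge_iff h hk).1 ha, (mem_hodge_iff h hl).1 hb, wedge_smul_smul]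
  congr 1
  ring

theorem opR_wedge (h : IsQuaternionic I J K) {k l p q p' q' : ℕ} (hk : p + q = k)
    (hl : p' + q' = l) {a : CForm V k} {b : CForm V l} (ha : a ∈ hodge I k p q)
    (hb : b ∈ hodge I l p' q') :
    opR I J K (k + l) (p + p') (wedge a b) = wedge (opR I J K k p a) (opR I J K l p' b) := by
  rw [opR_eq h (by omega) (wedge_mem_hodge h hk hl ha hb), opR_eq h hk ha, opR_eq h hl hb]
  exact act_wedge _ _ _ _ _ _

/-- Pull-backs by real maps commute with conjugation, so only the coefficients of `1, I, J, K` are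
conjugated; in matrix entries this gives the stated rearrangement. -/
theorem act_conjForm {k : ℕ} (a b c d : ℂ) (x : CForm V k) :
    act I J K k a b c d (conjForm x) = conjForm (act I J K k (starRingEnd ℂ d) (-starRingEnd ℂ c)
      (-starRingEnd ℂ b) (starRingEnd ℂ a) x) := by
  refine ind_conjForm _ _ (fun φ v => ?_) x
  rw [mat_apply, mat_apply]
  change _ * (starRingEnd ℂ) (φ v) + _ * (starRingEnd ℂ) (φ (I v)) +
    _ * (starRingEnd ℂ) (φ (J v)) + _ * (starRingEnd ℂ) (φ (K v)) = _
  simp only [map_add, map_mul, map_div₀, map_neg, map_sub, Complex.conj_conj, Complex.conj_I,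
    map_ofNat]
  ring

theorem conjForm_mem_hodge (h : IsQuaternionic I J K) {k p q : ℕ} (hk : p + q = k)
    {x : CForm V k} (hx : x ∈ hodge I k p q) : conjForm x ∈ hodge I k q p := by
  rw [mem_hodge_iff h (by omega)]
  intro z w
  rw [act_conjForm, map_zero, neg_zero, (mem_hodge_iff h hk).1 hx, conjForm_smul]
  simp only [map_mul, map_pow, Complex.conj_conj]
  rw [mul_comm]

theorem pull_J {k : ℕ} (x : CForm V k) : pull k J x = act I J K k 0 (-1) 1 0 x := by
  rw [pull_eq_ind, precomp_J I J K, act]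

/-- Conjugation turns the matrix of `ringR` into the one with bottom row `(-1, 1)`. This is the
matrix of `J` times that of `ringR` times `diag(-1, 1)`, and the last factor contributes `(-1) ^ p`.
-/
theorem ringR_conjForm (h : IsQuaternionic I J K) {k p q : ℕ} (hk : p + q = k)
    {x : CForm V k} (hx : x ∈ hodge I k p q) : ringR I J K k (conjForm x) =
      ((-1 : ℂ) ^ p) • conjForm (pull k J (ringR I J K k x)) := by
  have h1 := act_mul h 0 0 1 1 (-1) 0 0 1 x
  rw [(mem_hodge_iff h hk).1 hx, one_pow, mul_one, map_smul] at h1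
  simp only [mul_zero, zero_mul, add_zero, zero_add, mul_one, one_mul] at h1
  have h2 := act_mul h 0 (-1) 1 0 1 1 0 0 x
  simp only [mul_zero, add_zero, mul_one] at h2
  rw [ringR, act_conjForm, pull_J (I := I) (K := K), h2]
  simp only [map_zero, map_one, neg_zero]
  rw [← h1, conjForm_smul, map_pow, map_neg, map_one]

theorem opR_conjForm (h : IsQuaternionic I J K) {k p q : ℕ} (hk : p + q = k)
    {x : CForm V k} (hx : x ∈ hodge I k p q) : opR I J K k q (conjForm x) =
      ((-1 : ℂ) ^ p) • conjForm (pull k J (opR I J K k p x)) := by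
  rw [opR_eq h (by omega) (conjForm_mem_hodge h hk hx), opR_eq h hk hx, ringR_conjForm h hk hx]

end Wedge

/-! ### `R` and positive forms -/

section Positivity

variable {V : Type*} [AddCommGroup V] [Module ℝ V] [TopologicalSpace V]
  [IsTopologicalAddGroup V] [ContinuousSMul ℝ V] [T2Space V] [FiniteDimensional ℝ V]
  {I J K : V →L[ℝ] V}

/-- On covectors the matrix of `ringR` is `(1 - √-1 I - J + √-1 K)/2`; a 2-form receives this
operator in both arguments. -/
theorem ringR_two_apply (β : CForm V 2) (X Y : V) : ringR I J K 2 β ![X, Y] =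
    4⁻¹ * ∑ s : Fin 4, ∑ t : Fin 4, ((![1, -Complex.I, -1, Complex.I] : Fin 4 → ℂ) s *
      (![1, -Complex.I, -1, Complex.I] : Fin 4 → ℂ) t) * β ![![X, I X, J X, K X] s, ![Y, I Y, J Y, K Y] t] := by
  let ev (v : Fin 2 → V) : MForm V 2 →ₗ[ℂ] ℂ :=
    { toFun := fun m => m v
      map_add' := fun _ _ => rfl
      map_smul' := fun _ _ => rfl }
  have hev (v : Fin 2 → V) (m : MForm V 2) : ev v m = m v := rfl
  have key : ev ![X, Y] ∘ₗ mind (fun _ => mat I J K 1 1 0 0) =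
      (4⁻¹ : ℂ) • ∑ s : Fin 4, ∑ t : Fin 4, ((![1, -Complex.I, -1, Complex.I] : Fin 4 → ℂ) s *
      (![1, -Complex.I, -1, Complex.I] : Fin 4 → ℂ) t) • ev ![![X, I X, J X, K X] s, ![Y, I Y, J Y, K Y] t] := by
    refine mform_ext fun φ => ?_
    rw [LinearMap.comp_apply, mind_prodForm, LinearMap.smul_apply]
    simp only [LinearMap.sum_apply, LinearMap.smul_apply]
    simp only [hev, prodForm_apply, Fin.prod_univ_two, Fin.sum_univ_four, mat_apply]
    simp
    linear_combination (1/4*(φ 0 (I X) * φ 1 (I Y) - φ 0 (I X) * φ 1 (K Y) - φ 0 (K X) * φ 1 (I Y) + φ 0 (K X) * φ 1 (K Y))) * Complex.I_mul_I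
  have := LinearMap.congr_fun key β.toContinuousMultilinearMap
  rw [LinearMap.comp_apply, ← toContinuousMultilinearMap_ind, LinearMap.smul_apply] at this
  simp only [LinearMap.sum_apply, LinearMap.smul_apply] at this
  exact this

theorem cform_two_swap (β : CForm V 2) (X Y : V) : β ![X, Y] = -β ![Y, X] := by
  have := β.toAlternatingMap.map_swap ![X, Y] (i := 0) (j := 1) (by decide)
  have e : ![X, Y] ∘ Equiv.swap (0 : Fin 2) 1 = ![Y, X] := by
    ext i; fin_cases i <;> simp
  rw [e] at this
  exact (neg_eq_iff_eq_neg.2 this).symm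

theorem cform_two_neg (β : CForm V 2) (X Y : V) : β ![-X, Y] = -β ![X, Y] := by
  have := ContinuousAlternatingMap.vecCons_smul β ![Y] (-1 : ℝ) X
  simpa using this

theorem cform_two_neg' (β : CForm V 2) (X Y : V) : β ![X, -Y] = -β ![X, Y] := by
  rw [cform_two_swap, cform_two_neg, cform_two_swap β Y X, neg_neg]

theorem cform_two_self (β : CForm V 2) (X : V) : β ![X, X] = 0 :=
  β.map_eq_zero_of_eq ![X, X] (i := 0) (j := 1) rfl (by decide)

theorem apply_I_I (h : IsQuaternionic I J K) {β : CForm V 2} (hβ : β ∈ hodge I 2 1 1) (X Y : V) :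
    β ![I X, I Y] = β ![X, Y] := by
  have h1 := pull_rmul (I := I) (J := J) (K := K) (⟨0, 1, 0, 0⟩ : ℍ[ℝ]) β
  have h2 : pull 2 I β = β := by
    have e : rmul I J K (⟨0, 1, 0, 0⟩ : ℍ[ℝ]) = I := by
      ext v; simp [rmul]
    rw [e] at h1
    rw [h1]
    simp only [Complex.ofReal_zero, Complex.ofReal_one, one_mul, zero_mul, zero_add, zero_sub,
      neg_zero, sub_zero]
    rw [(mem_hodge_iff h one_add_one_eq_two).1 hβ]
    simp
  conv_rhs => rw [← h2]
  change _ = β (fun j => I (![X, Y] j))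
  congr 1
  ext j; fin_cases j <;> rfl

/-- Type `(1,1)` means invariance under `I`, which cancels the terms other than those pairing a
vector with its image under `I`. -/
theorem ringR_apply_J (h : IsQuaternionic I J K) {β : CForm V 2} (hβ : β ∈ hodge I 2 1 1) (X : V) :
    ringR I J K 2 β ![X, J X] = Complex.I / 2 * (β ![X, I X] + β ![J X, I (J X)]) := by
  have e1 : β ![X, J X] = -β ![I X, K X] := by
    rw [← apply_I_I h hβ, h.mul_JI, cform_two_neg']
  rw [ringR_two_apply]
  simp only [Fin.sum_univ_four, Matrix.cons_val, h.mul_JI, h.sq_J, h.mul_JK,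
    cform_two_neg', cform_two_self]
  rw [e1, cform_two_swap β (I X) X, cform_two_swap β (J X) X, cform_two_swap β (K X) X,
    cform_two_swap β (J X) (I X), cform_two_swap β (K X) (I X), cform_two_swap β (K X) (J X), e1]
  linear_combination (-2⁻¹ * β ![I X, K X]) * Complex.I_mul_I

theorem isQPositive_of_isPositive (h : IsQuaternionic I J K) {β : CForm V 2}
    (hβ : IsPositive I β) : IsQPositive I J ((-Complex.I) • ringR I J K 2 β) := by
  refine ⟨Submodule.smul_mem _ _ (ringR_mem_hodge h β), ?_, fun X => ?_⟩
  · have h1 := ringR_conjForm h one_add_one_eq_two hβ.type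
    rw [hβ.real, pow_one] at h1
    rw [pull_conjForm, map_smul, conjForm_smul]
    conv_rhs => rw [h1]
    rw [smul_smul, map_neg, Complex.conj_I]
    simp
  · rw [ContinuousAlternatingMap.smul_apply, ringR_apply_J h hβ.type, smul_eq_mul]
    have e : -Complex.I * (Complex.I / 2 * (β ![X, I X] + β ![J X, I (J X)])) =
        ((1 / 2 : ℝ) : ℂ) * (β ![X, I X] + β ![J X, I (J X)]) := by
      push_cast
      linear_combination (-(β ![X, I X] + β ![J X, I (J X)]) / 2) * Complex.I_mul_I
    rw [e, Complex.re_ofReal_mul, Complex.add_re]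
    have := hβ.nonneg X
    have := hβ.nonneg (J X)
    positivity

theorem isQPositive_of_isPositive' (h : IsQuaternionic I J K) {β : CForm V 2}
    (hβ : IsPositive' I β) : IsQPositive I J (Complex.I • ringR I J K 2 β) := by
  have hn : IsPositive I ((-1 : ℂ) • β) := by
    refine ⟨Submodule.smul_mem _ _ hβ.type, ?_, fun X => ?_⟩
    · rw [conjForm_smul, hβ.real, map_neg, map_one]
    · rw [ContinuousAlternatingMap.smul_apply, cform_two_swap, smul_neg, neg_one_smul, neg_neg]
      exact hβ.nonneg X
  have := isQPositive_of_isPositive h hn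
  rw [map_smul, smul_smul] at this
  simpa using this

theorem ringR_zero (h : IsQuaternionic I J K) (x : CForm V 0) : ringR I J K 0 x = x := by
  refine ringR_of_mem_hodge h fun θ => ?_
  have e : pull 0 (Real.cos θ • ContinuousLinearMap.id ℝ V + Real.sin θ • I) x = x := by
    ext v
    exact congrArg x (Subsingleton.elim _ _)
  rw [e]
  simp

theorem isProduct_ringR (h : IsQuaternionic I J K) {P Q : Set (CForm V 2)} {c : ℂ}
    (hPQ : ∀ β ∈ P, c • ringR I J K 2 β ∈ Q) {p : ℕ} {a : CForm V (2 * p)} (ha : IsProduct P p a) :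
    IsProduct Q p (c ^ p • ringR I J K (2 * p) a) := by
  induction ha with
  | one =>
    have := ringR_zero h (ContinuousAlternatingMap.constOfIsEmpty ℝ V (Fin 0) (1 : ℂ) : CForm V 0)
    rw [pow_zero, one_smul]
    change IsProduct Q 0 (ringR I J K 0 _)
    rw [this]
    exact IsProduct.one
  | @mul p a β _ hβ ih =>
    have e : c ^ (p + 1) • ringR I J K (2 * (p + 1)) (wedge a β) =
        wedge (c ^ p • ringR I J K (2 * p) a) (c • ringR I J K 2 β) := by
      rw [wedge_smul_smul, pow_succ]
      congr 1
      exact act_wedge _ _ _ _ a β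
    rw [e]
    exact IsProduct.mul ih (hPQ β hβ)

theorem productCone_ringR (h : IsQuaternionic I J K) {P Q : Set (CForm V 2)} {c : ℂ}
    (hPQ : ∀ β ∈ P, c • ringR I J K 2 β ∈ Q) {p : ℕ} {a : CForm V (2 * p)}
    (ha : a ∈ productCone P p) : c ^ p • ringR I J K (2 * p) a ∈ productCone Q p := by
  refine Submodule.span_induction (p := fun a _ => c ^ p • ringR I J K (2 * p) a ∈ productCone Q p)
    (fun a ha => ?_) ?_ (fun a b _ _ ha hb => ?_) (fun r a _ ha => ?_) ha
  · exact Submodule.subset_span (isProduct_ringR h hPQ ha)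
  · rw [map_zero, smul_zero_cform]; exact Submodule.zero_mem _
  · rw [map_add, smul_add]; exact Submodule.add_mem _ ha hb
  · have e : r • a = ((r : ℝ) : ℂ) • a := by
      ext v; rfl
    rw [e, map_smul, smul_comm]
    exact Submodule.smul_mem _ r ha

end Positivity

/-! ### Antisymmetrized derivatives and their Hodge components -/

section Uncurry

open ContinuousAlternatingMap (alternatizeUncurryFin alternatizeUncurryFin_apply
  alternatizeUncurryFin_smul alternatizeUncurryFin_add)

variable {E : Type*} [NormedAddCommGroup E] [NormedSpace ℝ E] [FiniteDimensional ℝ E] {k : ℕ}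

/-- `∑ θᵢ ⊗ φᵢ ↦ ∑ S θᵢ ⊗ U φᵢ` for form valued linear maps. -/
def twist (S : DualEnd E) (U : CForm E k →ₗ[ℂ] CForm E k) (φ : E →L[ℝ] CForm E k) :
    E →L[ℝ] CForm E k :=
  ∑ i, (S (vcoord i)).smulRight (U (φ (vbasis E i)))

theorem twist_apply (S : DualEnd E) (U : CForm E k →ₗ[ℂ] CForm E k) (φ : E →L[ℝ] CForm E k)
    (X : E) : twist S U φ X = ∑ i, S (vcoord i) X • U (φ (vbasis E i)) := by
  simp [twist]

theorem twist_one (φ : E →L[ℝ] CForm E k) : twist 1 LinearMap.id φ = φ := by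
  ext1 X
  rw [twist_apply]
  conv_rhs => rw [← (vbasis E).sum_repr X, map_sum]
  refine Finset.sum_congr rfl fun i _ => ?_
  rw [Module.End.one_apply, vcoord_apply, map_smul, LinearMap.id_apply]
  ext v
  simp

theorem twist_twist (S T : DualEnd E) (U W : CForm E k →ₗ[ℂ] CForm E k)
    (φ : E →L[ℝ] CForm E k) : twist T W (twist S U φ) = twist (T * S) (W ∘ₗ U) φ := by
  ext1 X
  rw [twist_apply, twist_apply]
  simp only [twist_apply, map_sum, map_smul, Finset.smul_sum]
  rw [Finset.sum_comm]
  refine Finset.sum_congr rfl fun i _ => ?_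
  have h := congrArg (fun ψ => T ψ X) (sum_vbasis (S (vcoord i)))
  simp only [map_sum, map_smul] at h
  rw [Module.End.mul_apply, ← h, sum_apply, Finset.sum_smul (M := CForm E k)]
  refine Finset.sum_congr rfl fun j _ => ?_
  rw [smul_smul, smul_apply, smul_eq_mul, mul_comm]
  rfl

theorem twist_add (S T : DualEnd E) (U : CForm E k →ₗ[ℂ] CForm E k) (φ : E →L[ℝ] CForm E k) :
    twist (S + T) U φ = twist S U φ + twist T U φ := by
  ext1 X
  simp only [twist_apply, LinearMap.add_apply, add_apply, ← Finset.sum_add_distrib]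
  exact Finset.sum_congr rfl fun i _ => add_smul (M := CForm E k) _ _ _

/-- Singling out argument `i` in the basis expansion separates the derivative slot from the `k`
slots of the form, and `T` acts on each. -/
theorem ind_alternatizeUncurryFin (T : DualEnd E) (φ : E →L[ℝ] CForm E k) :
    ind (k + 1) T (alternatizeUncurryFin φ) = alternatizeUncurryFin (twist T (ind k T) φ) := by
  ext v
  rw [ind_apply_apply, alternatizeUncurryFin_apply]
  simp only [alternatizeUncurryFin_apply, Finset.sum_mul]
  rw [Finset.sum_comm]
  refine Finset.sum_congr rfl fun i _ => ?_
  rw [twist_apply, ← (Fin.insertNthEquiv (fun _ => Fin (Module.finrank ℝ E)) i).sum_comp,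
    Fintype.sum_prod_type, ContinuousAlternatingMap.sum_apply, Finset.smul_sum]
  refine Finset.sum_congr rfl fun m _ => ?_
  rw [ContinuousAlternatingMap.smul_apply, ind_apply_apply, Finset.smul_sum, Finset.smul_sum]
  refine Finset.sum_congr rfl fun g _ => ?_
  have h1 : i.removeNth (fun j => vbasis E (i.insertNth (α := fun _ => Fin (Module.finrank ℝ E)) m g j)) =
      fun j => vbasis E (g j) := by
    ext1 j
    simp [Fin.removeNth]
  rw [Fin.prod_univ_succAbove _ i]
  simp only [Fin.insertNthEquiv_apply, Fin.insertNth_apply_same, Fin.insertNth_apply_succAbove, h1,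
    Fin.removeNth, smul_eq_mul, zsmul_eq_mul]
  ring

theorem ind_alternatizeUncurryFin_twist (T S : DualEnd E) (U : CForm E k →ₗ[ℂ] CForm E k)
    (φ : E →L[ℝ] CForm E k) : ind (k + 1) T (alternatizeUncurryFin (twist S U φ)) =
      alternatizeUncurryFin (twist (T * S) (ind k T ∘ₗ U) φ) := by
  rw [ind_alternatizeUncurryFin, twist_twist]

theorem twist_congr (S : DualEnd E) {U U' : CForm E k →ₗ[ℂ] CForm E k}
    {φ φ' : E →L[ℝ] CForm E k} (h : ∀ X, U (φ X) = U' (φ' X)) : twist S U φ = twist S U' φ' := by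
  ext1 X
  simp only [twist_apply, h]

variable {I J K : E →L[ℝ] E}

/-- The two diagonal matrix units sum to the identity and split the derivative slot into its `(1,0)`
and `(0,1)` parts; with values of type `(p,q)` these are the two Hodge components. -/
theorem hodgeProj_alternatizeUncurryFin (h : IsQuaternionic I J K) {p q : ℕ} (hk : p + q = k)
    {φ : E →L[ℝ] CForm E k} (hφ : ∀ X, φ X ∈ hodge I k p q) :
    hodgeProj I (k + 1) (p + 1) q (alternatizeUncurryFin φ) =
        alternatizeUncurryFin (twist (mat I J K 1 0 0 0) LinearMap.id φ) ∧
    hodgeProj I (k + 1) p (q + 1) (alternatizeUncurryFin φ) =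
        alternatizeUncurryFin (twist (mat I J K 0 0 0 1) LinearMap.id φ) := by
  have h1 : alternatizeUncurryFin (twist (mat I J K 1 0 0 0) LinearMap.id φ) ∈
      hodge I (k + 1) (p + 1) q := by
    rw [mem_hodge_iff h (by omega)]
    intro z w
    rw [act, ind_alternatizeUncurryFin_twist, mat_mul h, LinearMap.comp_id,
      ← alternatizeUncurryFin_smul]
    congr 1
    ext1 X
    rw [smul_apply, twist_apply, twist_apply, Finset.smul_sum]
    refine Finset.sum_congr rfl fun i _ => ?_
    have e := (mem_hodge_iff h hk).1 (hφ (vbasis E i)) z w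
    rw [act] at e
    have e2 := mat_smul I J K z 1 0 0 0
    simp only [mul_one, mul_zero] at e2
    simp only [mul_one, mul_zero, add_zero]
    rw [e, e2, LinearMap.smul_apply, smul_apply, smul_smul, LinearMap.id_apply, smul_smul]
    congr 1
    rw [smul_eq_mul]
    ring
  have h2 : alternatizeUncurryFin (twist (mat I J K 0 0 0 1) LinearMap.id φ) ∈
      hodge I (k + 1) p (q + 1) := by
    rw [mem_hodge_iff h (by omega)]
    intro z w
    rw [act, ind_alternatizeUncurryFin_twist, mat_mul h, LinearMap.comp_id,
      ← alternatizeUncurryFin_smul]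
    congr 1
    ext1 X
    rw [smul_apply, twist_apply, twist_apply, Finset.smul_sum]
    refine Finset.sum_congr rfl fun i _ => ?_
    have e := (mem_hodge_iff h hk).1 (hφ (vbasis E i)) z w
    rw [act] at e
    have e2 := mat_smul I J K w 0 0 0 1
    simp only [mul_one, mul_zero] at e2
    simp only [mul_one, mul_zero, zero_add]
    rw [e, e2, LinearMap.smul_apply, smul_apply, smul_smul, LinearMap.id_apply, smul_smul]
    congr 1
    rw [smul_eq_mul]
    ring
  have h3 : alternatizeUncurryFin φ =
      alternatizeUncurryFin (twist (mat I J K 1 0 0 0) LinearMap.id φ) +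
      alternatizeUncurryFin (twist (mat I J K 0 0 0 1) LinearMap.id φ) := by
    have e := mat_add_smul I J K 1 1 1 0 0 0 0 0 0 1
    simp only [one_smul, mul_one, mul_zero, add_zero, zero_add] at e
    rw [← alternatizeUncurryFin_add, ← twist_add, ← e, mat_one, twist_one]
  rw [(hodgeProj_eq h (by omega)).2, (hodgeProj_eq h (by omega)).2, h3]
  simp only [map_add]
  rw [comp_of_mem_hodge J K (by omega) h1 (by omega), comp_of_mem_hodge J K (by omega) h2 (by omega),
    comp_of_mem_hodge J K (by omega) h1 (by omega), comp_of_mem_hodge J K (by omega) h2 (by omega)]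
  simp

end Uncurry

/-! ### The Obata connection at a point -/

section Connection

variable {E : Type*} [NormedAddCommGroup E] [NormedSpace ℝ E] {I J K : E →L[ℝ] E}

/-- The symbol of the Obata connection: the derivatives `a` of `I` and `b` of `J` at a point come
from a symmetric bilinear map, as soon as the Nijenhuis tensors of `I` and `J` vanish there. -/
theorem exists_connection (h : IsQuaternionic I J K) (a b : E →L[ℝ] E →L[ℝ] E)
    (hR2 : ∀ X Y, b X (J Y) + J (b X Y) = 0)
    (hR3 : ∀ X Y, b X (I Y) + J (a X Y) + a X (J Y) + I (b X Y) = 0)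
    (hNI : ∀ X Y, a (I X) Y - a (I Y) X + I (a Y X) - I (a X Y) = 0)
    (hNJ : ∀ X Y, b (J X) Y - b (J Y) X + J (b Y X) - J (b X Y) = 0) :
    ∃ Γ : E →L[ℝ] E →L[ℝ] E, (∀ X Y, Γ X Y = Γ Y X) ∧
      (∀ X Y, a X Y = Γ X (I Y) - I (Γ X Y)) ∧ (∀ X Y, b X Y = Γ X (J Y) - J (Γ X Y)) := by
  let C := ContinuousLinearMap.compL ℝ E E E
  -- This is the Obata connection up to sign. Symmetry follows from the Nijenhuis identities and
  -- `hR3` at arguments rotated by `I`, `J`, `K`; the other two claims say that the commutators of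
  -- `Γ X` with `I` and `J` are their derivatives.
  let Γ : E →L[ℝ] E →L[ℝ] E := (2⁻¹ : ℝ) • (C I ∘L a.flip + C J ∘L b + C K ∘L b ∘L I
    - C K ∘L C.flip J ∘L a.flip)
  have hΓ (X Y : E) : Γ X Y =
      (2⁻¹ : ℝ) • (I (a Y X) + J (b X Y) + K (b (I X) Y) - K (a (J Y) X)) := by
    simp [Γ, C]
  refine ⟨Γ, fun X Y => ?_, fun X Y => ?_, fun X Y => ?_⟩
  · rw [hΓ, hΓ]
    have e0 := hNI X Y
    have e1 := hNI (J X) (J Y)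
    have e2 := congrArg J (hNI X (J Y))
    have e3 := congrArg J (hNI (J X) Y)
    have e4 := hNJ X Y
    have e5 := hNJ (I X) (I Y)
    have e6 := congrArg I (hNJ X (I Y))
    have e7 := congrArg I (hNJ (I X) Y)
    have e8 := hR3 (K X) Y
    have e9 := hR3 (K Y) X
    have e10 := congrArg I (hR3 (J X) Y)
    have e11 := congrArg I (hR3 (J Y) X)
    have e12 := congrArg J (hR3 (I X) Y)
    have e13 := congrArg J (hR3 (I Y) X)
    have e14 := congrArg K (hR3 X Y)
    have e15 := congrArg K (hR3 Y X)
    simp only [map_add, map_sub, map_neg, map_zero, neg_apply, h.sq_I, h.sq_J, h.mul_IJ,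
      h.mul_JI, h.mul_IK, h.mul_JK]
      at e0 e1 e2 e3 e4 e5 e6 e7 e8 e9 e10 e11 e12 e13 e14 e15 ⊢
    linear_combination (norm := module) (1/4 : ℝ) • e0 + (-1/4 : ℝ) • e1 + (-1/4 : ℝ) • e2 +
      (-1/4 : ℝ) • e3 + (-1/4 : ℝ) • e4 + (1/4 : ℝ) • e5 + (1/4 : ℝ) • e6 + (1/4 : ℝ) • e7 +
      (-1/4 : ℝ) • e8 + (1/4 : ℝ) • e9 + (-1/4 : ℝ) • e10 + (1/4 : ℝ) • e11 + (1/4 : ℝ) • e12 +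
      (-1/4 : ℝ) • e13 + (-1/4 : ℝ) • e14 + (1/4 : ℝ) • e15
  · rw [hΓ, hΓ]
    have e0 := congrArg I (hNI X Y)
    have e1 := congrArg K (hNI X (J Y))
    have e2 := congrArg J (hR3 X Y)
    have e3 := congrArg K (hR3 (I X) Y)
    simp only [map_add, map_sub, map_neg, map_zero, map_smul, neg_apply, h.sq_I,
      h.sq_J, h.mul_IJ, h.mul_JI, h.mul_KI, h.mul_IK, h.mul_JK] at e0 e1 e2 e3 ⊢
    linear_combination (norm := module) (1/2 : ℝ) • e0 + (1/2 : ℝ) • e1 + (-1/2 : ℝ) • e2 +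
      (-1/2 : ℝ) • e3
  · rw [hΓ, hΓ]
    have e0 := congrArg J (hR2 X Y)
    have e1 := congrArg K (hR2 (I X) Y)
    simp only [map_add, map_sub, map_neg, map_zero, map_smul, neg_apply, h.sq_J,
      h.mul_IJ, h.mul_KJ, h.mul_JK] at e0 e1 ⊢
    linear_combination (norm := module) (-1/2 : ℝ) • e0 + (-1/2 : ℝ) • e1

end Connection

/-! ### Smooth dependence of the matrix action -/

section Smooth

variable {E : Type*} [NormedAddCommGroup E] [NormedSpace ℝ E] [FiniteDimensional ℝ E] {k : ℕ}

theorem contDiff_cform {F : Type*} [NormedAddCommGroup F] [NormedSpace ℝ F] {n : WithTop ℕ∞}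
    {f : F → CForm E k} (hf : ∀ v, ContDiff ℝ n fun x => f x v) : ContDiff ℝ n f := by
  let ev : CForm E k →ₗ[ℝ] ((Fin k → Fin (Module.finrank ℝ E)) → ℂ) :=
    { toFun := fun a m => a fun j => vbasis E (m j)
      map_add' := fun _ _ => rfl
      map_smul' := fun _ _ => rfl }
  have hev : LinearMap.ker ev = ⊥ := by
    refine LinearMap.ker_eq_bot.2 fun a b hab => ?_
    ext v
    rw [← ind_one a, ← ind_one b, ind_apply_apply, ind_apply_apply]
    refine Finset.sum_congr rfl fun m _ => ?_
    rw [show (a fun j => vbasis E (m j)) = b fun j => vbasis E (m j) from congrFun hab m]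
  obtain ⟨g, hg⟩ := ev.exists_leftInverse_of_injective hev
  have : f = fun x => LinearMap.toContinuousLinearMap g (ev (f x)) := by
    ext1 x
    exact (LinearMap.congr_fun hg (f x)).symm
  rw [this]
  exact (ContinuousLinearMap.contDiff _).comp (contDiff_pi.2 fun m => hf _)

theorem contDiff_act (a b c d : ℂ) {n : WithTop ℕ∞} :
    ContDiff ℝ n fun p : ((E →L[ℝ] E) × (E →L[ℝ] E) × (E →L[ℝ] E)) × CForm E k =>
      act p.1.1 p.1.2.1 p.1.2.2 k a b c d p.2 := by
  refine contDiff_cform fun v => ?_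
  have hev (w : Fin k → E) : ContDiff ℝ n fun p : ((E →L[ℝ] E) × (E →L[ℝ] E) × (E →L[ℝ] E)) × CForm E k =>
      p.2 w :=
    (ContinuousLinearMap.contDiff (ContinuousAlternatingMap.apply ℝ E ℂ w)).comp contDiff_snd
  simp only [act, ind_apply_apply, mat_apply]
  refine ContDiff.sum fun m _ => (hev _).mul (contDiff_prod fun j _ => ?_)
  have hl (φ : CDual E) (w : E) : ContDiff ℝ n fun A : E →L[ℝ] E => φ (A w) :=
    φ.contDiff.comp (ContinuousLinearMap.apply ℝ E w).contDiff
  have h1 := (hl (vcoord (m j)) (v j)).comp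
    (contDiff_fst.comp (contDiff_fst (𝕜 := ℝ) (E := (E →L[ℝ] E) × (E →L[ℝ] E) × (E →L[ℝ] E)) (F := CForm E k)))
  have h2 := (hl (vcoord (m j)) (v j)).comp
    ((contDiff_fst.comp contDiff_snd).comp (contDiff_fst (𝕜 := ℝ) (E := (E →L[ℝ] E) × (E →L[ℝ] E) × (E →L[ℝ] E)) (F := CForm E k)))
  have h3 := (hl (vcoord (m j)) (v j)).comp
    ((contDiff_snd.comp contDiff_snd).comp (contDiff_fst (𝕜 := ℝ) (E := (E →L[ℝ] E) × (E →L[ℝ] E) × (E →L[ℝ] E)) (F := CForm E k)))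
  exact ((contDiff_const.add (contDiff_const.mul h1)).add (contDiff_const.mul h2)).add
    (contDiff_const.mul h3)

end Smooth

/-! ### The first order part of a form and the differentials in coordinates -/

section FirstOrder

open Topology Filter
open ContinuousAlternatingMap (alternatizeUncurryFin)

variable {E : Type*} [NormedAddCommGroup E] [NormedSpace ℝ E] [FiniteDimensional ℝ E] {k : ℕ}

theorem hasFDerivAt_act {F : Type*} [NormedAddCommGroup F] [NormedSpace ℝ F] {x : F}
    {I J K : F → E →L[ℝ] E} {α : F → CForm E k} (hI : HasFDerivAt I (0 : F →L[ℝ] E →L[ℝ] E) x)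
    (hJ : HasFDerivAt J (0 : F →L[ℝ] E →L[ℝ] E) x) (hK : HasFDerivAt K (0 : F →L[ℝ] E →L[ℝ] E) x)
    {α' : F →L[ℝ] CForm E k} (hα : HasFDerivAt α α' x) (a b c d : ℂ) (X : F) :
    fderiv ℝ (fun y => act (I y) (J y) (K y) k a b c d (α y)) x X =
      act (I x) (J x) (K x) k a b c d (α' X) := by
  let Φ := fun p : ((E →L[ℝ] E) × (E →L[ℝ] E) × (E →L[ℝ] E)) × CForm E k =>
      act p.1.1 p.1.2.1 p.1.2.2 k a b c d p.2
  have hΦ : HasFDerivAt Φ (fderiv ℝ Φ ((I x, J x, K x), α x)) ((I x, J x, K x), α x) :=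
    ((contDiff_act (n := 1) a b c d).differentiable one_ne_zero).differentiableAt.hasFDerivAt
  have h1 := hΦ.comp x ((hI.prodMk (hJ.prodMk hK)).prodMk hα)
  have : FiniteDimensional ℝ (CForm E k) := FiniteDimensional.complexToReal _
  let T := LinearMap.toContinuousLinearMap
    ((act (I x) (J x) (K x) k a b c d).restrictScalars ℝ)
  have h2 : HasFDerivAt T T (α x) := T.hasFDerivAt
  have h3 : HasFDerivAt T _ (α x) := HasFDerivAt.comp (𝕜 := ℝ) (g := Φ)
    (f := fun a : CForm E k => ((I x, J x, K x), a)) (α x) hΦ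
    ((hasFDerivAt_const _ _).prodMk (hasFDerivAt_id _))
  have h4 := congrArg (fun S => S (α' X)) (h2.unique h3)
  rw [show (fun y => act (I y) (J y) (K y) k a b c d (α y)) =
    Φ ∘ fun y => ((I y, J y, K y), α y) from rfl, h1.fderiv]
  exact h4.symm

theorem hasFDerivAt_inverse_mul_mul {F : Type*} [NormedAddCommGroup F] [NormedSpace ℝ F] {x : F}
    {L A : F → E →L[ℝ] E} {Γ A' : F →L[ℝ] E →L[ℝ] E} (hL : HasFDerivAt L Γ x) (hL1 : L x = 1)
    (hA : HasFDerivAt A A' x) (hA' : ∀ X Y, A' X Y = Γ X (A x Y) - A x (Γ X Y)) :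
    HasFDerivAt (fun v => Ring.inverse (L v) * A v * L v) (0 : F →L[ℝ] E →L[ℝ] E) x := by
  have hc : CompleteSpace E := FiniteDimensional.complete ℝ E
  have hinv : HasFDerivAt (fun v => Ring.inverse (L v)) (-Γ) x := by
    have e1 := hasFDerivAt_ringInverse (𝕜 := ℝ) (1 : (E →L[ℝ] E)ˣ)
    rw [Units.val_one, ← hL1] at e1
    refine (e1.comp x hL).congr_fderiv ?_
    ext X Y
    simp
  refine ((hinv.mul' hA).mul' hL).congr_fderiv ?_
  ext1 X
  change (Ring.inverse (L x) * A x) * Γ X + (Ring.inverse (L x) * A' X + -Γ X * A x) * L x = 0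
  have e : A' X = Γ X * A x - A x * Γ X := ContinuousLinearMap.ext (hA' X)
  rw [hL1, Ring.inverse_one, e]
  noncomm_ring

theorem precomp_neg_J {V : Type*} [AddCommGroup V] [Module ℝ V] [TopologicalSpace V]
    [IsTopologicalAddGroup V] [ContinuousSMul ℝ V] (I J K : V →L[ℝ] V) :
    precomp (-J) = mat I J K 0 1 (-1) 0 := by
  ext φ v
  simp [mat_apply]
  ring

/-- At a point where the derivatives of `I` and `J` come from a symmetric bilinear map, there is a
coordinate change in which the derivatives of `I, J, K` vanish; in these coordinates the first
order part of a form computes its exterior derivative, and commutes with quaternions. -/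
theorem exists_firstOrder {I J K : E → E →L[ℝ] E} {y₀ : E}
    (h : ∀ᶠ y in 𝓝 y₀, IsQuaternionic (I y) (J y) (K y))
    {a b : E →L[ℝ] E →L[ℝ] E} (hI : HasFDerivAt I a y₀) (hJ : HasFDerivAt J b y₀)
    (hNI : ∀ X Y, a (I y₀ X) Y - a (I y₀ Y) X + I y₀ (a Y X) - I y₀ (a X Y) = 0)
    (hNJ : ∀ X Y, b (J y₀ X) Y - b (J y₀ Y) X + J y₀ (b Y X) - J y₀ (b X Y) = 0) :
    ∃ D : (E → CForm E k) → E →L[ℝ] CForm E k,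
      (∀ α, DifferentiableAt ℝ α y₀ → extDeriv α y₀ = alternatizeUncurryFin (D α)) ∧
      (∀ α β z₁ z₂ z₃ z₄, DifferentiableAt ℝ α y₀ →
        (∀ᶠ y in 𝓝 y₀, β y = act (I y) (J y) (K y) k z₁ z₂ z₃ z₄ (α y)) →
        ∀ X, D β X = act (I y₀) (J y₀) (K y₀) k z₁ z₂ z₃ z₄ (D α X)) ∧
      (∀ α β (c : ℂ), DifferentiableAt ℝ α y₀ → (∀ᶠ y in 𝓝 y₀, β y = c • α y) →
        ∀ X, D β X = c • D α X) := by
  have hc : CompleteSpace E := FiniteDimensional.complete ℝ E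
  have h0 := h.self_of_nhds
  have hR2 (X Y : E) : b X (J y₀ Y) + J y₀ (b X Y) = 0 := by
    have e : (fun y => (J y).comp (J y)) =ᶠ[𝓝 y₀] fun _ => -ContinuousLinearMap.id ℝ E := by
      filter_upwards [h] with y hy
      ext X
      simp [hy.sq_J]
    have e1 := ((hJ.clm_comp hJ).congr_of_eventuallyEq e.symm).unique (hasFDerivAt_const _ _)
    simpa [add_comm] using congrArg (fun T => T X Y) e1
  have hR3 (X Y : E) : b X (I y₀ Y) + J y₀ (a X Y) + a X (J y₀ Y) + I y₀ (b X Y) = 0 := by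
    have e : (fun y => (J y).comp (I y) + (I y).comp (J y)) =ᶠ[𝓝 y₀] fun _ => 0 := by
      filter_upwards [h] with y hy
      ext X
      simp [hy.mul_IJ, hy.mul_JI]
    have e1 := (((hJ.clm_comp hI).add (hI.clm_comp hJ)).congr_of_eventuallyEq e.symm).unique
      (hasFDerivAt_const _ _)
    have e2 := congrArg (fun T => T X Y) e1
    simp at e2
    rw [← e2]
    abel
  obtain ⟨Γ, hΓ, hΓI, hΓJ⟩ := exists_connection h0 a b hR2 hR3 hNI hNJ
  -- Since `Γ` is symmetric, `ψ` has derivative `1 + Γ v`. Conjugating by this derivative adds minus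
  -- the commutator with `Γ`, which cancels the derivatives of `I`, `J`, `K` at the origin.
  let ψ : E → E := fun v => y₀ + v + (2⁻¹ : ℝ) • Γ v v
  let L : E → E →L[ℝ] E := fun v => 1 + Γ v
  have hψ (v : E) : HasFDerivAt ψ (L v) v := by
    have e1 : HasFDerivAt (fun v => Γ v v) (Γ v + Γ.flip v) v := by
      have := Γ.hasFDerivAt.clm_apply (hasFDerivAt_id (𝕜 := ℝ) v)
      simpa using this
    have e2 := ((hasFDerivAt_id (𝕜 := ℝ) v).const_add y₀).add (e1.const_smul (2⁻¹ : ℝ))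
    refine e2.congr_fderiv ?_
    ext X
    simp only [add_apply, smul_apply, ContinuousLinearMap.flip_apply, hΓ X v, L, ContinuousLinearMap.id_apply,
      one_apply_eq_self]
    module
  have hL (v : E) : HasFDerivAt L Γ v := Γ.hasFDerivAt.const_add 1
  have hψ0 : ψ 0 = y₀ := by simp [ψ]
  have hL0 : L 0 = 1 := by simp [L]
  have hunit : ∀ᶠ v in 𝓝 (0 : E), IsUnit (L v) := by
    refine (hL 0).continuousAt.eventually (p := IsUnit) ?_
    rw [hL0]
    exact Units.isOpen.mem_nhds isUnit_one
  let tr : (E → E →L[ℝ] E) → E → E →L[ℝ] E := fun A v => Ring.inverse (L v) * A (ψ v) * L v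
  have htr0 (A : E → E →L[ℝ] E) : tr A 0 = A y₀ := by simp [tr, hL0, hψ0]
  have htr {A : E → E →L[ℝ] E} {A' : E →L[ℝ] E →L[ℝ] E} (hA : HasFDerivAt A A' y₀)
      (hA' : ∀ X Y, A' X Y = Γ X (A y₀ Y) - A y₀ (Γ X Y)) : HasFDerivAt (tr A) (0 : E →L[ℝ] E →L[ℝ] E) 0 := by
    have e1 : HasFDerivAt (fun v => A (ψ v)) A' 0 := by
      rw [← hψ0] at hA
      refine (hA.comp 0 (hψ 0)).congr_fderiv ?_
      rw [hL0]
      rfl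
    exact hasFDerivAt_inverse_mul_mul (hL 0) hL0 e1 (by rwa [hψ0])
  have htrL {A : E → E →L[ℝ] E} {v : E} (hv : IsUnit (L v)) (Y : E) :
      L v (tr A v Y) = A (ψ v) (L v Y) := by
    have : L v * tr A v = A (ψ v) * L v := by
      simp only [tr]
      rw [← mul_assoc, ← mul_assoc, Ring.mul_inverse_cancel _ hv, one_mul]
    exact congrArg (fun T => T Y) this
  have hK : HasFDerivAt K ((ContinuousLinearMap.compL ℝ E E E (J y₀)).comp a +
      ((ContinuousLinearMap.compL ℝ E E E).flip (I y₀)).comp b) y₀ := by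
    refine (hJ.clm_comp hI).congr_of_eventuallyEq ?_
    filter_upwards [h] with y hy
    ext X
    simp [hy.mul_IJ]
  have hΓK (X Y : E) : ((ContinuousLinearMap.compL ℝ E E E (J y₀)).comp a +
      ((ContinuousLinearMap.compL ℝ E E E).flip (I y₀)).comp b) X Y =
      Γ X (K y₀ Y) - K y₀ (Γ X Y) := by
    simp [hΓI X Y, hΓJ X, h0.mul_IJ]
  have htI := htr hI hΓI
  have htJ := htr hJ hΓJ
  have htK := htr hK hΓK
  let pb : (E → CForm E k) → E → CForm E k := fun α v => (α (ψ v)).compContinuousLinearMap (L v)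
  have hψt : Tendsto ψ (𝓝 0) (𝓝 y₀) := by
    have := (hψ 0).continuousAt.tendsto
    rwa [hψ0] at this
  have hpb {α : E → CForm E k} (hα : DifferentiableAt ℝ α y₀) : DifferentiableAt ℝ (pb α) 0 := by
    rw [← hψ0] at hα
    exact (DifferentiableAt.comp (𝕜 := ℝ) 0 hα
      (hψ 0).differentiableAt).continuousAlternatingMapCompContinuousLinearMap
      (hL 0).differentiableAt
  refine ⟨fun α => fderiv ℝ (pb α) 0, fun α hα => ?_, fun α β z₁ z₂ z₃ z₄ hα hβ X => ?_,
    fun α β c hα hβ X => ?_⟩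
  -- The exterior derivative commutes with pull-back by `ψ`, whose derivative at the origin is the
  -- identity.
  · have hd : fderiv ℝ ψ = L := funext fun v => (hψ v).fderiv
    have hcd : ContDiffAt ℝ 2 ψ 0 := by
      have : ContDiff ℝ 2 ψ := by
        have e : ContDiff ℝ 2 fun v => Γ v v := Γ.contDiff.clm_apply contDiff_id
        exact (contDiff_const.add contDiff_id).add (contDiff_const.smul e)
      exact this.contDiffAt
    have hα' : DifferentiableAt ℝ α (ψ 0) := by rwa [hψ0]
    have e := extDeriv_pullback hα' hcd (by simp)
    rw [hd, hL0, hψ0] at e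
    rw [extDeriv] at e
    refine Eq.trans ?_ e.symm
    ext v
    simp
  · have e : pb β =ᶠ[𝓝 0] fun v => act (tr I v) (tr J v) (tr K v) k z₁ z₂ z₃ z₄ (pb α v) := by
      filter_upwards [hψt.eventually hβ, hunit] with v hv hu
      simp only [pb, hv, act]
      refine (ind_compContinuousLinearMap _ _ _ (fun φ => ?_) _).symm
      ext Y
      simp only [mat_apply, ContinuousLinearMap.comp_apply, htrL hu]
    beta_reduce
    rw [e.fderiv_eq, hasFDerivAt_act htI htJ htK (hpb hα).hasFDerivAt, htr0, htr0, htr0]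
  · have e : pb β =ᶠ[𝓝 0] fun v => c • pb α v := by
      filter_upwards [hψt.eventually hβ] with v hv
      simp only [pb, hv]
      rfl
    beta_reduce
    rw [e.fderiv_eq, fderiv_fun_const_smul (hpb hα)]
    rfl

theorem differentiableAt_act {F : Type*} [NormedAddCommGroup F] [NormedSpace ℝ F] {x : F}
    {I J K : F → E →L[ℝ] E} {α : F → CForm E k} (hI : DifferentiableAt ℝ I x)
    (hJ : DifferentiableAt ℝ J x) (hK : DifferentiableAt ℝ K x) (hα : DifferentiableAt ℝ α x)
    (a b c d : ℂ) : DifferentiableAt ℝ (fun y => act (I y) (J y) (K y) k a b c d (α y)) x :=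
  DifferentiableAt.comp (𝕜 := ℝ) (f := fun y => ((I y, J y, K y), α y)) x
    ((contDiff_act (n := 1) a b c d).differentiable one_ne_zero).differentiableAt
    ((hI.prodMk (hJ.prodMk hK)).prodMk hα)

/-- The operators `∂`, `∂̄` and `∂_J` under `R`, at a point of a coordinate domain. -/
theorem ringR_hodgeProj_extDeriv {I J K : E → E →L[ℝ] E} {y₀ : E}
    (h : ∀ᶠ y in 𝓝 y₀, IsQuaternionic (I y) (J y) (K y))
    (hI : DifferentiableAt ℝ I y₀) (hJ : DifferentiableAt ℝ J y₀) (hK : DifferentiableAt ℝ K y₀)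
    (hNI : ∀ X Y, fderiv ℝ I y₀ (I y₀ X) Y - fderiv ℝ I y₀ (I y₀ Y) X + I y₀ (fderiv ℝ I y₀ Y X)
      - I y₀ (fderiv ℝ I y₀ X Y) = 0)
    (hNJ : ∀ X Y, fderiv ℝ J y₀ (J y₀ X) Y - fderiv ℝ J y₀ (J y₀ Y) X + J y₀ (fderiv ℝ J y₀ Y X)
      - J y₀ (fderiv ℝ J y₀ X Y) = 0)
    {p q : ℕ} (hk : p + q = k) {α β γ : E → CForm E k} (hα : DifferentiableAt ℝ α y₀)
    (hα' : ∀ᶠ y in 𝓝 y₀, α y ∈ hodge (I y) k p q)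
    (hβ : ∀ᶠ y in 𝓝 y₀, β y = ringR (I y) (J y) (K y) k (α y))
    (hγ : ∀ᶠ y in 𝓝 y₀, γ y = pull k (J y) (ringR (I y) (J y) (K y) k (α y))) :
    ringR (I y₀) (J y₀) (K y₀) (k + 1) (hodgeProj (I y₀) (k + 1) (p + 1) q (extDeriv α y₀)) =
      hodgeProj (I y₀) (k + 1) (k + 1) 0 (extDeriv β y₀) ∧
    ringR (I y₀) (J y₀) (K y₀) (k + 1) (hodgeProj (I y₀) (k + 1) p (q + 1) (extDeriv α y₀)) =
      pull (k + 1) (-J y₀) (hodgeProj (I y₀) (k + 1) 0 (k + 1) (extDeriv γ y₀)) := by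
  obtain ⟨D, hD, hact, hsmul⟩ :=
    exists_firstOrder (k := k) h hI.hasFDerivAt hJ.hasFDerivAt hNI hNJ
  have h0 := h.self_of_nhds
  -- The matrix of `J` times that of `ringR` has rows `(0, 0)`, `(1, 1)`.
  have hγ1 : ∀ᶠ y in 𝓝 y₀, γ y = act (I y) (J y) (K y) k 0 0 1 1 (α y) := by
    filter_upwards [h, hγ] with y hy hy'
    rw [hy', pull_J (I := I y) (K := K y), ringR, act_mul hy]
    simp only [mul_zero, mul_one, add_zero]
  have hβd : DifferentiableAt ℝ β y₀ :=
    (differentiableAt_act hI hJ hK hα 1 1 0 0).congr_of_eventuallyEq hβ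
  have hγd : DifferentiableAt ℝ γ y₀ :=
    (differentiableAt_act hI hJ hK hα 0 0 1 1).congr_of_eventuallyEq hγ1
  -- Being of type `(p,q)` is a system of eigenvalue equations for diagonal matrices, and `D`
  -- commutes with these.
  have hDα (X : E) : D α X ∈ hodge (I y₀) k p q := by
    rw [mem_hodge_iff h0 hk]
    intro z w
    have e1 := hact α (fun y => (z ^ p * w ^ q) • α y) z 0 0 w hα (by
      filter_upwards [h, hα'] with y hy hy'
      rw [(mem_hodge_iff hy hk).1 hy'])
    rw [← e1, hsmul α _ _ hα (Eventually.of_forall fun _ => rfl)]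
  have hDβ := hact α β 1 1 0 0 hα hβ
  have hDγ := hact α γ 0 0 1 1 hα hγ1
  have hDβ' (X : E) : D β X ∈ hodge (I y₀) k k 0 := by
    rw [hDβ]
    exact ringR_mem_hodge h0 _
  have hDγ' (X : E) : D γ X ∈ hodge (I y₀) k 0 k := by
    rw [hDγ, mem_hodge_iff h0 (zero_add k)]
    intro z w
    rw [act_mul h0, pow_zero, one_mul, ← act_smul]
    simp only [mul_zero, mul_one, add_zero, zero_add]
  rw [hD α hα, hD β hβd, hD γ hγd, (hodgeProj_alternatizeUncurryFin h0 hk hDα).1,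
    (hodgeProj_alternatizeUncurryFin h0 hk hDα).2,
    (hodgeProj_alternatizeUncurryFin h0 (add_zero k) hDβ').1,
    (hodgeProj_alternatizeUncurryFin h0 (zero_add k) hDγ').2, ringR, act,
    ind_alternatizeUncurryFin_twist, ind_alternatizeUncurryFin_twist, mat_mul h0, mat_mul h0,
    LinearMap.comp_id]
  constructor
  -- The matrix of `ringR` fixes `E₁₁` under left multiplication, so the derivative slots agree.
  · simp only [mul_one, mul_zero, add_zero]
    exact congrArg alternatizeUncurryFin (twist_congr _ fun X => (hDβ X).symm)
  -- In the derivative slot the matrices of `ringR` and of `-J` both send `E₂₂` to `E₁₂`. In the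
  -- form slots `-J` takes the matrix with rows `(0, 0)`, `(1, 1)` back to that of `ringR`.
  · rw [pull_eq_ind, precomp_neg_J (I y₀) (J y₀) (K y₀), ind_alternatizeUncurryFin_twist,
      mat_mul h0, LinearMap.comp_id]
    simp only [mul_one, mul_zero, add_zero, zero_add]
    refine congrArg alternatizeUncurryFin (twist_congr _ fun X => ?_)
    have e1 := act_mul h0 0 1 (-1) 0 0 0 1 1 (D α X)
    simp only [mul_zero, mul_one, add_zero, zero_add] at e1
    rw [hDγ X]
    exact e1.symm

end FirstOrder

/-! ### Reading endomorphisms and brackets in a chart -/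

section Chart

open Topology Filter

variable {E : Type*} [NormedAddCommGroup E] [NormedSpace ℝ E]
  {M : Type*} [TopologicalSpace M] [ChartedSpace E M]

/-- The derivative of the inverse of the chart around `x₀`. -/
def dSymm (x₀ : M) (y : E) : E →L[ℝ] E :=
  mfderiv 𝓘(ℝ, E) 𝓘(ℝ, E) (extChartAt 𝓘(ℝ, E) x₀).symm y

/-- The derivative of the chart around `x₀`, as a function on the coordinate domain. -/
def dChart (x₀ : M) (y : E) : E →L[ℝ] E :=
  mfderiv 𝓘(ℝ, E) 𝓘(ℝ, E) (extChartAt 𝓘(ℝ, E) x₀) ((extChartAt 𝓘(ℝ, E) x₀).symm y)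

/-- A form at a point, as a form on the model space. -/
def formAt {k : ℕ} (a : DForm E M k) (x : M) : CForm E k := a x

/-- An endomorphism of a tangent space, as an endomorphism of the model space. -/
def endAt (A : TangentEnd E M) (x : M) : E →L[ℝ] E := A x

/-- An endomorphism of the tangent bundle in the chart around `x₀`. -/
def chartEnd (A : TangentEnd E M) (x₀ : M) (y : E) : E →L[ℝ] E :=
  (dChart x₀ y).comp ((endAt A ((extChartAt 𝓘(ℝ, E) x₀).symm y)).comp (dSymm x₀ y))

theorem inChart_eq {k : ℕ} (a : DForm E M k) (x₀ : M) (y : E) : inChart a x₀ y =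
    (formAt a ((extChartAt 𝓘(ℝ, E) x₀).symm y)).compContinuousLinearMap (dSymm x₀ y) := rfl

variable [IsManifold 𝓘(ℝ, E) ∞ M]

theorem isManifold_one : IsManifold 𝓘(ℝ, E) 1 M := .of_le (n := ∞) (by simp)

theorem dChart_comp_dSymm {x₀ : M} {y : E} (hy : y ∈ (extChartAt 𝓘(ℝ, E) x₀).target) :
    (dChart x₀ y).comp (dSymm x₀ y) = ContinuousLinearMap.id ℝ E := by
  have := isManifold_one (E := E) (M := M)
  have h := mfderiv_extChartAt_comp_mfderivWithin_extChartAt_symm (I := 𝓘(ℝ, E)) hy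
  rw [modelWithCornersSelf_coe, Set.range_id, mfderivWithin_univ] at h
  exact h

theorem dSymm_comp_dChart {x₀ : M} {y : E} (hy : y ∈ (extChartAt 𝓘(ℝ, E) x₀).target) :
    (dSymm x₀ y).comp (dChart x₀ y) = ContinuousLinearMap.id ℝ E := by
  have := isManifold_one (E := E) (M := M)
  have h := mfderivWithin_extChartAt_symm_comp_mfderiv_extChartAt (I := 𝓘(ℝ, E)) hy
  rw [modelWithCornersSelf_coe, Set.range_id, mfderivWithin_univ] at h
  exact h

/-- The tangent space at `x` is identified with the model space by the preferred chart at `x`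
itself. -/
theorem dChart_self (x : M) : dChart x (extChartAt 𝓘(ℝ, E) x x) = ContinuousLinearMap.id ℝ E := by
  have := isManifold_one (E := E) (M := M)
  have h := TangentBundle.continuousLinearMapAt_trivializationAt (𝕜 := ℝ) (I := 𝓘(ℝ, E)) (mem_chart_source E x)
  have h2 := TangentBundle.continuousLinearMapAt_trivializationAt_eq_core (𝕜 := ℝ) (I := 𝓘(ℝ, E)) (mem_chart_source E x)
  rw [dChart, extChartAt_to_inv]
  ext X
  have h3 := tangentCoordChange_self (I := 𝓘(ℝ, E)) (x := x) (z := x) (v := X) (mem_extChartAt_source x)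
  refine Eq.trans ?_ h3
  exact congrArg (fun T : E →L[ℝ] E => T X) (h.symm.trans h2)

theorem dSymm_self (x : M) : dSymm x (extChartAt 𝓘(ℝ, E) x x) = ContinuousLinearMap.id ℝ E := by
  have h := dChart_comp_dSymm (mem_extChartAt_target (I := 𝓘(ℝ, E)) x)
  rwa [dChart_self, ContinuousLinearMap.id_comp] at h

theorem chartEnd_self (A : TangentEnd E M) (x : M) :
    chartEnd A x (extChartAt 𝓘(ℝ, E) x x) = endAt A x := by
  rw [chartEnd, dChart_self, dSymm_self, extChartAt_to_inv]
  rfl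

/-- The trivialization of the endomorphism bundle at `x₀` conjugates by the derivative of the chart,
so smoothness of the section is smoothness of `chartEnd`. -/
theorem contDiffOn_chartEnd {A : TangentEnd E M} (hA : IsComplexStructure A) (x₀ : M) :
    ContDiffOn ℝ ∞ (chartEnd A x₀) (extChartAt 𝓘(ℝ, E) x₀).target := by
  have := isManifold_one (E := E) (M := M)
  let e := trivializationAt (E →L[ℝ] E)
    (fun x : M => TangentSpace 𝓘(ℝ, E) x →L[ℝ] TangentSpace 𝓘(ℝ, E) x) x₀
  intro y hy
  have hx : (extChartAt 𝓘(ℝ, E) x₀).symm y ∈ (chartAt E x₀).source := by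
    rw [← extChartAt_source 𝓘(ℝ, E)]
    exact (extChartAt 𝓘(ℝ, E) x₀).map_target hy
  have h1 : ContMDiffAt 𝓘(ℝ, E) 𝓘(ℝ, E →L[ℝ] E) ∞ (fun x => (e ⟨x, A x⟩).2)
      ((extChartAt 𝓘(ℝ, E) x₀).symm y) :=
    (e.contMDiffAt_section_iff ⟨hx, hx⟩).1 (hA.smooth _)
  have h2 := h1.comp_contMDiffWithinAt y (contMDiffOn_extChartAt_symm (n := ∞) x₀ y hy)
  refine (contMDiffWithinAt_iff_contDiffWithinAt.1 h2).congr_of_mem (fun z hz => ?_) hy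
  have hz' : (extChartAt 𝓘(ℝ, E) x₀).symm z ∈ (chartAt E x₀).source := by
    rw [← extChartAt_source 𝓘(ℝ, E)]
    exact (extChartAt 𝓘(ℝ, E) x₀).map_target hz
  have e1 : (trivializationAt E (TangentSpace 𝓘(ℝ, E)) x₀).continuousLinearMapAt ℝ
      ((extChartAt 𝓘(ℝ, E) x₀).symm z) = dChart x₀ z :=
    TangentBundle.continuousLinearMapAt_trivializationAt hz'
  have e2 : (trivializationAt E (TangentSpace 𝓘(ℝ, E)) x₀).symmL ℝ
      ((extChartAt 𝓘(ℝ, E) x₀).symm z) = dSymm x₀ z := by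
    have h := TangentBundle.symmL_trivializationAt (𝕜 := ℝ) (I := 𝓘(ℝ, E)) hz'
    rw [modelWithCornersSelf_coe, Set.range_id, mfderivWithin_univ,
      (extChartAt 𝓘(ℝ, E) x₀).right_inv hz] at h
    exact h
  have e3 : ((e ⟨(extChartAt 𝓘(ℝ, E) x₀).symm z, A ((extChartAt 𝓘(ℝ, E) x₀).symm z)⟩).2 :
      E →L[ℝ] E) = ((trivializationAt E (TangentSpace 𝓘(ℝ, E)) x₀).continuousLinearMapAt ℝ
      ((extChartAt 𝓘(ℝ, E) x₀).symm z)).comp ((A ((extChartAt 𝓘(ℝ, E) x₀).symm z)).comp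
      ((trivializationAt E (TangentSpace 𝓘(ℝ, E)) x₀).symmL ℝ
      ((extChartAt 𝓘(ℝ, E) x₀).symm z))) := rfl
  refine Eq.trans ?_ e3.symm
  rw [e1, e2]
  rfl

/-- The coordinate vector fields on the coordinate domain. -/
def coordField (x₀ : M) (X : E) : ∀ x : M, TangentSpace 𝓘(ℝ, E) x :=
  fun x => dSymm x₀ (extChartAt 𝓘(ℝ, E) x₀ x) X

theorem contMDiffAt_coordField (x₀ : M) (X : E) :
    ContMDiffAt 𝓘(ℝ, E) 𝓘(ℝ, E).tangent ∞
      (fun y => (coordField x₀ X y : TangentBundle 𝓘(ℝ, E) M)) x₀ := by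
  have := isManifold_one (E := E) (M := M)
  refine (Bundle.contMDiffAt_section x₀).2 ?_
  refine (contMDiffAt_const (c := X)).congr_of_eventuallyEq ?_
  filter_upwards [extChartAt_source_mem_nhds (I := 𝓘(ℝ, E)) x₀] with x hx
  have hx' : x ∈ (chartAt E x₀).source := by rwa [← extChartAt_source 𝓘(ℝ, E)]
  have e1 := TangentBundle.continuousLinearMapAt_trivializationAt (𝕜 := ℝ) (I := 𝓘(ℝ, E)) hx'
  have hy := (extChartAt 𝓘(ℝ, E) x₀).map_source hx
  have e2 := dChart_comp_dSymm hy
  rw [dChart, (extChartAt 𝓘(ℝ, E) x₀).left_inv hx] at e2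
  have e3 := congrArg (fun T => T (coordField x₀ X x)) e1
  have e4 := congrArg (fun T : E →L[ℝ] E => T X) e2
  refine Eq.trans ?_ (e3.trans e4)
  exact (((trivializationAt E (TangentSpace 𝓘(ℝ, E)) x₀).continuousLinearMapAt_apply_of_mem ℝ hx' (y := coordField x₀ X x))).symm

theorem mlieBracket_eq_lieBracket {V W : ∀ x : M, TangentSpace 𝓘(ℝ, E) x} {x : M} {v w : E → E}
    (hv : ∀ y ∈ (extChartAt 𝓘(ℝ, E) x).target,
      V ((extChartAt 𝓘(ℝ, E) x).symm y) = dSymm x y (v y))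
    (hw : ∀ y ∈ (extChartAt 𝓘(ℝ, E) x).target,
      W ((extChartAt 𝓘(ℝ, E) x).symm y) = dSymm x y (w y)) :
    VectorField.mlieBracket 𝓘(ℝ, E) V W x =
      VectorField.lieBracket ℝ v w (extChartAt 𝓘(ℝ, E) x x) := by
  have key {V : ∀ x : M, TangentSpace 𝓘(ℝ, E) x} {v : E → E}
      (hv : ∀ y ∈ (extChartAt 𝓘(ℝ, E) x).target,
        V ((extChartAt 𝓘(ℝ, E) x).symm y) = dSymm x y (v y)) :
      VectorField.mpullbackWithin 𝓘(ℝ, E) 𝓘(ℝ, E) (extChartAt 𝓘(ℝ, E) x).symm V Set.univ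
        =ᶠ[𝓝 (extChartAt 𝓘(ℝ, E) x x)] v := by
    filter_upwards [extChartAt_target_mem_nhds (I := 𝓘(ℝ, E)) x] with y hy
    rw [VectorField.mpullbackWithin_apply, mfderivWithin_univ, hv y hy]
    have e1 : (dSymm x y).inverse = dChart x y :=
      ContinuousLinearMap.inverse_eq (dSymm_comp_dChart hy) (dChart_comp_dSymm hy)
    have e2 := congrArg (fun T : E →L[ℝ] E => T (v y)) (dChart_comp_dSymm hy)
    refine Eq.trans ?_ e2
    exact congrArg (fun T : E →L[ℝ] E => T (dSymm x y (v y))) e1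
  rw [← VectorField.mlieBracketWithin_univ, VectorField.mlieBracketWithin_apply,
    modelWithCornersSelf_coe, Set.range_id, Set.preimage_univ, Set.inter_univ]
  obtain ⟨e, he⟩ : ∃ e : E →L[ℝ] E, e = mfderiv 𝓘(ℝ, E) 𝓘(ℝ, E) (extChartAt 𝓘(ℝ, E) x) x := ⟨_, rfl⟩
  have e1 : e.inverse = ContinuousLinearMap.id ℝ E := by
    have := dChart_self (E := E) x
    rw [dChart, extChartAt_to_inv] at this
    rw [he.trans this, ContinuousLinearMap.inverse_id]
  rw [he] at e1
  have e2 : VectorField.lieBracketWithin ℝ v w Set.univ (extChartAt 𝓘(ℝ, E) x x) =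
      VectorField.lieBracket ℝ v w (extChartAt 𝓘(ℝ, E) x x) := by
    rw [VectorField.lieBracketWithin_univ]
  refine Eq.trans ?_ (((key hv).lieBracketWithin_vectorField_eq_nhds (s := Set.univ) (key hw)).trans e2)
  exact congrArg (fun T : E →L[ℝ] E => T _) e1

/-- Evaluate integrability on coordinate fields: their brackets with each other vanish, and the
remaining ones are derivatives of the coordinate matrix of `A`. -/
theorem chartEnd_nijenhuis {A : TangentEnd E M} (hA : IsComplexStructure A) (x : M) (X Y : E) :
    fderiv ℝ (chartEnd A x) (extChartAt 𝓘(ℝ, E) x x)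
        (chartEnd A x (extChartAt 𝓘(ℝ, E) x x) X) Y -
      fderiv ℝ (chartEnd A x) (extChartAt 𝓘(ℝ, E) x x)
        (chartEnd A x (extChartAt 𝓘(ℝ, E) x x) Y) X +
      chartEnd A x (extChartAt 𝓘(ℝ, E) x x)
        (fderiv ℝ (chartEnd A x) (extChartAt 𝓘(ℝ, E) x x) Y X) -
      chartEnd A x (extChartAt 𝓘(ℝ, E) x x)
        (fderiv ℝ (chartEnd A x) (extChartAt 𝓘(ℝ, E) x x) X Y) = 0 := by
  have hX (X : E) : ∀ y ∈ (extChartAt 𝓘(ℝ, E) x).target,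
      coordField x X ((extChartAt 𝓘(ℝ, E) x).symm y) = dSymm x y ((fun _ => X) y) := by
    intro y hy
    rw [coordField, (extChartAt 𝓘(ℝ, E) x).right_inv hy]
  have hAX (X : E) : ∀ y ∈ (extChartAt 𝓘(ℝ, E) x).target,
      A ((extChartAt 𝓘(ℝ, E) x).symm y) (coordField x X ((extChartAt 𝓘(ℝ, E) x).symm y)) =
        dSymm x y ((fun y => chartEnd A x y X) y) := by
    intro y hy
    rw [hX X y hy]
    exact (congrArg (fun T : E →L[ℝ] E => T (endAt A ((extChartAt 𝓘(ℝ, E) x).symm y)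
      (dSymm x y X))) (dSymm_comp_dChart hy)).symm
  have hd : DifferentiableAt ℝ (chartEnd A x) (extChartAt 𝓘(ℝ, E) x x) :=
    ((contDiffOn_chartEnd hA x).contDiffAt
      (extChartAt_target_mem_nhds (I := 𝓘(ℝ, E)) x)).differentiableAt (by simp)
  have hf (X Y : E) : fderiv ℝ (fun y => chartEnd A x y X) (extChartAt 𝓘(ℝ, E) x x) Y =
      fderiv ℝ (chartEnd A x) (extChartAt 𝓘(ℝ, E) x x) Y X := by
    have := (hd.hasFDerivAt.clm_apply (hasFDerivAt_const X _)).fderiv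
    rw [this]
    simp
  have h1 := hA.integrable (coordField x X) (coordField x Y) x (contMDiffAt_coordField x X)
    (contMDiffAt_coordField x Y)
  rw [mlieBracket_eq_lieBracket (hAX X) (hAX Y), mlieBracket_eq_lieBracket (hAX X) (hX Y),
    mlieBracket_eq_lieBracket (hX X) (hAX Y), mlieBracket_eq_lieBracket (hX X) (hX Y)] at h1
  have h2 : VectorField.lieBracket ℝ (fun y => chartEnd A x y X) (fun y => chartEnd A x y Y)
        (extChartAt 𝓘(ℝ, E) x x)
      - endAt A x (VectorField.lieBracket ℝ (fun y => chartEnd A x y X) (fun _ => Y)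
        (extChartAt 𝓘(ℝ, E) x x))
      - endAt A x (VectorField.lieBracket ℝ (fun _ => X) (fun y => chartEnd A x y Y)
        (extChartAt 𝓘(ℝ, E) x x))
      - VectorField.lieBracket ℝ (fun _ => X) (fun _ => Y) (extChartAt 𝓘(ℝ, E) x x) = 0 := h1
  rw [← chartEnd_self] at h2
  simp only [VectorField.lieBracket, hf, fderiv_fun_const] at h2
  simp at h2
  rw [← h2]
  abel

end Chart

/-! ### The operator `R` on differential forms -/

section Global

open Topology Filter

variable {E : Type*} [NormedAddCommGroup E] [NormedSpace ℝ E]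
  {M : Type*} [TopologicalSpace M] [ChartedSpace E M] [IsManifold 𝓘(ℝ, E) ∞ M]
  {I J K : TangentEnd E M} {k : ℕ}

theorem IsHypercomplex.isQuaternionic (hM : IsHypercomplex I J K) (x : M) :
    IsQuaternionic (endAt I x) (endAt J x) (endAt K x) :=
  ⟨hM.complexI.sq x, hM.complexJ.sq x, hM.mul_IJ x, hM.mul_JI x⟩

theorem dSymm_chartEnd (A : TangentEnd E M) {x₀ : M} {y : E}
    (hy : y ∈ (extChartAt 𝓘(ℝ, E) x₀).target) (X : E) :
    dSymm x₀ y (chartEnd A x₀ y X) = endAt A ((extChartAt 𝓘(ℝ, E) x₀).symm y) (dSymm x₀ y X) :=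
  congrArg (fun T : E →L[ℝ] E => T (endAt A ((extChartAt 𝓘(ℝ, E) x₀).symm y) (dSymm x₀ y X)))
    (dSymm_comp_dChart hy)

theorem dSymm_injective {x₀ : M} {y : E} (hy : y ∈ (extChartAt 𝓘(ℝ, E) x₀).target) :
    Function.Injective (dSymm x₀ y) := fun X Y h => by
  have e (X : E) : dChart x₀ y (dSymm x₀ y X) = X :=
    congrArg (fun T : E →L[ℝ] E => T X) (dChart_comp_dSymm hy)
  rw [← e X, h, e]

theorem IsHypercomplex.isQuaternionic_chartEnd (hM : IsHypercomplex I J K) {x₀ : M} {y : E}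
    (hy : y ∈ (extChartAt 𝓘(ℝ, E) x₀).target) :
    IsQuaternionic (chartEnd I x₀ y) (chartEnd J x₀ y) (chartEnd K x₀ y) := by
  have h := hM.isQuaternionic ((extChartAt 𝓘(ℝ, E) x₀).symm y)
  refine ⟨fun X => ?_, fun X => ?_, fun X => ?_, fun X => ?_⟩ <;> apply dSymm_injective hy <;>
    simp only [dSymm_chartEnd _ hy, map_neg, h.sq_I, h.sq_J, h.mul_IJ, h.mul_JI]

variable [FiniteDimensional ℝ E]

theorem inChart_act {a b : DForm E M k} {z₁ z₂ z₃ z₄ : ℂ} {x₀ : M} {y : E}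
    (hy : y ∈ (extChartAt 𝓘(ℝ, E) x₀).target)
    (h : ∀ x, formAt b x = act (endAt I x) (endAt J x) (endAt K x) k z₁ z₂ z₃ z₄ (formAt a x)) :
    inChart b x₀ y = act (chartEnd I x₀ y) (chartEnd J x₀ y) (chartEnd K x₀ y) k z₁ z₂ z₃ z₄
      (inChart a x₀ y) := by
  rw [inChart_eq, inChart_eq, h]
  refine (ind_compContinuousLinearMap _ _ _ (fun φ => ?_) _).symm
  ext Y
  simp only [mat_apply, ContinuousLinearMap.comp_apply, dSymm_chartEnd _ hy]

theorem IsHypercomplex.inChart_mem_hodge (hM : IsHypercomplex I J K) {p q : ℕ} {a : DForm E M k}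
    (ha : IsFormOfType I p q a) {x₀ : M} {y : E} (hy : y ∈ (extChartAt 𝓘(ℝ, E) x₀).target) :
    inChart a x₀ y ∈ hodge (chartEnd I x₀ y) k p q := by
  rw [mem_hodge_iff (hM.isQuaternionic_chartEnd hy) ha.degree]
  intro z w
  have h (x : M) : (z ^ p * w ^ q) • formAt a x =
      act (endAt I x) (endAt J x) (endAt K x) k z 0 0 w (formAt a x) :=
    ((mem_hodge_iff (hM.isQuaternionic x) ha.degree).1 (ha.type x) z w).symm
  exact (inChart_act (b := fun x => (z ^ p * w ^ q) • formAt a x) hy h).symm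

theorem formAt_formR (hM : IsHypercomplex I J K) {p q : ℕ} {a : DForm E M k}
    (ha : ∀ x, formAt a x ∈ hodge (endAt I x) k p q) (hk : p + q = k) (x : M) :
    formAt (formR I J K p q a) x =
      ringR (endAt I x) (endAt J x) (endAt K x) k (formAt a x) :=
  opR_eq (hM.isQuaternionic x) hk (ha x)

theorem isFormOfType_formR (hM : IsHypercomplex I J K) {p q : ℕ} {a : DForm E M k}
    (ha : IsFormOfType I p q a) : IsFormOfType I (p + q) 0 (formR I J K p q a) := by
  have hR := formAt_formR hM ha.type ha.degree
  refine ⟨ha.degree, fun x₀ => ?_, fun x => ?_⟩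
  · have h1 : ContDiffOn ℝ ∞ (fun y => act (chartEnd I x₀ y) (chartEnd J x₀ y) (chartEnd K x₀ y) k
        1 1 0 0 (inChart a x₀ y)) (extChartAt 𝓘(ℝ, E) x₀).target :=
      ContDiff.comp_contDiffOn (𝕜 := ℝ)
        (f := fun y => ((chartEnd I x₀ y, chartEnd J x₀ y, chartEnd K x₀ y), inChart a x₀ y))
        (contDiff_act (n := ∞) 1 1 0 0) (((contDiffOn_chartEnd hM.complexI x₀).prodMk ((contDiffOn_chartEnd hM.complexJ x₀).prodMk
          (contDiffOn_chartEnd hM.complexK x₀))).prodMk (ha.smooth x₀))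
    exact h1.congr fun y hy => inChart_act hy hR
  · have h1 := ringR_mem_hodge (hM.isQuaternionic x) (formAt a x)
    rw [← hR x] at h1
    obtain rfl := ha.degree
    exact h1

theorem formAt_extD (a : DForm E M k) (x : M) :
    formAt (extD a) x = extDeriv (inChart a x) (extChartAt 𝓘(ℝ, E) x x) := by
  have h : formAt (extD a) x = (extDeriv (inChart a x)
      (extChartAt 𝓘(ℝ, E) x x)).compContinuousLinearMap
        (dChart x (extChartAt 𝓘(ℝ, E) x x)) := by
    rw [dChart, extChartAt_to_inv]
    rfl
  rw [h, dChart_self]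
  ext v
  simp

theorem inChart_pull (J' : TangentEnd E M) (b : DForm E M k) {x₀ : M} {y : E}
    (hy : y ∈ (extChartAt 𝓘(ℝ, E) x₀).target) :
    inChart (fun x => pull k (J' x) (b x)) x₀ y = pull k (chartEnd J' x₀ y) (inChart b x₀ y) := by
  -- The coefficients of `I` and `K` in this matrix are zero, so `J'` can fill their places and no
  -- quaternionic relation is needed.
  have h (x : M) : formAt (fun x => pull k (J' x) (b x)) x =
      act (endAt J' x) (endAt J' x) (endAt J' x) k 0 (-1) 1 0 (formAt b x) :=
    pull_J (V := E) (J := endAt J' x) (formAt b x)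
  rw [inChart_act hy h, pull_J]

theorem formAt_hodgeProj_mem (hM : IsHypercomplex I J K) {p q : ℕ} (hk : p + q = k)
    (b : DForm E M k) (x : M) :
    formAt (fun x => hodgeProj (I x) k p q (b x)) x ∈ hodge (endAt I x) k p q := by
  have h : hodgeProj (endAt I x) k p q (formAt b x) ∈ hodge (endAt I x) k p q := by
    rw [(hodgeProj_eq (hM.isQuaternionic x) hk).2]
    exact comp_mem_hodge (hM.isQuaternionic x) hk _
  exact h

/-- At each point the chart around that very point is used; there the chart derivatives are
identities, and the coordinate statement becomes the global one. -/
theorem formR_del_delbar (hM : IsHypercomplex I J K) {p q : ℕ} {a : DForm E M k}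
    (ha : IsFormOfType I p q a) :
    formR I J K (p + 1) q (del I p q a) = del I (p + q) 0 (formR I J K p q a) ∧
      formR I J K p (q + 1) (delbar I p q a) = delJ I J (formR I J K p q a) := by
  obtain rfl := ha.degree
  have hR := formAt_formR hM ha.type rfl
  have key (x : M) := by
    have hn := extChartAt_target_mem_nhds (I := 𝓘(ℝ, E)) x
    have hd {A : TangentEnd E M} (hA : IsComplexStructure A) :
        DifferentiableAt ℝ (chartEnd A x) (extChartAt 𝓘(ℝ, E) x x) :=
      ((contDiffOn_chartEnd hA x).contDiffAt hn).differentiableAt (by simp)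
    exact ringR_hodgeProj_extDeriv (k := p + q) (I := chartEnd I x) (J := chartEnd J x)
      (K := chartEnd K x) (y₀ := extChartAt 𝓘(ℝ, E) x x)
      (α := inChart a x) (β := inChart (formR I J K p q a) x)
      (γ := inChart (fun y => pull (p + q) (J y) (formR I J K p q a y)) x)
      (by filter_upwards [hn] with y hy using hM.isQuaternionic_chartEnd hy)
      (hd hM.complexI) (hd hM.complexJ) (hd hM.complexK)
      (chartEnd_nijenhuis hM.complexI x) (chartEnd_nijenhuis hM.complexJ x) rfl
      (((ha.smooth x).contDiffAt hn).differentiableAt (by simp))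
      (by filter_upwards [hn] with y hy using hM.inChart_mem_hodge ha hy)
      (by filter_upwards [hn] with y hy using inChart_act hy hR)
      (by
        filter_upwards [hn] with y hy
        rw [inChart_pull _ _ hy, inChart_act hy hR, ringR])
  simp only [chartEnd_self, ← formAt_extD] at key
  constructor
  · funext x
    have h1 := formAt_formR hM (formAt_hodgeProj_mem hM (p := p + 1) (q := q) (by omega) (extD a))
      (by omega) x
    exact h1.trans (key x).1
  · funext x
    have h1 := formAt_formR hM (formAt_hodgeProj_mem hM (p := p) (q := q + 1) (by omega) (extD a))
      (by omega) x
    exact h1.trans (key x).2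

end Global

end Hypercomplex

end

/-! ### The theorem -/

open Hypercomplex in
theorem mainTheorem7
    {E : Type*} [NormedAddCommGroup E] [NormedSpace ℝ E] [FiniteDimensional ℝ E]
    {M : Type*} [TopologicalSpace M] [ChartedSpace E M] [IsManifold 𝓘(ℝ, E) ∞ M]
    (I J K : TangentEnd E M) (hM : IsHypercomplex I J K) :
    -- the objects that enter the construction of `R` are well defined
    (∀ (x : M) (k : ℕ),
      IsCompl (lamPlus (I x) (J x) (K x) k) (lamLow (I x) (J x) (K x) k) ∧
      ∀ p q : ℕ, p + q = k →
        IsCompl (hodge (I x) k p q) (hodgeCompl (I x) k p q) ∧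
        Set.MapsTo (projPlus (I x) (J x) (K x) k) (hodge (I x) k p q)
          (lamPlus (I x) (J x) (K x) k ⊓ hodge (I x) k p q : Submodule ℂ _) ∧
        Set.BijOn (hMul (J x) k p) (hodge (I x) k k 0)
          (lamPlus (I x) (J x) (K x) k ⊓ hodge (I x) k p q : Submodule ℂ _)) ∧
    (∀ (k p q : ℕ) (a : DForm E M k), IsFormOfType I p q a →
      IsFormOfType I (p + q) 0 (formR I J K p q a)) ∧
    -- `R` is multiplicative
    (∀ (k l p q p' q' : ℕ) (a : DForm E M k) (b : DForm E M l),
      IsFormOfType I p q a → IsFormOfType I p' q' b →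
      formR I J K (p + p') (q + q') (fun x => wedge (a x) (b x)) =
        fun x => wedge (formR I J K p q a x) (formR I J K p' q' b x)) ∧
    -- `R` and the real structures
    (∀ (k p q : ℕ) (a : DForm E M k), IsFormOfType I p q a →
      formR I J K q p (fun x => conjForm (a x)) =
        fun x => ((-1 : ℂ) ^ p) • conjForm (pull k (J x) (formR I J K p q a x))) ∧
    -- `R` and the differentials
    (∀ (k p q : ℕ) (a : DForm E M k), IsFormOfType I p q a →
      formR I J K (p + 1) q (del I p q a) = del I (p + q) 0 (formR I J K p q a) ∧
      formR I J K p (q + 1) (delbar I p q a) = delJ I J (formR I J K p q a)) ∧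
    -- `R` and positivity, for either of the two sign conventions for positive `(1,1)`-forms
    (∀ (p : ℕ) (a : DForm E M (2 * p)), IsFormOfType I p p a →
      ((∀ x, a x ∈ productCone {β | IsPositive (I x) β} p) →
        ∀ x, ((-Complex.I) ^ p) • formR I J K p p a x ∈
          productCone {β | IsQPositive (I x) (J x) β} p) ∧
      ((∀ x, a x ∈ productCone {β | IsPositive' (I x) β} p) →
        ∀ x, (Complex.I ^ p) • formR I J K p p a x ∈
          productCone {β | IsQPositive (I x) (J x) β} p)) := by
  -- Apart from smoothness and the differentials the claims are fibrewise; the tangent spaces are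
  -- the model space by definition, hence `V := E` below.
  have hq := hM.isQuaternionic
  refine ⟨fun x k => ⟨isCompl_lamPlus_lamLow (V := E) (hq x) k, fun p q hk =>
      ⟨(hodgeProj_eq (V := E) (hq x) hk).1, mapsTo_projPlus (V := E) (hq x) hk,
        bijOn_hMul (V := E) (hq x) hk⟩⟩,
    fun k p q a ha => isFormOfType_formR hM ha,
    fun k l p q p' q' a b ha hb => funext fun x =>
      opR_wedge (V := E) (hq x) ha.degree hb.degree (ha.type x) (hb.type x),
    fun k p q a ha => funext fun x => opR_conjForm (V := E) (hq x) ha.degree (ha.type x),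
    fun k p q a ha => formR_del_delbar hM ha,
    fun p a ha => ⟨fun h x => ?_, fun h x => ?_⟩⟩
  · have e := opR_eq (V := E) (hq x) ha.degree (ha.type x)
    have h1 := productCone_ringR (V := E) (hq x)
      (fun β hβ => isQPositive_of_isPositive (hq x) hβ) (h x)
    rw [← e] at h1
    exact h1
  · have e := opR_eq (V := E) (hq x) ha.degree (ha.type x)
    have h1 := productCone_ringR (V := E) (hq x)
      (fun β hβ => isQPositive_of_isPositive' (hq x) hβ) (h x)
    rw [← e] at h1
    exact h1
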